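/- For a set $E$ in a metric space let $N(E,\delta)$ be the least number of $\delta$-balls centred in $E$ that cover $E$, and let $\dim_M E=\limsup_{\delta\to0^+}\log N(E,\delta)/\log(1/\delta)$ be its upper Minkowski dimension. For $K\subset\mathbb{R}^2$ and $\delta>0$ let $K_\delta=K+B(0,\delta)$, write $|\cdot|$ for Lebesgue measure on $\mathbb{R}^2$ (and for the Euclidean norm of a vector), and let $$D(K)=\{(k_1,k_2)\in K\times K:\ |k_2-k_1|=1\}\subset\mathbb{R}^2\times\mathbb{R}^2 .$$ For $0<\alpha\le 2$ let $g_2(\alpha)$ be the supremum of $\dim_M D(K)$ over all compact sets $K\subset\mathbb{R}^2$ of Hausdorff dimension $\alpha$ for which there is a constant $C=C(K)$ such that $$|K_\delta\cap B(x,r)|\le C\,(r/\delta)^{\alpha}\,\delta^{2}\qquad\text{for all } x\in\mathbb{R}^2 \text{ and all } r\ge\delta>0 .$$ Then for $0<\alpha\le1$ $$\frac{3\alpha}{2}\le g_2(\alpha)\le\min\Big\{\frac{5\alpha}{3},\ \frac{\alpha(2+\alpha)}{1+\alpha}\Big\};$$ for $1\le\alpha\le 3/2$ we have $g_2(\alpha)=\alpha+\tfrac12$;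 and for $3/2\le\alpha\le2$ we have $g_2(\alpha)=2\alpha-1$. -/

import Mathlib

open Filter Topology MeasureTheory
open scoped NNReal ENNReal

noncomputable section

/-- Upper Minkowski (box-counting) dimension
`limsup_{δ → 0+} log N(E, δ) / log (1/δ)`, where `N(E, δ)` is the least number of closed
`δ`-balls centred in `E` that cover `E`. The empty set has dimension `⊥ = -∞`. -/
def upperMinkowskiDim {X : Type*} [PseudoEMetricSpace X] (E : Set X) : EReal :=
  limsup (fun δ : ℝ≥0 =>
    ENNReal.log (Metric.coveringNumber δ E : ℝ≥0∞) / ((-Real.log (δ : ℝ) : ℝ) : EReal))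
    (𝓝[>] 0)

/-- The unit distance set `D(K) = {(k₁, k₂) ∈ K² : |k₂ - k₁| = 1}`. The metric on the product is
the maximum metric, which is bi-Lipschitz equivalent to the Euclidean one. -/
def unitDistancePairs {d : ℕ} (K : Set (EuclideanSpace ℝ (Fin d))) :
    Set (EuclideanSpace ℝ (Fin d) × EuclideanSpace ℝ (Fin d)) :=
  {p | p.1 ∈ K ∧ p.2 ∈ K ∧ ‖p.2 - p.1‖ = 1}

/-- The open `δ`-neighbourhoods `K_δ` of `K` are `δ`-discrete `α`-sets, uniformly in `δ`:
`|K_δ ∩ B(x, r)| ≤ C (r / δ)^α δ^d` for all `x` and all `r ≥ δ > 0`. -/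
def IsDiscreteAlphaSet {d : ℕ} (α : ℝ) (K : Set (EuclideanSpace ℝ (Fin d))) : Prop :=
  ∃ C : ℝ, ∀ δ : ℝ, 0 < δ → ∀ x : EuclideanSpace ℝ (Fin d), ∀ r : ℝ, δ ≤ r →
    volume (Metric.thickening δ K ∩ Metric.ball x r) ≤
      ENNReal.ofReal (C * (r / δ) ^ α * δ ^ d)

/-- `g_d(α)`: the supremum of the upper Minkowski dimensions of the unit distance sets of the
compact `K ⊆ ℝ^d` of Hausdorff dimension `α` whose neighbourhoods are `δ`-discrete `α`-sets. -/
def unitDistanceDim (d : ℕ) (α : ℝ) : EReal :=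
  sSup {s : EReal | ∃ K : Set (EuclideanSpace ℝ (Fin d)),
    IsCompact K ∧ dimH K = ENNReal.ofReal α ∧ IsDiscreteAlphaSet α K ∧
      s = upperMinkowskiDim (unitDistancePairs K)}

end

/-! Everything reduces to counting at one scale `δ`. A `δ`-net `P` of `K` has `≲ (r / δ) ^ α` points
in each ball of radius `r`, and `N(D(K), δ)` is controlled by the number of pairs of `P` at distance
`1 + O(δ)`.

Upper bound, `α ≤ 1`. Two annuli of radius `1` and width `δ` whose centres are at distance `t ≤ 1/2`
meet in two pieces of diameter `≲ δ / t` (`planar_circle_intersection`), so they share `≲ t ^ (-α)`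
points of `P`. There are `≲ (t / δ) ^ α` centres at distance about `t`, so every dyadic `t`
contributes `δ ^ (-α)`, and Cauchy–Schwarz gives `δ ^ (-3α/2)` pairs up to a logarithmic factor. For
`α ≤ 1` the exponent `3α/2` is at most both terms of the minimum, and it equals the lower bound.

Upper bound, `α ≥ 1`. The smoothed number of pairs is the integral of a Gaussian times `|expSum P|²`
times the Fourier transform of arc length, which is `O(|ξ| ^ (-1/2))`. Replacing this decay by a sum
of Gaussians (`norm_circleTransform_mul_gaussian_le`) bounds the integral by the energies of `P` at
the scales `2 ^ (-j)`, `j ≤ J`, where `δ = 2 ^ (-J)`. The number of pairs is then `≲ δ ^ (1 - 2α) ∑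
2 ^ ((3/2 - α) j)`: the finest scale decides when `α < 3/2` and gives `α + 1/2`, the coarsest
decides when `α > 3/2` and gives `2α - 1`.

Lower bounds. In an interval times a Cantor set of dimension near `α - 1`, the first abscissa and
both ordinates of a unit pair are free, which gives `1 + 2(α - 1)` (`strip_le_unitDistanceDim`). For
`3α/2` and `α + 1/2` the point is that a unit circle stays within `O(δ)` of its tangent along an arc
of length `√δ`: two vertical stacks of height `√δ` at horizontal distance `1` have all mutual
distances `1 + O(δ)`. Replacing each point of the right stack by a cluster of diameter `O(δ)` makes
the distances exactly `1` (`block_le_unitDistanceDim`). Each cluster resembles a Cantor set, so the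
growth condition survives below scale `δ`. Blocks of this kind for a sequence of scales shrink to a
point, and adjoining a product Cantor set fixes the Hausdorff dimension. -/

/-- The Euclidean plane. -/
abbrev Plane := EuclideanSpace ℝ (Fin 2)

/-! ### Regular covers, discrete `α`-sets and Hausdorff dimension -/

/-- `K ∩ B(x, r)` is covered by `≲ (r / ε) ^ α` balls of radius `ε`, for all `0 < ε ≤ r`. -/
def RegularCover (α : ℝ) (K : Set Plane) : Prop :=
  ∃ M : ℝ, ∀ (x : Plane) (ε r : ℝ), 0 < ε → ε ≤ r → ∃ T : Finset Plane,
    (T.card : ℝ) ≤ M * (r / ε) ^ α ∧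
      K ∩ Metric.ball x r ⊆ ⋃ t ∈ T, Metric.closedBall t ε

theorem RegularCover.union {α : ℝ} {K₁ K₂ : Set Plane} (h₁ : RegularCover α K₁)
    (h₂ : RegularCover α K₂) : RegularCover α (K₁ ∪ K₂) := by
  classical
  obtain ⟨M₁, h₁⟩ := h₁
  obtain ⟨M₂, h₂⟩ := h₂
  refine ⟨M₁ + M₂, fun x ε r hε hr => ?_⟩
  obtain ⟨T₁, hc₁, hT₁⟩ := h₁ x ε r hε hr
  obtain ⟨T₂, hc₂, hT₂⟩ := h₂ x ε r hε hr
  refine ⟨T₁ ∪ T₂, ?_, ?_⟩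
  · have : ((T₁ ∪ T₂).card : ℝ) ≤ T₁.card + T₂.card := by exact_mod_cast Finset.card_union_le _ _
    linarith
  · rw [Set.union_inter_distrib_right, Finset.set_biUnion_union]
    exact Set.union_subset_union hT₁ hT₂

/-- A point of `K_δ ∩ B(x, r)` is within `δ ≤ r` of a point of `K ∩ B(x, 2r)`, so doubling the
`δ`-balls that cover the latter covers the former. Passing to the closure costs nothing, since open
neighbourhoods do not change. -/
theorem RegularCover.isDiscreteAlphaSet_closure {α : ℝ} {K : Set Plane} (h : RegularCover α K) :
    IsDiscreteAlphaSet α (closure K) := by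
  obtain ⟨M, h⟩ := h
  refine ⟨4 * Real.pi * M * 2 ^ α, fun δ hδ x r hr => ?_⟩
  have hr0 : 0 < r := hδ.trans_le hr
  obtain ⟨T, hc, hT⟩ := h x δ (2 * r) hδ (by linarith)
  have hsub : Metric.thickening δ (closure K) ∩ Metric.ball x r ⊆
      ⋃ t ∈ T, Metric.ball t (2 * δ) := by
    rintro p ⟨hp, hpx⟩
    rw [Metric.thickening_closure, Metric.mem_thickening_iff] at hp
    obtain ⟨k, hk, hpk⟩ := hp
    have hkx : k ∈ Metric.ball x (2 * r) := by
      rw [Metric.mem_ball] at hpx ⊢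
      linarith [dist_triangle k p x, dist_comm k p]
    have := hT ⟨hk, hkx⟩
    simp only [Set.mem_iUnion] at this ⊢
    obtain ⟨t, ht, hkt⟩ := this
    refine ⟨t, ht, ?_⟩
    rw [Metric.mem_closedBall] at hkt
    rw [Metric.mem_ball]
    linarith [dist_triangle p k t]
  calc volume (Metric.thickening δ (closure K) ∩ Metric.ball x r)
      ≤ volume (⋃ t ∈ T, Metric.ball t (2 * δ)) := measure_mono hsub
    _ ≤ ∑ t ∈ T, volume (Metric.ball t (2 * δ)) := measure_biUnion_finset_le _ _
    _ = T.card * ENNReal.ofReal ((2 * δ) ^ 2 * Real.pi) := by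
        simp only [EuclideanSpace.volume_ball_fin_two, Finset.sum_const, nsmul_eq_mul]
        congr 1
        rw [← ENNReal.ofReal_pow (by positivity), ← ENNReal.ofReal_mul (by positivity)]
    _ = ENNReal.ofReal (T.card * ((2 * δ) ^ 2 * Real.pi)) := by
        rw [ENNReal.ofReal_mul (Nat.cast_nonneg _), ENNReal.ofReal_natCast]
    _ ≤ _ := by
        apply ENNReal.ofReal_le_ofReal
        calc (T.card : ℝ) * ((2 * δ) ^ 2 * Real.pi)
            ≤ (M * (2 * r / δ) ^ α) * ((2 * δ) ^ 2 * Real.pi) := by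
              gcongr
          _ = _ := by
              rw [mul_div_assoc, Real.mul_rpow (by norm_num) (by positivity)]
              ring

/-- Covers by `≲ ε ^ (-α)` closed balls of radius `ε`, along `ε = 1 / (n + 1)`, keep the
`α`-dimensional Hausdorff measure finite. Each such cover is a finite union of closed sets and
therefore covers the closure as well. -/
theorem RegularCover.dimH_closure_le {α : ℝ} (hα : 0 ≤ α) {K : Set Plane} (h : RegularCover α K)
    (hK : Bornology.IsBounded K) : dimH (closure K) ≤ ENNReal.ofReal α := by
  obtain ⟨M, h⟩ := h
  obtain ⟨R, hR⟩ := hK.subset_ball 0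
  set R' : ℝ := max R 1
  have hR' : K ⊆ Metric.ball 0 R' := hR.trans (Metric.ball_subset_ball (le_max_left _ _))
  have hR1 : 1 ≤ R' := le_max_right _ _
  have hε : ∀ n : ℕ, (0 : ℝ) < 1 / ((n : ℝ) + 1) := fun n => by positivity
  have hε1 : ∀ n : ℕ, 1 / ((n : ℝ) + 1) ≤ R' := fun n =>
    (by rw [div_le_one (by positivity)]; linarith [n.cast_nonneg (α := ℝ)] :
      1 / ((n : ℝ) + 1) ≤ 1).trans hR1
  choose T hc hT using fun n : ℕ => h 0 (1 / ((n : ℝ) + 1)) R' (hε n) (hε1 n)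
  have hbound : Measure.hausdorffMeasure (α.toNNReal : ℝ) (closure K) ≤
      ENNReal.ofReal (M * (2 * R') ^ α) := by
    refine (Measure.hausdorffMeasure_le_liminf_sum (ι := fun n => T n) _ (closure K)
      (l := atTop) (fun n : ℕ => ENNReal.ofReal (2 * (1 / ((n : ℝ) + 1)))) ?_
      (fun n i => Metric.closedBall i.1 (1 / ((n : ℝ) + 1))) ?_ ?_).trans ?_
    · have : Tendsto (fun n : ℕ => 2 * (1 / ((n : ℝ) + 1))) atTop (𝓝 (2 * 0)) :=
        tendsto_one_div_add_atTop_nhds_zero_nat.const_mul 2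
      simpa using ENNReal.tendsto_ofReal this
    · refine Eventually.of_forall fun n i => ?_
      refine Metric.ediam_le_of_forall_dist_le fun p hp q hq => ?_
      rw [Metric.mem_closedBall] at hp hq
      linarith [dist_triangle_right p q i.1]
    · refine Eventually.of_forall fun n => ?_
      refine closure_minimal ?_ (isClosed_iUnion_of_finite fun i => Metric.isClosed_closedBall)
      intro p hp
      have := hT n ⟨hp, hR' hp⟩
      simp only [Set.mem_iUnion] at this ⊢
      obtain ⟨t, ht, hpt⟩ := this
      exact ⟨⟨t, ht⟩, hpt⟩
    · refine liminf_le_of_frequently_le' (Frequently.of_forall fun n => ?_)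
      calc ∑ i : T n, Metric.ediam (Metric.closedBall i.1 (1 / ((n : ℝ) + 1))) ^
              ((α.toNNReal : ℝ≥0) : ℝ)
          ≤ ∑ i : T n, ENNReal.ofReal ((2 * (1 / ((n : ℝ) + 1))) ^ α) := by
            refine Finset.sum_le_sum fun i _ => ?_
            rw [Real.coe_toNNReal _ hα, ← ENNReal.ofReal_rpow_of_nonneg (by positivity) hα]
            refine ENNReal.rpow_le_rpow ?_ hα
            refine Metric.ediam_le_of_forall_dist_le fun p hp q hq => ?_
            rw [Metric.mem_closedBall] at hp hq
            linarith [dist_triangle_right p q i.1]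
        _ = ENNReal.ofReal ((T n).card * (2 * (1 / ((n : ℝ) + 1))) ^ α) := by
            rw [ENNReal.ofReal_mul (by positivity), ENNReal.ofReal_natCast]
            simp
        _ ≤ _ := by
            apply ENNReal.ofReal_le_ofReal
            calc _ ≤ (M * (R' / (1 / ((n : ℝ) + 1))) ^ α) * (2 * (1 / ((n : ℝ) + 1))) ^ α := by
                  gcongr
                  exact hc n
              _ = _ := by
                  rw [mul_assoc, ← Real.mul_rpow (by positivity) (by positivity)]
                  congr 2
                  have : ((n : ℝ) + 1) ≠ 0 := by positivity
                  field_simp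
  have := dimH_le_of_hausdorffMeasure_ne_top (ne_top_of_le_ne_top ENNReal.ofReal_ne_top hbound)
  exact this

/-! ### Regularity of sets organised as trees, and coding of cells by residues -/

/-- A set organised as a tree, whose level-`j` pieces have diameter `≲ λ ^ j`, whose `λ ^ j`-balls
meet boundedly many level-`j` pieces and whose pieces have at most `λ ^ (-α)` children, satisfies
`RegularCover α`. -/
theorem regularCover_range_of_tree {I T κ₀ κ : Type*} {α l c : ℝ} (hα : 0 ≤ α) (hl : 0 < l)
    (hl1 : l < 1) (hc : 0 < c) (p : I → Plane) (label : ℕ → I → T) (S₀ : Finset κ₀) (S : Finset κ)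
    (hS : (S.card : ℝ) ≤ l⁻¹ ^ α)
    (hdist : ∀ j i i', label j i = label j i' → dist (p i) (p i') ≤ c * l ^ j)
    (hroot : ∃ code : I → κ₀, (∀ i, code i ∈ S₀) ∧
      ∀ i i', code i = code i' → label 0 i = label 0 i')
    (hball : ∀ (j : ℕ) (x : Plane), ∃ code : I → κ₀, (∀ i, code i ∈ S₀) ∧
      ∀ i i', p i ∈ Metric.ball x (l ^ j) → p i' ∈ Metric.ball x (l ^ j) →
        code i = code i' → label j i = label j i')
    (hstep : ∀ j, ∃ code : I → κ, (∀ i, code i ∈ S) ∧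
      ∀ i i', label j i = label j i' → code i = code i' → label (j + 1) i = label (j + 1) i') :
    RegularCover α (Set.range p) := by
  classical
  choose e heS he using hstep
  have hdet : ∀ (m j : ℕ) (i i' : I), label j i = label j i' →
      (∀ a : Fin m, e (j + a) i = e (j + a) i') → label (j + m) i = label (j + m) i' := by
    intro m
    induction m with
    | zero => intro j i i' h _; simpa using h
    | succ m ih =>
      intro j i i' h h'
      rw [← add_assoc]
      refine he _ _ _ (ih j i i' h fun a => ?_) ?_
      · simpa using h' a.castSucc
      · simpa using h' (Fin.last m)
  have hcover : ∀ (B : Set Plane) (code : I → κ₀) (j m : ℕ), (∀ i, code i ∈ S₀) →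
      (∀ i i', p i ∈ B → p i' ∈ B → code i = code i' → label j i = label j i') →
      ∃ F : Finset Plane, F.card ≤ S₀.card * S.card ^ m ∧
        Set.range p ∩ B ⊆ ⋃ t ∈ F, Metric.closedBall t (c * l ^ (j + m)) := by
    intro B code j m hcode hB
    -- The coarse code fixes the level-`j` piece within `B`, and `m` further digits fix the level-`j
    -- + m` piece. One representative per code word therefore gives the centres of a cover; the
    -- value `0` of `rep` at words that do not occur plays no role.
    let big : I → κ₀ × (Fin m → κ) := fun i => (code i, fun a => e (j + a) i)
    let good : Finset (κ₀ × (Fin m → κ)) := S₀ ×ˢ Fintype.piFinset fun _ => S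
    let rep : κ₀ × (Fin m → κ) → Plane := fun w =>
      if h : ∃ i, p i ∈ B ∧ big i = w then p h.choose else 0
    refine ⟨good.image rep, Finset.card_image_le.trans (by simp [good]), ?_⟩
    rintro _ ⟨⟨i, rfl⟩, hi⟩
    simp only [Set.mem_iUnion, Finset.mem_image]
    have hex : ∃ i', p i' ∈ B ∧ big i' = big i := ⟨i, hi, rfl⟩
    refine ⟨rep (big i), ⟨big i, ?_, rfl⟩, ?_⟩
    · simp [good, big, hcode, heS]
    · simp only [rep, dif_pos hex]
      obtain ⟨h1, h2⟩ := hex.choose_spec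
      rw [Metric.mem_closedBall]
      refine hdist _ _ _ (hdet m j _ _ ?_ fun a => ?_)
      · exact hB _ _ hi h1 (congrArg Prod.fst h2).symm
      · exact (congrFun (congrArg Prod.snd h2) a).symm
  -- The radius is rounded to `l ^ j` and `m` is the least depth with `c * l ^ (j + m) ≤ ε`. Each
  -- rounding loses at most a factor `l`, whence `l⁻¹ ^ 2`; the summand `1` covers the case `m = 0`.
  refine ⟨S₀.card * (1 + (c * l⁻¹ ^ 2) ^ α), fun x ε r hε hr => ?_⟩
  have hr0 : 0 < r := hε.trans_le hr
  have hquot : 1 ≤ r / ε := by rwa [one_le_div hε]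
  obtain ⟨j, hj1, hj2⟩ := exists_nat_pow_near_of_lt_one (lt_min hr0 one_pos) (min_le_right r 1) hl hl1
  have hex : ∃ m : ℕ, c * l ^ (j + m) ≤ ε := by
    obtain ⟨m, hm⟩ := exists_pow_lt_of_lt_one (div_pos hε hc) hl1
    refine ⟨m, ?_⟩
    have : l ^ (j + m) ≤ l ^ m := pow_le_pow_of_le_one hl.le hl1.le (by omega)
    rw [lt_div_iff₀ hc] at hm
    nlinarith
  have hcode : ∃ code : I → κ₀, (∀ i, code i ∈ S₀) ∧ ∀ i i', p i ∈ Metric.ball x r →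
      p i' ∈ Metric.ball x r → code i = code i' → label j i = label j i' := by
    rcases le_or_gt r 1 with h1 | h1
    · obtain ⟨code, h, h'⟩ := hball j x
      rw [min_eq_left h1] at hj2
      exact ⟨code, h, fun i i' hi hi' => h' i i' (Metric.ball_subset_ball hj2 hi)
        (Metric.ball_subset_ball hj2 hi')⟩
    · rw [min_eq_right h1.le] at hj1 hj2
      have hj0 : j = 0 := by
        by_contra hne
        exact absurd hj2 (not_le.2 (pow_lt_one₀ hl.le hl1 hne))
      obtain ⟨code, h, h'⟩ := hroot
      exact ⟨code, h, fun i i' _ _ hcc => hj0 ▸ h' i i' hcc⟩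
  obtain ⟨code, hcS, hcB⟩ := hcode
  obtain ⟨F, hF, hFc⟩ := hcover _ code j (Nat.find hex) hcS hcB
  refine ⟨F, ?_, hFc.trans ?_⟩
  · have hpow : ((S.card : ℝ) ^ Nat.find hex) ≤ (1 + (c * l⁻¹ ^ 2) ^ α) * (r / ε) ^ α := by
      have hrα : 1 ≤ (r / ε) ^ α := Real.one_le_rpow hquot hα
      have hcα : 0 ≤ (c * l⁻¹ ^ 2) ^ α := by positivity
      rcases Nat.eq_zero_or_pos (Nat.find hex) with h0 | hpos
      · rw [h0, pow_zero]
        nlinarith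
      · obtain ⟨m, hm⟩ := Nat.exists_eq_succ_of_ne_zero hpos.ne'
        have hlt : ε < c * l ^ (j + m) := not_le.1 (Nat.find_min hex (by omega))
        have hkey : l⁻¹ ^ (m + 1) ≤ c * l⁻¹ ^ 2 * (r / ε) := by
          have h1 : l ^ (j + 1) ≤ r := hj1.le.trans (min_le_left _ _)
          have h2 : ε * l ≤ c * r * l ^ m := by
            have h3 : c * l ^ (j + m) * l = c * l ^ m * l ^ (j + 1) := by ring
            have h4 : c * l ^ m * l ^ (j + 1) ≤ c * l ^ m * r := by gcongr
            nlinarith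
          rw [inv_pow, inv_pow, inv_le_iff_one_le_mul₀ (by positivity)]
          have : c * (l ^ 2)⁻¹ * (r / ε) * l ^ (m + 1) = (c * r * l ^ m) / (ε * l) := by
            field_simp
            ring
          rw [this, one_le_div (by positivity)]
          exact h2
        calc ((S.card : ℝ) ^ Nat.find hex) ≤ (l⁻¹ ^ α) ^ (m + 1) := by
              rw [hm]; gcongr
          _ = (l⁻¹ ^ (m + 1)) ^ α := by
              rw [← Real.rpow_natCast, ← Real.rpow_natCast, ← Real.rpow_mul (by positivity),
                ← Real.rpow_mul (by positivity), mul_comm]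
          _ ≤ (c * l⁻¹ ^ 2 * (r / ε)) ^ α := by gcongr
          _ = (c * l⁻¹ ^ 2) ^ α * (r / ε) ^ α := Real.mul_rpow (by positivity) (by positivity)
          _ ≤ _ := by nlinarith
    calc (F.card : ℝ) ≤ S₀.card * (S.card : ℝ) ^ Nat.find hex := by exact_mod_cast hF
      _ ≤ S₀.card * ((1 + (c * l⁻¹ ^ 2) ^ α) * (r / ε) ^ α) := by gcongr
      _ = _ := by ring
  · exact Set.iUnion₂_mono fun t _ => Metric.closedBall_subset_closedBall (Nat.find_spec hex)

theorem Plane.dist_le (x y : Plane) : dist x y ≤ |x 0 - y 0| + |x 1 - y 1| := by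
  rw [EuclideanSpace.dist_eq, Fin.sum_univ_two, Real.dist_eq, Real.dist_eq]
  refine Real.sqrt_le_iff.2 ⟨by positivity, ?_⟩
  nlinarith [abs_nonneg (x 0 - y 0), abs_nonneg (x 1 - y 1)]

theorem Plane.abs_sub_le (x y : Plane) (i : Fin 2) : |x i - y i| ≤ dist x y := by
  rw [dist_eq_norm]
  simpa using PiLp.norm_apply_le (x - y) i

/-- Floors of numbers at distance `≤ C` differ by less than `C + 1`, so their residues modulo `m ≥ C
+ 1` tell them apart. Residues thus name, with a bounded alphabet, the cells met by a ball of
comparable size. -/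
theorem Int.floor_eq_of_emod_eq {x y C : ℝ} {m : ℕ} (h : |x - y| ≤ C) (hm : C + 1 ≤ m)
    (hmod : ⌊x⌋ % (m : ℤ) = ⌊y⌋ % (m : ℤ)) : ⌊x⌋ = ⌊y⌋ := by
  have hd : (m : ℤ) ∣ ⌊x⌋ - ⌊y⌋ := Int.ModEq.dvd (Eq.symm hmod)
  have hlt : |⌊x⌋ - ⌊y⌋| < (m : ℤ) := by
    have : (|((⌊x⌋ - ⌊y⌋ : ℤ) : ℝ)|) < m := by
      push_cast
      rw [abs_le] at h
      rw [abs_lt]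
      constructor <;>
        linarith [Int.floor_le x, Int.lt_floor_add_one x, Int.floor_le y, Int.lt_floor_add_one y]
    exact_mod_cast this
  have := Int.eq_zero_of_abs_lt_dvd hd hlt
  omega

theorem abs_sub_lt_of_floor_emod_eq {x y s C : ℝ} {m : ℕ} (hs : 0 < s) (h : |x - y| ≤ C * s)
    (hm : C + 1 ≤ m) (hmod : ⌊x / s⌋ % (m : ℤ) = ⌊y / s⌋ % (m : ℤ)) : |x - y| < s := by
  have hdiv : |x / s - y / s| ≤ C := by
    rw [← sub_div, abs_div, abs_of_pos hs, div_le_iff₀ hs]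
    exact h
  have := Int.abs_sub_lt_one_of_floor_eq_floor (Int.floor_eq_of_emod_eq hdiv hm hmod)
  rwa [← sub_div, abs_div, abs_of_pos hs, div_lt_one hs] at this

/-! ### Product Cantor sets of prescribed dimension -/

/-- The points `∑ bᵢ l ^ i` with `bᵢ ∈ {0, 1}`. -/
noncomputable def cantorSum (l : ℝ) (b : ℕ → Fin 2) : ℝ := ∑' i, (b i : ℝ) * l ^ i

section CantorSum

variable {l : ℝ}

theorem Fin.two_cast_sub_abs_le (a b : Fin 2) : |((a : ℕ) : ℝ) - ((b : ℕ) : ℝ)| ≤ 1 := by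
  fin_cases a <;> fin_cases b <;> simp

theorem summable_cantorSum_sub (hl : 0 < l) (hl1 : l < 1) (b b' : ℕ → Fin 2) :
    Summable fun i => ((b i : ℝ) - (b' i : ℝ)) * l ^ i := by
  refine Summable.of_norm_bounded (summable_geometric_of_lt_one hl.le hl1) fun i => ?_
  rw [Real.norm_eq_abs, abs_mul, abs_of_pos (pow_pos hl i)]
  exact mul_le_of_le_one_left (pow_pos hl i).le (Fin.two_cast_sub_abs_le _ _)

theorem summable_cantorSum (hl : 0 < l) (hl1 : l < 1) (b : ℕ → Fin 2) :
    Summable fun i => (b i : ℝ) * l ^ i := by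
  simpa using summable_cantorSum_sub hl hl1 b (fun _ => 0)

theorem cantorSum_sub_eq_tsum (hl : 0 < l) (hl1 : l < 1) {b b' : ℕ → Fin 2} {n : ℕ}
    (h : ∀ i < n, b i = b' i) :
    cantorSum l b - cantorSum l b' =
      ∑' i, ((b (i + n) : ℝ) - (b' (i + n) : ℝ)) * l ^ (i + n) := by
  have hs := summable_cantorSum_sub hl hl1 b b'
  rw [cantorSum, cantorSum, ← (summable_cantorSum hl hl1 b).tsum_sub (summable_cantorSum hl hl1 b')]
  simp_rw [← sub_mul]
  rw [← hs.sum_add_tsum_nat_add n, Finset.sum_eq_zero, zero_add]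
  intro i hi
  rw [h i (Finset.mem_range.1 hi), sub_self, zero_mul]

theorem abs_tsum_digit_sub_le (hl : 0 < l) (hl1 : l < 1) (b b' : ℕ → Fin 2) (n : ℕ) :
    |∑' i, ((b (i + n) : ℝ) - (b' (i + n) : ℝ)) * l ^ (i + n)| ≤ l ^ n / (1 - l) := by
  have hg : HasSum (fun i => l ^ (i + n)) (l ^ n / (1 - l)) := by
    have := (hasSum_geometric_of_lt_one hl.le hl1).mul_right (l ^ n)
    simpa [pow_add, div_eq_mul_inv, mul_comm] using this
  rw [← Real.norm_eq_abs]
  refine tsum_of_norm_bounded hg fun i => ?_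
  rw [Real.norm_eq_abs, abs_mul, abs_of_pos (pow_pos hl _)]
  exact mul_le_of_le_one_left (pow_pos hl _).le (Fin.two_cast_sub_abs_le _ _)

theorem abs_cantorSum_sub_le (hl : 0 < l) (hl1 : l < 1) {b b' : ℕ → Fin 2} {n : ℕ}
    (h : ∀ i < n, b i = b' i) : |cantorSum l b - cantorSum l b'| ≤ l ^ n / (1 - l) := by
  rw [cantorSum_sub_eq_tsum hl hl1 h]
  exact abs_tsum_digit_sub_le hl hl1 b b' n

/-- The first differing digit contributes exactly `l ^ n`, and the later ones at most `l ^ (n + 1) /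
(1 - l)`. The difference is a positive multiple of `l ^ n` as soon as `l < 1/2`, so nearby points
share their leading digits. -/
theorem le_abs_cantorSum_sub (hl : 0 < l) (hl1 : l < 1) {b b' : ℕ → Fin 2} {n : ℕ}
    (h : ∀ i < n, b i = b' i) (hn : b n ≠ b' n) :
    (1 - 2 * l) / (1 - l) * l ^ n ≤ |cantorSum l b - cantorSum l b'| := by
  have hs := (summable_nat_add_iff n).2 (summable_cantorSum_sub hl hl1 b b')
  have h1 := cantorSum_sub_eq_tsum hl hl1 h
  rw [hs.tsum_eq_zero_add] at h1
  have h2 := abs_tsum_digit_sub_le hl hl1 b b' (n + 1)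
  simp only [zero_add, add_assoc, add_comm 1 n] at h1
  have h3 : |((b n : ℝ) - (b' n : ℝ)) * l ^ n| = l ^ n := by
    rw [abs_mul, abs_of_pos (pow_pos hl n)]
    have : |((b n : ℕ) : ℝ) - ((b' n : ℕ) : ℝ)| = 1 := by
      revert hn
      generalize b n = a
      generalize b' n = a'
      fin_cases a <;> fin_cases a' <;> simp
    rw [this, one_mul]
  rw [h1]
  have h4 : (1 - 2 * l) / (1 - l) * l ^ n = l ^ n - l ^ (n + 1) / (1 - l) := by
    have : 1 - l ≠ 0 := by linarith
    field_simp
    ring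
  rw [h4]
  have h5 := abs_sub_abs_le_abs_add
    (((b n : ℝ) - (b' n : ℝ)) * l ^ n)
    (∑' i, ((b (i + (n + 1)) : ℝ) - (b' (i + (n + 1)) : ℝ)) * l ^ (i + (n + 1)))
  rw [h3] at h5
  linarith

theorem exists_first_difference {b b' : ℕ → Fin 2} (h : b ≠ b') :
    ∃ n, (∀ i < n, b i = b' i) ∧ b n ≠ b' n := by
  classical
  have hex : ∃ n, b n ≠ b' n := Function.ne_iff.1 h
  exact ⟨Nat.find hex, fun i hi => not_not.1 (Nat.find_min hex hi), Nat.find_spec hex⟩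

theorem agree_of_abs_cantorSum_sub_lt (hl : 0 < l) (hl2 : l < 1 / 2) {b b' : ℕ → Fin 2} {j : ℕ}
    (h : |cantorSum l b - cantorSum l b'| < (1 - 2 * l) / (1 - l) * l ^ j) :
    ∀ i < j, b i = b' i := by
  by_contra! hne
  obtain ⟨i₀, hi₀, hne⟩ := hne
  obtain ⟨n, hn, hn'⟩ := exists_first_difference (fun heq => hne (congrFun heq i₀))
  have hnj : n ≤ j := by
    by_contra! hlt
    exact hne (hn i₀ (by omega))
  have h1 := le_abs_cantorSum_sub hl (by linarith) hn hn'
  have h2 : l ^ j ≤ l ^ n := pow_le_pow_of_le_one hl.le (by linarith) hnj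
  have h3 : 0 ≤ (1 - 2 * l) / (1 - l) := div_nonneg (by linarith) (by linarith)
  nlinarith

end CantorSum

/-- The point of the product Cantor set with digit sequences `i.1` and `i.2`. -/
noncomputable def cantorPoint (l : ℝ) (i : (ℕ → Fin 2) × (ℕ → Fin 2)) : Plane :=
  !₂[cantorSum l i.1, cantorSum l i.2]

theorem regularCover_range_cantorPoint {α l : ℝ} (hα : 0 ≤ α) (hl : 0 < l) (hl2 : l < 1 / 2)
    (h4 : 4 ≤ l⁻¹ ^ α) : RegularCover α (Set.range (cantorPoint l)) := by
  set κ : ℝ := (1 - 2 * l) / (1 - l) with hκ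
  have hκ0 : 0 < κ := div_pos (by linarith) (by linarith)
  -- Two points of a ball of radius `l ^ j` differ by at most `2 * l ^ j` in each coordinate, that
  -- is by `2 / κ` meshes of size `κ * l ^ j`, and points in a common mesh agree in their first `j`
  -- digits.
  set m : ℕ := ⌈2 / κ⌉₊ + 1 with hm
  have hmle : 2 / κ + 1 ≤ m := by
    rw [hm]; push_cast; linarith [Nat.le_ceil (2 / κ)]
  let label : ℕ → (ℕ → Fin 2) × (ℕ → Fin 2) → (ℕ → Fin 2) × (ℕ → Fin 2) := fun j i =>
    (fun n => if n < j then i.1 n else 0, fun n => if n < j then i.2 n else 0)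
  have hlabel : ∀ j i i', label j i = label j i' ↔
      (∀ n < j, i.1 n = i'.1 n) ∧ ∀ n < j, i.2 n = i'.2 n := by
    intro j i i'
    simp only [label, Prod.mk.injEq, funext_iff]
    refine and_congr ?_ ?_ <;>
    · refine forall_congr' fun n => ?_
      by_cases hn : n < j <;> simp [hn]
  have hm0 : (0 : ℤ) < m := by exact_mod_cast Nat.succ_pos _
  let S₀ : Finset (ℤ × ℤ) := Finset.Ico 0 (m : ℤ) ×ˢ Finset.Ico 0 (m : ℤ)
  refine regularCover_range_of_tree hα hl (by linarith) (c := 2 / (1 - l))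
    (div_pos two_pos (by linarith)) (cantorPoint l) label S₀
    (Finset.univ : Finset (Fin 2 × Fin 2)) (by simpa using by linarith) ?_ ?_ ?_ ?_
  · intro j i i' h
    rw [hlabel] at h
    refine (Plane.dist_le _ _).trans ?_
    have h1 := abs_cantorSum_sub_le hl (by linarith) h.1
    have h2 := abs_cantorSum_sub_le hl (by linarith) h.2
    simp only [cantorPoint]
    calc _ ≤ l ^ j / (1 - l) + l ^ j / (1 - l) := add_le_add (by simpa using h1) (by simpa using h2)
      _ = _ := by ring
  · refine ⟨fun _ => (0, 0), fun _ => by simpa [S₀] using hm0, fun i i' _ => ?_⟩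
    simp [hlabel]
  · intro j x
    refine ⟨fun i => (⌊cantorSum l i.1 / (κ * l ^ j)⌋ % (m : ℤ),
      ⌊cantorSum l i.2 / (κ * l ^ j)⌋ % (m : ℤ)), fun i => ?_, ?_⟩
    · simp [S₀, Int.emod_nonneg _ hm0.ne', Int.emod_lt_of_pos _ hm0]
    · intro i i' hi hi' hcode
      rw [Prod.mk.injEq] at hcode
      have hd : dist (cantorPoint l i) (cantorPoint l i') ≤ 2 * l ^ j := by
        rw [Metric.mem_ball] at hi hi'
        linarith [dist_triangle_right (cantorPoint l i) (cantorPoint l i') x]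
      have hs : 0 < κ * l ^ j := by positivity
      have h2 : 2 * l ^ j = 2 / κ * (κ * l ^ j) := by field_simp
      rw [hlabel]
      constructor
      · refine agree_of_abs_cantorSum_sub_lt hl hl2
          (abs_sub_lt_of_floor_emod_eq (C := 2 / κ) hs ?_ hmle hcode.1)
        have := (Plane.abs_sub_le (cantorPoint l i) (cantorPoint l i') 0).trans hd
        rw [← h2]
        simpa [cantorPoint] using this
      · refine agree_of_abs_cantorSum_sub_lt hl hl2
          (abs_sub_lt_of_floor_emod_eq (C := 2 / κ) hs ?_ hmle hcode.2)
        have := (Plane.abs_sub_le (cantorPoint l i) (cantorPoint l i') 1).trans hd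
        rw [← h2]
        simpa [cantorPoint] using this
  · intro j
    refine ⟨fun i => (i.1 j, i.2 j), fun _ => Finset.mem_univ _, fun i i' h hcode => ?_⟩
    rw [hlabel] at h ⊢
    rw [Prod.mk.injEq] at hcode
    refine ⟨fun n hn => ?_, fun n hn => ?_⟩
    · rcases Nat.lt_succ_iff_lt_or_eq.1 hn with h' | rfl
      exacts [h.1 n h', hcode.1]
    · rcases Nat.lt_succ_iff_lt_or_eq.1 hn with h' | rfl
      exacts [h.2 n h', hcode.2]

theorem isBounded_range_cantorPoint {l : ℝ} (hl : 0 < l) (hl1 : l < 1) :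
    Bornology.IsBounded (Set.range (cantorPoint l)) := by
  refine Metric.isBounded_iff.2 ⟨2 / (1 - l), ?_⟩
  rintro _ ⟨i, rfl⟩ _ ⟨i', rfl⟩
  refine (Plane.dist_le _ _).trans ?_
  have h1 := abs_cantorSum_sub_le hl hl1 (n := 0) (b := i.1) (b' := i'.1) (by simp)
  have h2 := abs_cantorSum_sub_le hl hl1 (n := 0) (b := i.2) (b' := i'.2) (by simp)
  calc _ ≤ l ^ 0 / (1 - l) + l ^ 0 / (1 - l) :=
        add_le_add (by simpa [cantorPoint] using h1) (by simpa [cantorPoint] using h2)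
    _ = _ := by ring

/-- If the digits first differ at place `n`, the binary expansions differ by at most `2 ^ (-n) = (l
^ n) ^ a`, while the Cantor points differ by a multiple of `l ^ n`. Reading Cantor digits in base
two is therefore `a`-Hölder. -/
theorem abs_ofDigits_sub_le_rpow {l a : ℝ} (hl : 0 < l) (hl2 : l < 1 / 2) (ha : 0 < a)
    (hla : l ^ a = 1 / 2) (b b' : ℕ → Fin 2) :
    |Real.ofDigits b - Real.ofDigits b'| ≤
      ((1 - 2 * l) / (1 - l))⁻¹ ^ a * |cantorSum l b - cantorSum l b'| ^ a := by
  have hκ0 : 0 < (1 - 2 * l) / (1 - l) := div_pos (by linarith) (by linarith)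
  rcases eq_or_ne b b' with rfl | hne
  · simp only [sub_self, abs_zero]
    positivity
  · obtain ⟨n, hn, hn'⟩ := exists_first_difference hne
    have h1 := le_abs_cantorSum_sub hl (by linarith) hn hn'
    have h2 : |Real.ofDigits b - Real.ofDigits b'| ≤ ((2 : ℝ)⁻¹) ^ n := by
      simpa using Real.abs_ofDigits_sub_ofDigits_le (x := b) (y := b') (n := n) hn
    calc _ ≤ ((2 : ℝ)⁻¹) ^ n := h2
      _ = (l ^ n) ^ a := by
          rw [← Real.rpow_natCast, ← Real.rpow_natCast, ← Real.rpow_mul hl.le, mul_comm,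
            Real.rpow_mul hl.le, hla, one_div]
      _ ≤ (((1 - 2 * l) / (1 - l))⁻¹ * |cantorSum l b - cantorSum l b'|) ^ a := by
          refine Real.rpow_le_rpow (by positivity) ?_ ha.le
          rw [inv_mul_eq_div, le_div_iff₀ hκ0]
          linarith
      _ = _ := Real.mul_rpow (by positivity) (by positivity)

/-- An `a`-Hölder map multiplies the Hausdorff dimension by at most `1 / a`. Reading digits in base
two maps the Cantor set onto a set containing the open unit square, which has dimension `2`. -/
theorem le_dimH_range_cantorPoint {l : ℝ} {a : ℝ≥0} (hl : 0 < l) (hl2 : l < 1 / 2) (ha : 0 < a)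
    (hla : l ^ (a : ℝ) = 1 / 2) : 2 * (a : ℝ≥0∞) ≤ dimH (Set.range (cantorPoint l)) := by
  set κ : ℝ := ((1 - 2 * l) / (1 - l))⁻¹ ^ (a : ℝ) with hκ
  have hκ0 : 0 ≤ κ := by
    have : 0 < (1 - 2 * l) / (1 - l) := div_pos (by linarith) (by linarith)
    positivity
  let q : (ℕ → Fin 2) × (ℕ → Fin 2) → Plane := fun i => !₂[Real.ofDigits i.1, Real.ofDigits i.2]
  have hq : ∀ i i', dist (q i) (q i') ≤
      (2 * κ) * dist (cantorPoint l i) (cantorPoint l i') ^ (a : ℝ) := by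
    intro i i'
    refine (Plane.dist_le _ _).trans ?_
    have h1 := abs_ofDigits_sub_le_rpow hl hl2 (a := a) (by exact_mod_cast ha) hla i.1 i'.1
    have h2 := abs_ofDigits_sub_le_rpow hl hl2 (a := a) (by exact_mod_cast ha) hla i.2 i'.2
    have e1 : |cantorSum l i.1 - cantorSum l i'.1| ≤ dist (cantorPoint l i) (cantorPoint l i') := by
      simpa [cantorPoint] using Plane.abs_sub_le (cantorPoint l i) (cantorPoint l i') 0
    have e2 : |cantorSum l i.2 - cantorSum l i'.2| ≤ dist (cantorPoint l i) (cantorPoint l i') := by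
      simpa [cantorPoint] using Plane.abs_sub_le (cantorPoint l i) (cantorPoint l i') 1
    have f1 := mul_le_mul_of_nonneg_left (Real.rpow_le_rpow (abs_nonneg _) e1 a.coe_nonneg) hκ0
    have f2 := mul_le_mul_of_nonneg_left (Real.rpow_le_rpow (abs_nonneg _) e2 a.coe_nonneg) hκ0
    have g1 : |q i 0 - q i' 0| = |Real.ofDigits i.1 - Real.ofDigits i'.1| := by simp [q]
    have g2 : |q i 1 - q i' 1| = |Real.ofDigits i.2 - Real.ofDigits i'.2| := by simp [q]
    rw [g1, g2]
    linarith
  -- A digit sequence is chosen for each Cantor point. The Hölder bound `hq` shows that `q` depends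
  -- only on the Cantor point, so the choice does not affect the image.
  choose! inv hinv using fun x (hx : x ∈ Set.range (cantorPoint l)) => hx
  have hhol : HolderOnWith (2 * κ).toNNReal a (q ∘ inv) (Set.range (cantorPoint l)) := by
    intro x hx y hy
    have := hq (inv x) (inv y)
    rw [hinv x hx, hinv y hy] at this
    rw [edist_dist, edist_dist, ENNReal.ofReal_rpow_of_nonneg dist_nonneg a.coe_nonneg]
    change _ ≤ ENNReal.ofReal (2 * κ) * _
    rw [← ENNReal.ofReal_mul (by positivity)]
    exact ENNReal.ofReal_le_ofReal this
  have himg : (q ∘ inv) '' Set.range (cantorPoint l) = Set.range q := by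
    ext y
    constructor
    · rintro ⟨x, _, rfl⟩
      exact ⟨_, rfl⟩
    · rintro ⟨i, rfl⟩
      refine ⟨cantorPoint l i, ⟨i, rfl⟩, ?_⟩
      have := hq (inv (cantorPoint l i)) i
      rw [hinv _ ⟨i, rfl⟩, dist_self, Real.zero_rpow (by exact_mod_cast ha.ne'), mul_zero] at this
      exact dist_le_zero.1 this
  have hdim : dimH (Set.range q) = 2 := by
    have hmem : Set.range q ∈ 𝓝 (!₂[(1 / 2 : ℝ), 1 / 2] : Plane) := by
      have hopen : IsOpen {x : Plane | (0 < x 0 ∧ x 0 < 1) ∧ 0 < x 1 ∧ x 1 < 1} := by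
        have c0 : Continuous fun x : Plane => x 0 := by fun_prop
        have c1 : Continuous fun x : Plane => x 1 := by fun_prop
        exact ((isOpen_lt continuous_const c0).inter (isOpen_lt c0 continuous_const)).inter
          ((isOpen_lt continuous_const c1).inter (isOpen_lt c1 continuous_const))
      refine mem_of_superset (hopen.mem_nhds (by norm_num)) ?_
      rintro x ⟨⟨h1, h2⟩, h3, h4⟩
      obtain ⟨b, -, hb⟩ := Real.ofDigits_SurjOn (b := 2) (by norm_num) ⟨h1.le, h2.le⟩
      obtain ⟨b', -, hb'⟩ := Real.ofDigits_SurjOn (b := 2) (by norm_num) ⟨h3.le, h4.le⟩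
      refine ⟨(b, b'), ?_⟩
      ext k
      fin_cases k
      · simpa [q] using hb
      · simpa [q] using hb'
    simpa using Real.dimH_of_mem_nhds hmem
  have := hhol.dimH_image_le ha
  rw [himg, hdim, ENNReal.le_div_iff_mul_le (Or.inl (by exact_mod_cast ha.ne'))
    (Or.inl ENNReal.coe_ne_top)] at this
  exact this

/-- Every `α ∈ (0, 2)` is a lower bound for the Hausdorff dimension of a bounded set with `RegularCover α`. -/
theorem exists_regularCover_le_dimH {α : ℝ} (hα : 0 < α) (hα2 : α < 2) :
    ∃ K : Set Plane, Bornology.IsBounded K ∧ RegularCover α K ∧ ENNReal.ofReal α ≤ dimH K := by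
  -- With this ratio four children fill dimension `α` exactly, `4 * l ^ α = 1`, and `l ^ (α / 2) = 1
  -- / 2` is the Hölder relation. The condition `l < 1/2` amounts to `α < 2`.
  set l : ℝ := 2 ^ (-(2 / α)) with hldef
  have hl : 0 < l := by positivity
  have hl2 : l < 1 / 2 := by
    have : l < 2 ^ (-1 : ℝ) := by
      refine Real.rpow_lt_rpow_of_exponent_lt one_lt_two ?_
      rw [neg_lt_neg_iff, lt_div_iff₀ hα]
      linarith
    rwa [Real.rpow_neg_one, ← one_div] at this
  refine ⟨Set.range (cantorPoint l), isBounded_range_cantorPoint hl (by linarith),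
    regularCover_range_cantorPoint hα.le hl hl2 ?_, ?_⟩
  · rw [hldef, Real.rpow_neg two_pos.le, inv_inv, ← Real.rpow_mul two_pos.le, div_mul_cancel₀ _ hα.ne']
    norm_num
  · have ha : 0 < (α / 2).toNNReal := Real.toNNReal_pos.2 (by linarith)
    have := le_dimH_range_cantorPoint hl hl2 ha (by
      rw [Real.coe_toNNReal _ (by linarith), hldef, ← Real.rpow_mul two_pos.le,
        show -(2 / α) * (α / 2) = -1 by field_simp, Real.rpow_neg_one, one_div])
    refine le_trans (le_of_eq ?_) this
    change _ = 2 * ENNReal.ofReal (α / 2)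
    rw [show (2 : ℝ≥0∞) = ENNReal.ofReal 2 by simp, ← ENNReal.ofReal_mul two_pos.le]
    congr 1
    ring

/-! ### Bounding the upper Minkowski dimension from below and from above -/

/-- Separated subsets at a sequence of scales bound the upper Minkowski dimension from below. -/
theorem le_upperMinkowskiDim {X : Type*} [MetricSpace X] {E : Set X} {t : ℝ} (δ : ℕ → ℝ)
    (hδ : Tendsto δ atTop (𝓝 0)) (hδ0 : ∀ k, 0 < δ k) (P : ℕ → Finset X)
    (hP : ∀ k, ↑(P k) ⊆ E)
    (hsep : ∀ k, (P k : Set X).Pairwise fun x y => 2 * δ k < dist x y)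
    (hcard : ∀ τ < t, ∀ᶠ k in atTop, δ k ^ (-τ) ≤ (P k).card) :
    (t : EReal) ≤ upperMinkowskiDim E := by
  refine EReal.ge_of_forall_gt_iff_ge.1 fun τ hτ => ?_
  replace hτ : τ < t := by exact_mod_cast hτ
  refine le_limsup_of_frequently_le' ?_
  have hlim : Tendsto (fun k => (δ k).toNNReal) atTop (𝓝[>] 0) := by
    refine tendsto_nhdsWithin_iff.2 ⟨?_, Eventually.of_forall fun k => Real.toNNReal_pos.2 (hδ0 k)⟩
    simpa [Function.comp_def] using (continuous_real_toNNReal.tendsto 0).comp hδ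
  refine hlim.frequently (Eventually.frequently ?_)
  filter_upwards [hcard τ hτ, hδ.eventually_lt_const one_pos] with k hk hk1
  have hlog : 0 < -Real.log (δ k) := by
    have := Real.log_neg (hδ0 k) hk1
    linarith
  have hN : ((P k).card : ℕ∞) ≤ Metric.coveringNumber (δ k).toNNReal E := by
    refine le_trans ?_ (Metric.externalCoveringNumber_le_coveringNumber _ _)
    refine le_trans ?_ (Metric.packingNumber_two_mul_le_externalCoveringNumber _ _)
    rw [← Set.encard_coe_eq_coe_finsetCard]
    refine Metric.IsSeparated.encard_le_packingNumber (hP k) fun x hx y hy hxy => ?_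
    have : 2 * δ k < dist x y := hsep k hx hy hxy
    change _ < edist x y
    rw [edist_dist]
    have e : ((2 * (δ k).toNNReal : ℝ≥0) : ℝ≥0∞) = ENNReal.ofReal (2 * δ k) := by
      rw [ENNReal.ofReal_mul two_pos.le]
      simp [ENNReal.ofReal]
    rw [e]
    exact (ENNReal.ofReal_lt_ofReal_iff_of_nonneg (by linarith [hδ0 k])).2 this
  simp only [Real.coe_toNNReal _ (hδ0 k).le]
  rw [EReal.le_div_iff_mul_le (by exact_mod_cast hlog) (EReal.coe_ne_top _)]
  have h1 : ENNReal.ofReal (δ k ^ (-τ)) ≤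
      (Metric.coveringNumber (δ k).toNNReal E : ℝ≥0∞) := by
    calc ENNReal.ofReal (δ k ^ (-τ)) ≤ ENNReal.ofReal ((P k).card) := ENNReal.ofReal_le_ofReal hk
      _ = (((P k).card : ℕ∞) : ℝ≥0∞) := by simp
      _ ≤ _ := by exact_mod_cast hN
  refine le_trans (le_of_eq ?_) (ENNReal.log_le_log h1)
  rw [ENNReal.log_ofReal_of_pos (Real.rpow_pos_of_pos (hδ0 k) _), Real.log_rpow (hδ0 k),
    ← EReal.coe_mul]
  congr 1
  ring

/-- Any exponent `τ > t` absorbs the constant and the linear factor `J + 1`, which leaves room for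
the logarithmic losses of the counting arguments. A general `δ` in `(2 ^ (-(J + 1)), 2 ^ (-J)]` is
compared with the finer dyadic scale. -/
theorem upperMinkowskiDim_le {X : Type*} [PseudoEMetricSpace X] {E : Set X} {t C : ℝ} (ht : 0 ≤ t)
    (h : ∀ J : ℕ, (Metric.coveringNumber ((2 : ℝ≥0)⁻¹ ^ J) E : ℝ≥0∞) ≤
      ENNReal.ofReal (C * (J + 1) * 2 ^ (t * J))) :
    upperMinkowskiDim E ≤ (t : EReal) := by
  refine EReal.le_of_forall_lt_iff_le.1 fun τ hτ => ?_
  replace hτ : t < τ := by exact_mod_cast hτ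
  refine limsup_le_of_le (h := ?_)
  have hbase : 1 < (2 : ℝ) ^ (τ - t) := Real.one_lt_rpow one_lt_two (by linarith)
  have hev : ∀ᶠ J : ℕ in atTop, C * ((J + 1 : ℕ) + 1) * 2 ^ (t * (J + 1 : ℕ)) ≤ (2 : ℝ) ^ (τ * J) := by
    have h1 : Tendsto (fun J : ℕ => C * 2 ^ t * ((J : ℝ) ^ 1 / ((2 : ℝ) ^ (τ - t)) ^ J) +
        C * 2 ^ t * 2 * ((J : ℝ) ^ 0 / ((2 : ℝ) ^ (τ - t)) ^ J)) atTop
        (𝓝 (C * 2 ^ t * 0 + C * 2 ^ t * 2 * 0)) :=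
      ((tendsto_pow_const_div_const_pow_of_one_lt 1 hbase).const_mul _).add
        ((tendsto_pow_const_div_const_pow_of_one_lt 0 hbase).const_mul _)
    rw [mul_zero, mul_zero, add_zero] at h1
    filter_upwards [h1.eventually_le_const one_pos] with J hJ
    have hpos : 0 < ((2 : ℝ) ^ (τ - t)) ^ J := by positivity
    have e1 : (2 : ℝ) ^ (τ * J) = ((2 : ℝ) ^ (τ - t)) ^ J * 2 ^ (t * J) := by
      rw [← Real.rpow_natCast ((2 : ℝ) ^ (τ - t)), ← Real.rpow_mul two_pos.le,
        ← Real.rpow_add two_pos]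
      congr 1
      ring
    have e2 : (2 : ℝ) ^ (t * (J + 1 : ℕ)) = 2 ^ t * 2 ^ (t * J) := by
      rw [← Real.rpow_add two_pos]
      congr 1
      push_cast
      ring
    have e3 : C * 2 ^ t * ((J : ℝ) ^ 1 / ((2 : ℝ) ^ (τ - t)) ^ J) +
        C * 2 ^ t * 2 * ((J : ℝ) ^ 0 / ((2 : ℝ) ^ (τ - t)) ^ J) =
        (C * 2 ^ t * (J + 2)) / ((2 : ℝ) ^ (τ - t)) ^ J := by
      rw [pow_one, pow_zero]
      field_simp
    rw [e3, div_le_one hpos] at hJ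
    rw [e1, e2]
    have := mul_le_mul_of_nonneg_right hJ (Real.rpow_nonneg two_pos.le (t * J))
    calc _ = C * 2 ^ t * (J + 2) * 2 ^ (t * J) := by push_cast; ring
      _ ≤ _ := this
  obtain ⟨J₀, hJ₀⟩ := eventually_atTop.1 hev
  have hmem : Set.Ioo (0 : ℝ≥0) (2⁻¹ ^ (J₀ + 1)) ∈ 𝓝[>] (0 : ℝ≥0) :=
    Ioo_mem_nhdsGT (by positivity)
  filter_upwards [hmem] with δ hδ
  have hδ1 : δ ≤ 1 := hδ.2.le.trans (pow_le_one₀ (by positivity) (by norm_num))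
  obtain ⟨J, hJ1, hJ2⟩ := exists_nat_pow_near_of_lt_one (x := δ) (y := (2 : ℝ≥0)⁻¹) hδ.1 hδ1
    (by norm_num) (by norm_num)
  have hJJ : J₀ ≤ J := by
    have := hJ1.trans hδ.2
    rw [pow_lt_pow_iff_right_of_lt_one₀ (by norm_num) (by norm_num)] at this
    omega
  have hδpos : (0 : ℝ) < δ := hδ.1
  have hδlt : (δ : ℝ) < 1 := by
    have : (δ : ℝ≥0) < 1 := hδ.2.trans_le (pow_le_one₀ (by positivity) (by norm_num))
    exact_mod_cast this
  have hlog : 0 < -Real.log (δ : ℝ) := by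
    have := Real.log_neg hδpos hδlt
    linarith
  rw [EReal.div_le_iff_le_mul (by exact_mod_cast hlog) (EReal.coe_ne_top _)]
  have hcov : (Metric.coveringNumber δ E : ℝ≥0∞) ≤ ENNReal.ofReal ((δ : ℝ) ^ (-τ)) := by
    have h1 : (Metric.coveringNumber δ E : ℝ≥0∞) ≤
        (Metric.coveringNumber ((2 : ℝ≥0)⁻¹ ^ (J + 1)) E : ℝ≥0∞) := by
      exact_mod_cast Metric.coveringNumber_anti hJ1.le
    refine h1.trans ((h (J + 1)).trans (ENNReal.ofReal_le_ofReal ((hJ₀ J hJJ).trans ?_)))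
    have h2 : (δ : ℝ) ≤ 2⁻¹ ^ J := by exact_mod_cast hJ2
    calc (2 : ℝ) ^ (τ * J) = ((2 : ℝ)⁻¹ ^ J) ^ (-τ) := by
          rw [inv_pow, Real.rpow_neg (by positivity), Real.inv_rpow (by positivity), inv_inv,
            ← Real.rpow_natCast, ← Real.rpow_mul two_pos.le, mul_comm]
      _ ≤ (δ : ℝ) ^ (-τ) :=
          Real.rpow_le_rpow_of_nonpos hδpos h2 (by linarith)
  refine (ENNReal.log_le_log hcov).trans (le_of_eq ?_)
  rw [ENNReal.log_ofReal_of_pos (Real.rpow_pos_of_pos hδpos _), Real.log_rpow hδpos,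
    ← EReal.coe_mul]
  congr 1
  ring

/-- A lower bound for `unitDistanceDim` from separated families of unit distance pairs in a set
satisfying `RegularCover α`. -/
theorem le_unitDistanceDim {α t : ℝ} (hα : 0 < α)
    (hdim : ∃ K : Set Plane, Bornology.IsBounded K ∧ RegularCover α K ∧ ENNReal.ofReal α ≤ dimH K)
    {K₁ : Set Plane} (hb : Bornology.IsBounded K₁) (hr : RegularCover α K₁) (δ : ℕ → ℝ)
    (hδ : Tendsto δ atTop (𝓝 0)) (hδ0 : ∀ k, 0 < δ k) {ι : Type*} (S : ℕ → Finset ι)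
    (P : ℕ → ι → Plane × Plane) (hP : ∀ k, ∀ i ∈ S k, P k i ∈ unitDistancePairs K₁)
    (hsep : ∀ k, ∀ i ∈ S k, ∀ i' ∈ S k, i ≠ i' → 2 * δ k < dist (P k i) (P k i'))
    (hcard : ∀ τ < t, ∀ᶠ k in atTop, δ k ^ (-τ) ≤ (S k).card) :
    (t : EReal) ≤ unitDistanceDim 2 α := by
  classical
  obtain ⟨K₀, hb₀, hr₀, hd₀⟩ := hdim
  have hr' := hr₀.union hr
  have hb' := hb₀.union hb
  have hsub : K₀ ∪ K₁ ⊆ closure (K₀ ∪ K₁) := subset_closure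
  -- The part `K₀` forces the Hausdorff dimension up to `α`, the part `K₁` carries the pairs, and
  -- regularity of the union gives the growth condition and the upper bound for the dimension.
  refine le_trans ?_ (le_sSup ⟨closure (K₀ ∪ K₁), hb'.isCompact_closure, le_antisymm
    (hr'.dimH_closure_le hα.le hb') (hd₀.trans (dimH_mono (Set.subset_union_left.trans hsub))),
    hr'.isDiscreteAlphaSet_closure, rfl⟩)
  have hinj : ∀ k, Set.InjOn (P k) (S k) := by
    intro k i hi i' hi' heq
    by_contra hne
    have := hsep k i hi i' hi' hne
    rw [heq, dist_self] at this
    linarith [hδ0 k]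
  refine le_upperMinkowskiDim δ hδ hδ0 (fun k => (S k).image (P k)) (fun k => ?_) (fun k => ?_) ?_
  · rw [Finset.coe_image]
    rintro _ ⟨i, hi, rfl⟩
    obtain ⟨h1, h2, h3⟩ := hP k i hi
    exact ⟨hsub (Or.inr h1), hsub (Or.inr h2), h3⟩
  · rw [Finset.coe_image]
    rintro _ ⟨i, hi, rfl⟩ _ ⟨i', hi', rfl⟩ hne
    exact hsep k i hi i' hi' fun h => hne (h ▸ rfl)
  · intro τ hτ
    filter_upwards [hcard τ hτ] with k hk
    rwa [Finset.card_image_of_injOn (hinj k)]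

/-! ### Restricted digits and the strip example for `2α - 1` -/

/-- The numbers below `B ^ N` whose `i`-th base-`B` digit is less than `E i` for all `i`. -/
def digitSet (B : ℕ) (E : ℕ → ℕ) (N : ℕ) : Finset ℕ :=
  (Finset.range (B ^ N)).filter fun u => ∀ i < N, u / B ^ i % B < E i

theorem mem_digitSet {B N u : ℕ} {E : ℕ → ℕ} :
    u ∈ digitSet B E N ↔ u < B ^ N ∧ ∀ i < N, u / B ^ i % B < E i := by
  simp [digitSet]

theorem digit_lt_of_mem_digitSet {B N u : ℕ} {E : ℕ → ℕ} (hB : 0 < B) (hE : ∀ i, 0 < E i)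
    (hu : u ∈ digitSet B E N) (i : ℕ) : u / B ^ i % B < E i := by
  rw [mem_digitSet] at hu
  rcases lt_or_ge i N with h | h
  · exact hu.2 i h
  · rw [Nat.div_eq_of_lt (hu.1.trans_le (Nat.pow_le_pow_right hB h)), Nat.zero_mod]
    exact hE i

theorem digit_mul_pow_add {B N i a u : ℕ} (hB : 0 < B) (hi : i < N) :
    (a * B ^ N + u) / B ^ i % B = u / B ^ i % B := by
  obtain ⟨m, rfl⟩ := Nat.exists_eq_add_of_lt hi
  have : a * B ^ (i + m + 1) + u = u + B ^ i * (a * B ^ m * B) := by ring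
  rw [this, Nat.add_mul_div_left _ _ (pow_pos hB i), Nat.add_mul_mod_self_right]

theorem prod_le_card_digitSet {B : ℕ} {E : ℕ → ℕ} (hB : 0 < B) (hE : ∀ i, E i ≤ B) (N : ℕ) :
    ∏ i ∈ Finset.range N, E i ≤ (digitSet B E N).card := by
  induction N with
  | zero => simp [digitSet]
  | succ N ih =>
    rw [Finset.prod_range_succ]
    calc _ ≤ (digitSet B E N).card * (Finset.range (E N)).card := by
          rw [Finset.card_range]; gcongr
      _ = (digitSet B E N ×ˢ Finset.range (E N)).card := (Finset.card_product _ _).symm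
      _ ≤ _ := by
          refine Finset.card_le_card_of_injOn (fun q => q.2 * B ^ N + q.1) ?_ ?_
          · rintro ⟨u, d⟩ hq
            simp only [Finset.coe_product, Set.mem_prod, Finset.mem_coe, Finset.mem_range] at hq
            rw [mem_digitSet] at hq
            rw [Finset.mem_coe, mem_digitSet]
            obtain ⟨⟨hu, hdig⟩, hd⟩ := hq
            dsimp only
            refine ⟨?_, fun i hi => ?_⟩
            · have : (d + 1) * B ^ N ≤ B * B ^ N :=
                Nat.mul_le_mul_right _ (hd.trans_le (hE N))
              rw [pow_succ]
              linarith
            · rcases Nat.lt_succ_iff_lt_or_eq.1 hi with h | rfl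
              · rw [digit_mul_pow_add hB h]
                exact hdig i h
              · rw [mul_comm, Nat.mul_add_div (pow_pos hB i), Nat.div_eq_of_lt hu, add_zero]
                exact (Nat.mod_le _ _).trans_lt hd
          · rintro ⟨u, d⟩ hq ⟨u', d'⟩ hq' heq
            simp only [Finset.coe_product, Set.mem_prod, Finset.mem_coe, mem_digitSet] at hq hq' heq
            have h1 := congrArg (· / B ^ N) heq
            have h2 := congrArg (· % B ^ N) heq
            simp only [mul_comm _ (B ^ N), Nat.mul_add_div (pow_pos hB N), Nat.mul_add_mod,
              Nat.div_eq_of_lt hq.1.1, Nat.div_eq_of_lt hq'.1.1, Nat.mod_eq_of_lt hq.1.1,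
              Nat.mod_eq_of_lt hq'.1.1, add_zero] at h1 h2
            rw [h1, h2]

/-- The product of `[0, 2)` with the set of `c ∈ [0, 1)` all of whose base-`B` digits are
less than `D`. -/
def stripSet (B D : ℕ) : Set Plane :=
  {x | (0 ≤ x 0 ∧ x 0 < 2) ∧ (0 ≤ x 1 ∧ x 1 < 1) ∧ ∀ j : ℕ, ⌊(B : ℝ) ^ (j + 1) * x 1⌋ % B < D}

theorem isBounded_stripSet (B D : ℕ) : Bornology.IsBounded (stripSet B D) := by
  refine Metric.isBounded_iff.2 ⟨3, fun x hx y hy => (Plane.dist_le _ _).trans ?_⟩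
  obtain ⟨h1, h2, -⟩ := hx
  obtain ⟨h3, h4, -⟩ := hy
  have a : |x 0 - y 0| ≤ 2 := abs_le.2 ⟨by linarith, by linarith⟩
  have b : |x 1 - y 1| ≤ 1 := abs_le.2 ⟨by linarith, by linarith⟩
  linarith

theorem floor_pow_succ_mul (B : ℕ) (hB : 0 < B) (j : ℕ) (x : ℝ) :
    ⌊(B : ℝ) ^ (j + 1) * x⌋ / (B : ℤ) = ⌊(B : ℝ) ^ j * x⌋ := by
  rw [← Int.floor_div_natCast]
  congr 1
  have : (B : ℝ) ≠ 0 := by positivity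
  field_simp
  ring

/-- A `B`-adic square has at most `B` admissible children positions horizontally and `D` vertically,
so the tree criterion with ratio `B⁻¹` applies as soon as `B * D ≤ B ^ α`. -/
theorem regularCover_stripSet {α : ℝ} {B D : ℕ} (hα : 0 ≤ α) (hB : 2 ≤ B)
    (hBD : (B * D : ℝ) ≤ (B : ℝ) ^ α) : RegularCover α (stripSet B D) := by
  have hB0 : (0 : ℝ) < B := by positivity
  have hB1 : (1 : ℝ) < B := by exact_mod_cast hB
  have hBz : (0 : ℤ) < B := by exact_mod_cast (by omega : 0 < B)
  rw [← Subtype.range_coe (s := stripSet B D)]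
  let label : ℕ → stripSet B D → ℤ × ℤ := fun j x =>
    (⌊(B : ℝ) ^ j * x.1 0⌋, ⌊(B : ℝ) ^ j * x.1 1⌋)
  -- Within a ball of radius `B ^ (-j)`, or within the whole strip when `j = 0`, the rescaled
  -- coordinates vary by at most `2`, so residues modulo `4 ≥ 2 + 1` separate the cells.
  let S₀ : Finset (ℤ × ℤ) := Finset.Ico 0 4 ×ˢ Finset.Ico 0 4
  have hball : ∀ (j : ℕ) (P : Set (stripSet B D)),
      (∀ x ∈ P, ∀ y ∈ P, ∀ k, |x.1 k - y.1 k| ≤ 2 * ((B : ℝ)⁻¹) ^ j) →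
      ∃ code : stripSet B D → ℤ × ℤ, (∀ i, code i ∈ S₀) ∧
      ∀ i i', i ∈ P → i' ∈ P → code i = code i' → label j i = label j i' := by
    intro j P hPj
    refine ⟨fun x => ((label j x).1 % (4 : ℕ), (label j x).2 % (4 : ℕ)), fun x => ?_, ?_⟩
    · simp only [S₀, Finset.mem_product, Finset.mem_Ico]
      omega
    · intro x y hx hy hxy
      rw [Prod.mk.injEq] at hxy
      have hk : ∀ k, |(B : ℝ) ^ j * x.1 k - (B : ℝ) ^ j * y.1 k| ≤ 2 := by
        intro k
        rw [← mul_sub, abs_mul, abs_of_pos (by positivity)]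
        have := hPj x hx y hy k
        rw [inv_pow, ← div_eq_mul_inv, le_div_iff₀ (by positivity)] at this
        linarith
      exact Prod.ext (Int.floor_eq_of_emod_eq (hk 0) (by norm_num) hxy.1)
        (Int.floor_eq_of_emod_eq (hk 1) (by norm_num) hxy.2)
  refine regularCover_range_of_tree hα (l := (B : ℝ)⁻¹) (c := 2) (by positivity)
    (inv_lt_one_of_one_lt₀ hB1) two_pos Subtype.val label S₀
    (Finset.Ico 0 (B : ℤ) ×ˢ Finset.Ico 0 (D : ℤ)) ?_ ?_ ?_ ?_ ?_
  · simpa using hBD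
  · intro j x y hxy
    simp only [label, Prod.mk.injEq] at hxy
    refine (Plane.dist_le _ _).trans ?_
    have hk : ∀ k, ⌊(B : ℝ) ^ j * x.1 k⌋ = ⌊(B : ℝ) ^ j * y.1 k⌋ →
        |x.1 k - y.1 k| ≤ (B : ℝ)⁻¹ ^ j := by
      intro k hk
      have := (Int.abs_sub_lt_one_of_floor_eq_floor hk).le
      rw [← mul_sub, abs_mul, abs_of_pos (by positivity)] at this
      rw [inv_pow, inv_eq_one_div, le_div_iff₀ (by positivity)]
      linarith
    linarith [hk 0 hxy.1, hk 1 hxy.2]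
  · obtain ⟨code, h1, h2⟩ := hball 0 Set.univ (by
      intro x _ y _ k
      obtain ⟨h1, h2, -⟩ := x.2
      obtain ⟨h3, h4, -⟩ := y.2
      rw [pow_zero, mul_one, abs_le]
      fin_cases k
      · exact ⟨by simp only [Fin.zero_eta]; linarith, by simp only [Fin.zero_eta]; linarith⟩
      · exact ⟨by simp only [Fin.mk_one]; linarith, by simp only [Fin.mk_one]; linarith⟩)
    exact ⟨code, h1, fun i i' => h2 i i' trivial trivial⟩
  · intro j x
    refine hball j {i | i.1 ∈ Metric.ball x ((B : ℝ)⁻¹ ^ j)} fun p hp q hq k => ?_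
    refine (Plane.abs_sub_le _ _ _).trans ?_
    simp only [Set.mem_ofPred_eq, Metric.mem_ball] at hp hq
    linarith [dist_triangle_right p.1 q.1 x]
  · intro j
    refine ⟨fun x => ((label (j + 1) x).1 % B, (label (j + 1) x).2 % B), fun x => ?_, ?_⟩
    · simp only [Finset.mem_product, Finset.mem_Ico]
      exact ⟨⟨Int.emod_nonneg _ hBz.ne', Int.emod_lt_of_pos _ hBz⟩, Int.emod_nonneg _ hBz.ne',
        x.2.2.2 j⟩
    · intro x y hxy hcode
      simp only [label, Prod.mk.injEq] at hxy hcode ⊢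
      rw [← floor_pow_succ_mul B (by omega) j (x.1 0),
        ← floor_pow_succ_mul B (by omega) j (y.1 0),
        ← floor_pow_succ_mul B (by omega) j (x.1 1),
        ← floor_pow_succ_mul B (by omega) j (y.1 1)] at hxy
      constructor
      · rw [← Int.mul_ediv_add_emod ⌊(B : ℝ) ^ (j + 1) * x.1 0⌋ B, hxy.1, hcode.1,
          Int.mul_ediv_add_emod]
      · rw [← Int.mul_ediv_add_emod ⌊(B : ℝ) ^ (j + 1) * x.1 1⌋ B, hxy.2, hcode.2,
          Int.mul_ediv_add_emod]

theorem digit_div_pow_lt {B D n v : ℕ} (hB : 0 < B) (hD : 0 < D)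
    (hv : v ∈ digitSet B (fun _ => D) n) (j : ℕ) :
    ⌊(B : ℝ) ^ (j + 1) * ((v : ℝ) / (B : ℝ) ^ n)⌋ % (B : ℤ) < D := by
  have hB0 : (B : ℝ) ≠ 0 := by positivity
  rcases le_or_gt (j + 1) n with h | h
  · have e : (B : ℝ) ^ (j + 1) * ((v : ℝ) / (B : ℝ) ^ n) = (v : ℝ) / ((B ^ (n - (j + 1)) : ℕ) : ℝ) := by
      obtain ⟨m, rfl⟩ := Nat.exists_eq_add_of_le h
      rw [Nat.add_sub_cancel_left]
      push_cast
      field_simp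
      ring
    rw [e, Int.floor_div_natCast, Int.floor_natCast]
    exact_mod_cast digit_lt_of_mem_digitSet hB (fun _ => hD) hv _
  · have e : (B : ℝ) ^ (j + 1) * ((v : ℝ) / (B : ℝ) ^ n) = ((v * B ^ (j - n) * B : ℕ) : ℝ) := by
      obtain ⟨m, hm⟩ := Nat.exists_eq_add_of_le (Nat.lt_succ_iff.1 h)
      subst hm
      rw [Nat.add_sub_cancel_left]
      push_cast
      rw [pow_succ, pow_add]
      field_simp
    rw [e, Int.floor_natCast]
    push_cast
    rw [Int.mul_emod_left]
    exact_mod_cast hD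

theorem exists_regularCover_two :
    ∃ K : Set Plane, Bornology.IsBounded K ∧ RegularCover 2 K ∧ ENNReal.ofReal 2 ≤ dimH K := by
  refine ⟨stripSet 2 2, isBounded_stripSet 2 2, regularCover_stripSet two_pos.le le_rfl (by norm_num),
    ?_⟩
  have hmem : stripSet 2 2 ∈ 𝓝 (!₂[(1 / 2 : ℝ), 1 / 2] : Plane) := by
    have hopen : IsOpen {x : Plane | (0 < x 0 ∧ x 0 < 2) ∧ 0 < x 1 ∧ x 1 < 1} := by
      have c0 : Continuous fun x : Plane => x 0 := by fun_prop
      have c1 : Continuous fun x : Plane => x 1 := by fun_prop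
      exact ((isOpen_lt continuous_const c0).inter (isOpen_lt c0 continuous_const)).inter
        ((isOpen_lt continuous_const c1).inter (isOpen_lt c1 continuous_const))
    refine mem_of_superset (hopen.mem_nhds (by norm_num)) ?_
    rintro x ⟨⟨h1, h2⟩, h3, h4⟩
    exact ⟨⟨h1.le, h2⟩, ⟨h3.le, h4⟩, fun j => Int.emod_lt_of_pos _ (by norm_num)⟩
  simp [Real.dimH_of_mem_nhds hmem]

theorem exists_regularCover_of_le_two {α : ℝ} (hα : 0 < α) (hα2 : α ≤ 2) :
    ∃ K : Set Plane, Bornology.IsBounded K ∧ RegularCover α K ∧ ENNReal.ofReal α ≤ dimH K := by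
  rcases hα2.lt_or_eq with h | rfl
  exacts [exists_regularCover_le_dimH hα h, exists_regularCover_two]

/-- A large base makes the number of admissible digits approximate `B ^ a` in exponent. Requiring `D
+ 1 ≤ B ^ a` rather than `D ≤ B ^ a` leaves room for one additional child in the block construction.
-/
theorem exists_base_digit {a s : ℝ} (hs0 : 0 ≤ s) (hs : s < a) (ha : a ≤ 1) :
    ∃ B D : ℕ, 8 ≤ B ∧ 1 ≤ D ∧ D ≤ B ∧ (D + 1 : ℝ) ≤ (B : ℝ) ^ a ∧ (B : ℝ) ^ s ≤ D := by
  have h1 : Tendsto (fun B : ℕ => (B : ℝ) ^ (a - s)) atTop atTop :=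
    (tendsto_rpow_atTop (by linarith)).comp tendsto_natCast_atTop_atTop
  obtain ⟨B, hB3, hB8⟩ := ((h1.eventually_ge_atTop 3).and (eventually_ge_atTop 8)).exists
  have hB0 : (0 : ℝ) < B := by exact_mod_cast (by omega : 0 < B)
  have hB1 : (1 : ℝ) ≤ B := by exact_mod_cast (by omega : 1 ≤ B)
  have hs1 : 1 ≤ (B : ℝ) ^ s := Real.one_le_rpow hB1 hs0
  have hmul : (B : ℝ) ^ a = (B : ℝ) ^ (a - s) * (B : ℝ) ^ s := by
    rw [← Real.rpow_add hB0]; congr 1; ring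
  have hbig : (B : ℝ) ^ s + 2 ≤ (B : ℝ) ^ a := by nlinarith
  have hfl : 1 ≤ ⌊(B : ℝ) ^ a⌋₊ := Nat.le_floor (by push_cast; linarith)
  have hcast : ((⌊(B : ℝ) ^ a⌋₊ - 1 : ℕ) : ℝ) = (⌊(B : ℝ) ^ a⌋₊ : ℝ) - 1 := by
    push_cast [hfl]; ring
  have hlo := Nat.lt_floor_add_one ((B : ℝ) ^ a)
  have hhi := Nat.floor_le (Real.rpow_nonneg hB0.le a)
  have hD : (B : ℝ) ^ s ≤ ((⌊(B : ℝ) ^ a⌋₊ - 1 : ℕ) : ℝ) := by rw [hcast]; linarith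
  refine ⟨B, ⌊(B : ℝ) ^ a⌋₊ - 1, hB8, ?_, ?_, ?_, hD⟩
  · exact_mod_cast hs1.trans hD
  · have : (B : ℝ) ^ a ≤ (B : ℝ) ^ (1 : ℝ) := Real.rpow_le_rpow_of_exponent_le hB1 ha
    rw [Real.rpow_one] at this
    have : ((⌊(B : ℝ) ^ a⌋₊ - 1 : ℕ) : ℝ) ≤ B := by rw [hcast]; linarith
    exact_mod_cast this
  · rw [hcast]; linarith

/-- The scales used are `B ^ (-m) / 3`, so that points at distance `B ^ (-m)` are strictly more than
two scales apart. The factor `3` shifts exponents by a constant only. -/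
theorem eventually_rpow_neg_le {B τ : ℝ} (hB : 1 < B) (m e : ℕ → ℝ)
    (h : Tendsto (fun k => e k - τ * m k) atTop atTop) :
    ∀ᶠ k in atTop, (B ^ (-m k) / 3) ^ (-τ) ≤ B ^ e k := by
  have hB0 : 0 < B := by linarith
  filter_upwards [h.eventually_ge_atTop (τ * Real.logb B 3)] with k hk
  have h3 : (3 : ℝ) = B ^ Real.logb B 3 := (Real.rpow_logb hB0 hB.ne' (by norm_num)).symm
  rw [h3, ← Real.rpow_sub hB0, ← Real.rpow_mul hB0.le]
  refine Real.rpow_le_rpow_of_exponent_le hB.le ?_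
  linarith

/-- The pair with first point `(a, b)` whose second point lies to the right at unit distance and
height `b + w`. -/
noncomputable def unitPair (a b w : ℝ) : Plane × Plane :=
  (!₂[a, b], !₂[a + √(1 - w ^ 2), b + w])

theorem norm_unitPair_sub {a b w : ℝ} (hw : |w| ≤ 1) :
    ‖(unitPair a b w).2 - (unitPair a b w).1‖ = 1 := by
  have : 0 ≤ 1 - w ^ 2 := by nlinarith [abs_le.1 hw]
  rw [EuclideanSpace.norm_eq, Fin.sum_univ_two]
  simp [unitPair, Real.sq_sqrt this]

theorem abs_fst_sub_le_dist_unitPair (a b w a' b' w' : ℝ) :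
    |a - a'| ≤ dist (unitPair a b w) (unitPair a' b' w') := by
  refine le_trans ?_ (le_max_left _ _)
  simpa [unitPair] using Plane.abs_sub_le (unitPair a b w).1 (unitPair a' b' w').1 0

theorem abs_snd_sub_le_dist_unitPair (a b w a' b' w' : ℝ) :
    |b - b'| ≤ dist (unitPair a b w) (unitPair a' b' w') := by
  refine le_trans ?_ (le_max_left _ _)
  simpa [unitPair] using Plane.abs_sub_le (unitPair a b w).1 (unitPair a' b' w').1 1

theorem abs_height_sub_le_dist_unitPair (a b w a' b' w' : ℝ) :
    |(b + w) - (b' + w')| ≤ dist (unitPair a b w) (unitPair a' b' w') := by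
  refine le_trans ?_ (le_max_right _ _)
  simpa [unitPair] using Plane.abs_sub_le (unitPair a b w).2 (unitPair a' b' w').2 1

theorem inv_le_abs_div_sub_div {u v : ℕ} (h : u ≠ v) {X c : ℝ} (hX : 0 < X) :
    X⁻¹ ≤ |((u : ℝ) / X + c) - ((v : ℝ) / X + c)| := by
  rw [add_sub_add_right_eq_sub, ← sub_div, abs_div, abs_of_pos hX, inv_eq_one_div]
  gcongr
  have : (1 : ℤ) ≤ |(u : ℤ) - v| := Int.one_le_abs (by omega)
  exact_mod_cast this

theorem tendsto_rpow_neg_div_three {B : ℝ} (hB : 1 < B) {m : ℕ → ℝ} (hm : Tendsto m atTop atTop) :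
    Tendsto (fun k => B ^ (-m k) / 3) atTop (𝓝 0) := by
  have h1 : Tendsto (fun x : ℝ => B ^ x) atBot (𝓝 0) := tendsto_rpow_atBot_of_base_gt_one B hB
  simpa using ((h1.comp (tendsto_neg_atTop_atBot.comp hm)).div_const 3)

/-- The abscissa of the first point and the ordinates of both points are free. They determine the
abscissa of the second point, which is admissible because the strip contains all abscissae in `[0,
2)`. This gives at least `B ^ n * D ^ (2n)` pairs, separated because the three parameters can be
read off from the coordinates. -/
theorem strip_le_unitDistanceDim {α s : ℝ} {B D : ℕ} (hα : 0 < α) (hα2 : α ≤ 2) (hB : 2 ≤ B)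
    (hD : 1 ≤ D) (hDB : D ≤ B) (hBD : (B * D : ℝ) ≤ (B : ℝ) ^ α) (hs : (B : ℝ) ^ s ≤ D) :
    ((1 + 2 * s : ℝ) : EReal) ≤ unitDistanceDim 2 α := by
  have hB1 : (1 : ℝ) < B := by exact_mod_cast hB
  have hB0 : (0 : ℝ) < B := by linarith
  have hpow : ∀ n : ℕ, (B : ℝ) ^ (-(n : ℝ)) = ((B : ℝ) ^ n)⁻¹ := fun n => by
    rw [Real.rpow_neg hB0.le, Real.rpow_natCast]
  have hnat : Tendsto (fun n : ℕ => (n : ℝ)) atTop atTop := tendsto_natCast_atTop_atTop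
  refine le_unitDistanceDim hα (exists_regularCover_of_le_two hα hα2) (isBounded_stripSet B D)
    (regularCover_stripSet hα.le hB hBD) (fun n : ℕ => (B : ℝ) ^ (-(n : ℝ)) / 3)
    (tendsto_rpow_neg_div_three hB1 hnat) (fun n => by positivity)
    (fun n => Finset.range (B ^ n) ×ˢ digitSet B (fun _ => D) n ×ˢ digitSet B (fun _ => D) n)
    (fun n q => unitPair ((q.1 : ℝ) / (B : ℝ) ^ n) ((q.2.1 : ℝ) / (B : ℝ) ^ n)
      (((q.2.2 : ℝ) - q.2.1) / (B : ℝ) ^ n)) ?_ ?_ ?_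
  · rintro n ⟨i, v, v'⟩ hq
    simp only [Finset.mem_product, Finset.mem_range] at hq ⊢
    obtain ⟨hi, hv, hv'⟩ := hq
    have hBn : (0 : ℝ) < (B : ℝ) ^ n := by positivity
    have hunit : ∀ u : ℕ, u < B ^ n → (u : ℝ) / (B : ℝ) ^ n < 1 := fun u hu => by
      rw [div_lt_one hBn]; exact_mod_cast hu
    have hi1 := hunit i hi
    have hv1 := hunit v (mem_digitSet.1 hv).1
    have hv1' := hunit v' (mem_digitSet.1 hv').1
    have hi0 : 0 ≤ (i : ℝ) / (B : ℝ) ^ n := by positivity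
    have hv0 : 0 ≤ (v : ℝ) / (B : ℝ) ^ n := by positivity
    have hv0' : 0 ≤ (v' : ℝ) / (B : ℝ) ^ n := by positivity
    have hsum : (v : ℝ) / (B : ℝ) ^ n + ((v' : ℝ) - v) / (B : ℝ) ^ n = (v' : ℝ) / (B : ℝ) ^ n := by
      ring
    have hw : |((v' : ℝ) - v) / (B : ℝ) ^ n| ≤ 1 := by
      rw [abs_le]
      constructor <;> linarith
    have hsq : √(1 - (((v' : ℝ) - v) / (B : ℝ) ^ n) ^ 2) ≤ 1 := by
      rw [Real.sqrt_le_one]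
      nlinarith [sq_nonneg (((v' : ℝ) - v) / (B : ℝ) ^ n)]
    refine ⟨⟨⟨by simpa [unitPair] using hi0, ?_⟩, ⟨by simpa [unitPair] using hv0,
      by simpa [unitPair] using hv1⟩, ?_⟩, ⟨⟨?_, ?_⟩, ⟨?_, ?_⟩, ?_⟩, norm_unitPair_sub hw⟩
    · simp only [unitPair, PiLp.toLp_apply, Matrix.cons_val_zero]
      linarith
    · simpa [unitPair] using digit_div_pow_lt (by omega) hD hv
    · simp only [unitPair, PiLp.toLp_apply, Matrix.cons_val_zero]
      positivity
    · simp only [unitPair, PiLp.toLp_apply, Matrix.cons_val_zero]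
      linarith
    · simpa [unitPair, hsum] using hv0'
    · simpa [unitPair, hsum] using hv1'
    · simpa [unitPair, hsum] using digit_div_pow_lt (by omega) hD hv'
  · rintro n ⟨i, v, v'⟩ hq ⟨j, u, u'⟩ hq' hne
    have hBn : (0 : ℝ) < (B : ℝ) ^ n := by positivity
    have hBn' : 0 < ((B : ℝ) ^ n)⁻¹ := by positivity
    rw [hpow]
    refine lt_of_lt_of_le (by linarith : 2 * (((B : ℝ) ^ n)⁻¹ / 3) < ((B : ℝ) ^ n)⁻¹) ?_
    by_cases h1 : i = j
    · by_cases h2 : v = u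
      · have h3 : v' ≠ u' := fun h => hne (by rw [h1, h2, h])
        refine le_trans ?_ (abs_height_sub_le_dist_unitPair _ _ _ _ _ _)
        convert! inv_le_abs_div_sub_div h3 (c := 0) hBn using 3 <;> ring
      · refine le_trans ?_ (abs_snd_sub_le_dist_unitPair _ _ _ _ _ _)
        simpa using inv_le_abs_div_sub_div h2 (c := 0) hBn
    · refine le_trans ?_ (abs_fst_sub_le_dist_unitPair _ _ _ _ _ _)
      simpa using inv_le_abs_div_sub_div h1 (c := 0) hBn
  · intro τ hτ
    have hlim : Tendsto (fun n : ℕ => (1 + 2 * s) * (n : ℝ) - τ * n) atTop atTop := by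
      simp_rw [← sub_mul]
      exact hnat.const_mul_atTop (by linarith)
    filter_upwards [eventually_rpow_neg_le hB1 _ _ hlim] with n hn
    refine hn.trans ?_
    have hc : D ^ n ≤ (digitSet B (fun _ => D) n).card := by
      simpa using prod_le_card_digitSet (B := B) (E := fun _ => D) (by omega) (fun _ => hDB) n
    have hc' : ((B : ℝ) ^ s) ^ n ≤ (digitSet B (fun _ => D) n).card :=
      (pow_le_pow_left₀ (by positivity) hs n).trans (by exact_mod_cast hc)
    calc (B : ℝ) ^ ((1 + 2 * s) * (n : ℝ)) = (B : ℝ) ^ n * (((B : ℝ) ^ s) ^ n * ((B : ℝ) ^ s) ^ n) := by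
          rw [← Real.rpow_natCast ((B : ℝ) ^ s), ← Real.rpow_mul hB0.le, ← Real.rpow_natCast (B : ℝ) n,
            ← Real.rpow_add hB0, ← Real.rpow_add hB0]
          congr 1
          ring
      _ ≤ (B : ℝ) ^ n * ((digitSet B (fun _ => D) n).card * (digitSet B (fun _ => D) n).card) := by
          gcongr
      _ = _ := by simp

theorem two_mul_sub_one_le_unitDistanceDim {α : ℝ} (hα : 1 < α) (hα2 : α ≤ 2) :
    ((2 * α - 1 : ℝ) : EReal) ≤ unitDistanceDim 2 α := by
  refine EReal.ge_of_forall_gt_iff_ge.1 fun τ hτ => ?_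
  replace hτ : τ < 2 * α - 1 := by exact_mod_cast hτ
  -- The maximum with `0` only serves small `τ`, as `exists_base_digit` asks for a nonnegative
  -- exponent.
  obtain ⟨B, D, hB, hD, hDB, hle, hs⟩ := exists_base_digit (a := α - 1) (s := max 0 ((τ - 1) / 2))
    (le_max_left _ _) (max_lt (by linarith) (by linarith)) (by linarith)
  have hB0 : (0 : ℝ) < B := by exact_mod_cast (by omega : 0 < B)
  refine le_trans ?_ (strip_le_unitDistanceDim (by linarith) hα2 (by omega) hD hDB ?_ hs)
  · have := le_max_right 0 ((τ - 1) / 2)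
    exact_mod_cast (by linarith : τ ≤ 1 + 2 * max 0 ((τ - 1) / 2))
  · have : (B : ℝ) ^ α = B * (B : ℝ) ^ (α - 1) := by
      rw [← Real.rpow_one_add' hB0.le (by linarith)]
      congr 1
      ring
    rw [this]
    gcongr
    linarith

/-! ### Truncated digit expansions -/

section Truncation

variable {B L j a b : ℕ}

/-- The quotient `a / B ^ (L - j)` truncates `a * B ^ (-L)` at precision `B ^ (-j)`. For `j > L` the
natural subtraction gives `0` and the quotient is `a` itself, so nothing new appears beyond
generation `L`. -/
theorem abs_sub_mul_inv_pow_le (hB : 0 < B) (h : a / B ^ (L - j) = b / B ^ (L - j)) :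
    |(a : ℝ) - b| * (B : ℝ)⁻¹ ^ L ≤ (B : ℝ)⁻¹ ^ j := by
  have hB0 : (0 : ℝ) < B := by exact_mod_cast hB
  rcases le_or_gt j L with hj | hj
  · have h1 : ⌊(a : ℝ) / ((B ^ (L - j) : ℕ) : ℝ)⌋ = ⌊(b : ℝ) / ((B ^ (L - j) : ℕ) : ℝ)⌋ := by
      rw [Int.floor_div_natCast, Int.floor_div_natCast, Int.floor_natCast, Int.floor_natCast]
      exact_mod_cast h
    have h2 := (Int.abs_sub_lt_one_of_floor_eq_floor h1).le
    have hp : (0 : ℝ) < ((B ^ (L - j) : ℕ) : ℝ) := by positivity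
    rw [← sub_div, abs_div, abs_of_pos hp, div_le_one hp] at h2
    calc _ ≤ ((B ^ (L - j) : ℕ) : ℝ) * (B : ℝ)⁻¹ ^ L := by gcongr
      _ = _ := by
        obtain ⟨m, rfl⟩ := Nat.exists_eq_add_of_le hj
        rw [Nat.add_sub_cancel_left]
        push_cast
        rw [inv_pow, inv_pow, pow_add]
        field_simp
  · rw [Nat.sub_eq_zero_of_le hj.le] at h
    simp only [pow_zero, Nat.div_one] at h
    rw [h, sub_self, abs_zero, zero_mul]
    positivity

theorem div_pow_sub_eq_of_mod_eq {C : ℕ} (hB : 0 < B)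
    (h : |(a : ℝ) - b| * (B : ℝ)⁻¹ ^ L ≤ C * (B : ℝ)⁻¹ ^ j)
    (hmod : a / B ^ (L - j) % (C + 1) = b / B ^ (L - j) % (C + 1)) :
    a / B ^ (L - j) = b / B ^ (L - j) := by
  have hB0 : (0 : ℝ) < B := by exact_mod_cast hB
  have hB1 : (1 : ℝ) ≤ B := by exact_mod_cast hB
  have hp : (0 : ℝ) < ((B ^ (L - j) : ℕ) : ℝ) := by positivity
  have h1 : |(a : ℝ) / ((B ^ (L - j) : ℕ) : ℝ) - (b : ℝ) / ((B ^ (L - j) : ℕ) : ℝ)| ≤ C := by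
    rw [← sub_div, abs_div, abs_of_pos hp, div_le_iff₀ hp]
    rw [inv_pow, inv_pow, ← div_eq_mul_inv, ← div_eq_mul_inv, div_le_div_iff₀ (by positivity)
      (by positivity)] at h
    rcases le_or_gt j L with hj | hj
    · obtain ⟨m, rfl⟩ := Nat.exists_eq_add_of_le hj
      rw [Nat.add_sub_cancel_left]
      push_cast
      rw [pow_add] at h
      have hj0 : (0 : ℝ) < (B : ℝ) ^ j := by positivity
      nlinarith
    · rw [Nat.sub_eq_zero_of_le hj.le, pow_zero, Nat.cast_one, mul_one]
      have hj0 : (0 : ℝ) < (B : ℝ) ^ j := by positivity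
      have : (B : ℝ) ^ L ≤ (B : ℝ) ^ j := pow_le_pow_right₀ hB1 hj.le
      have hC : (0 : ℝ) ≤ C := by positivity
      nlinarith
  have h2 := Int.floor_eq_of_emod_eq (m := C + 1) h1 (by push_cast; linarith) (by
    rw [Int.floor_div_natCast, Int.floor_div_natCast, Int.floor_natCast, Int.floor_natCast]
    exact_mod_cast hmod)
  rw [Int.floor_div_natCast, Int.floor_div_natCast, Int.floor_natCast, Int.floor_natCast] at h2
  exact_mod_cast h2

theorem div_pow_sub_succ_eq (h : a / B ^ (L - j) = b / B ^ (L - j))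
    (hd : j < L → a / B ^ (L - (j + 1)) % B = b / B ^ (L - (j + 1)) % B) :
    a / B ^ (L - (j + 1)) = b / B ^ (L - (j + 1)) := by
  rcases lt_or_ge j L with hj | hj
  · have e : L - j = (L - (j + 1)) + 1 := by omega
    rw [e, pow_succ, ← Nat.div_div_eq_div_mul, ← Nat.div_div_eq_div_mul] at h
    rw [← Nat.div_add_mod (a / B ^ (L - (j + 1))) B, h, hd hj, Nat.div_add_mod]
  · rwa [Nat.sub_eq_zero_of_le hj, ← Nat.sub_eq_zero_of_le (hj.trans j.le_succ)] at h

end Truncation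

/-! ### The block construction: tree structure and regularity -/

/-- The number of base-`B` digits of the fine part of the `k`-th block. -/
def fineLength (k : ℕ) : ℕ := k ^ 2 + k

/-- The number of base-`B` digits of the coordinates in the `k`-th block. -/
def blockLength (k : ℕ) : ℕ := fineLength k + k ^ 2

/-- The finest scale of the `k`-th block is `B ^ (-blockScale k)`. -/
def blockScale (k : ℕ) : ℕ := 2 * fineLength k

theorem blockLength_add (k : ℕ) : blockLength k + k = blockScale k := by
  simp only [blockLength, blockScale, fineLength]
  ring

/-- The indices `(k, u, v, z)`: the fine digits of `u` are below `D₂` and the coarse ones below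
`D₁`; for `v` it is the other way round; the digits of `z` are below `D₁`. -/
def blockIndex (B D₁ D₂ : ℕ) : Set (ℕ × ℕ × ℕ × ℕ) :=
  {q | q.2.1 ∈ digitSet B (fun i => if i < fineLength q.1 then D₂ else D₁) (blockLength q.1) ∧
    q.2.2.1 ∈ digitSet B (fun i => if i < fineLength q.1 then D₁ else D₂) (blockLength q.1) ∧
    q.2.2.2 ∈ digitSet B (fun _ => D₁) (fineLength q.1)}

/-- A union of finite blocks, the `k`-th one of diameter about `B ^ (-k)`, whose points have
coordinates with restricted digits, perturbed horizontally by `g`. -/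
noncomputable def blockPoint (B : ℕ) (e : ℝ) (o : ℕ → ℝ) (g : ℕ → ℕ → ℕ → ℝ)
    (q : ℕ × ℕ × ℕ × ℕ) : Plane :=
  !₂[e + q.2.1 * (B : ℝ)⁻¹ ^ blockScale q.1 + g q.1 q.2.2.1 q.2.2.2,
    o q.1 + q.2.2.1 * (B : ℝ)⁻¹ ^ blockScale q.1]

/-- The cell of generation `j` containing a block point. -/
def blockLabel (B j : ℕ) (q : ℕ × ℕ × ℕ × ℕ) : Option (ℕ × ℕ × ℕ × ℕ) :=
  if j ≤ q.1 then none else some (q.1, q.2.1 / B ^ (blockScale q.1 - j),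
    q.2.2.1 / B ^ (blockScale q.1 - j), q.2.2.2 / B ^ (blockScale q.1 + fineLength q.1 - j))

/-- The new digits that determine the cell of generation `j + 1` inside that of generation `j`. -/
def blockDigit (B j : ℕ) (q : ℕ × ℕ × ℕ × ℕ) : Option (ℕ × ℕ) :=
  if j + 1 ≤ q.1 then none else
  if j < blockScale q.1 then
    if blockScale q.1 - (j + 1) < fineLength q.1 then
      some (q.2.2.1 / B ^ (blockScale q.1 - (j + 1)) % B,
        q.2.1 / B ^ (blockScale q.1 - (j + 1)) % B)
    else
      some (q.2.1 / B ^ (blockScale q.1 - (j + 1)) % B,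
        q.2.2.1 / B ^ (blockScale q.1 - (j + 1)) % B)
  else some (q.2.2.2 / B ^ (blockScale q.1 + fineLength q.1 - (j + 1)) % B, 0)

section Block

variable {B D₁ D₂ : ℕ}

/-- In the coarse and the fine range alike the digit bounded by `D₁` is listed first, so the
alphabet `D₁ × D₂` serves all scales. The extra letter `none` stands for the blocks not yet detached
from the common cell, and is the reason for `D₁ * D₂ + 1` children. -/
theorem blockDigit_mem (hB : 0 < B) (h₁ : 0 < D₁) (h₂ : 0 < D₂) {q : ℕ × ℕ × ℕ × ℕ}
    (hq : q ∈ blockIndex B D₁ D₂) (j : ℕ) :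
    blockDigit B j q ∈ Finset.insertNone (Finset.range D₁ ×ˢ Finset.range D₂) := by
  obtain ⟨k, u, v, z⟩ := q
  obtain ⟨hu, hv, hz⟩ := hq
  dsimp only at hu hv hz
  have hu' := digit_lt_of_mem_digitSet hB (fun i => by split_ifs <;> assumption) hu
    (blockScale k - (j + 1))
  have hv' := digit_lt_of_mem_digitSet hB (fun i => by split_ifs <;> assumption) hv
    (blockScale k - (j + 1))
  have hz' := digit_lt_of_mem_digitSet hB (fun i => h₁) hz
    (blockScale k + fineLength k - (j + 1))
  rw [Finset.mem_insertNone]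
  intro d hd
  simp only [blockDigit] at hd
  split_ifs at hd with c1 c2 c3
  · simp at hd
  · rw [if_pos c3] at hu' hv'
    simp only [Option.mem_def, Option.some.injEq] at hd
    subst hd
    simp [hu', hv']
  · rw [if_neg c3] at hu' hv'
    simp only [Option.mem_def, Option.some.injEq] at hd
    subst hd
    simp [hu', hv']
  · simp only [Option.mem_def, Option.some.injEq] at hd
    subst hd
    simp [hz', h₂]

/-- The digits of `z` live at the generations between `blockScale` and `blockScale + fineLength` and
are invisible before. -/
theorem fine_div_eq_zero (hB : 0 < B) {q : ℕ × ℕ × ℕ × ℕ}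
    (hq : q ∈ blockIndex B D₁ D₂) {j : ℕ} (hj : j ≤ blockScale q.1) :
    q.2.2.2 / B ^ (blockScale q.1 + fineLength q.1 - j) = 0 :=
  Nat.div_eq_of_lt ((mem_digitSet.1 hq.2.2).1.trans_le (Nat.pow_le_pow_right hB (by omega)))

theorem blockLabel_succ_eq (hB : 0 < B) {q q' : ℕ × ℕ × ℕ × ℕ} (hq : q ∈ blockIndex B D₁ D₂)
    (hq' : q' ∈ blockIndex B D₁ D₂) {j : ℕ} (hl : blockLabel B j q = blockLabel B j q')
    (hd : blockDigit B j q = blockDigit B j q') : blockLabel B (j + 1) q = blockLabel B (j + 1) q' := by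
  have hz0 := fun c => fine_div_eq_zero hB hq (j := j + 1) c
  have hz0' := fun c => fine_div_eq_zero hB hq' (j := j + 1) c
  have hz1 := fun c => fine_div_eq_zero hB hq (j := j) c
  have hz1' := fun c => fine_div_eq_zero hB hq' (j := j) c
  have hub := (mem_digitSet.1 hq.1).1
  have hub' := (mem_digitSet.1 hq'.1).1
  have hvb := (mem_digitSet.1 hq.2.1).1
  have hvb' := (mem_digitSet.1 hq'.2.1).1
  obtain ⟨k, u, v, z⟩ := q
  obtain ⟨k', u', v', z'⟩ := q'
  dsimp only at hz0 hz0' hz1 hz1' hub hub' hvb hvb'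
  have hsome : ∀ q : ℕ × ℕ × ℕ × ℕ, ¬ j + 1 ≤ q.1 → ∃ d, blockDigit B j q = some d := by
    intro q hc
    simp only [blockDigit, if_neg hc]
    split_ifs <;> exact ⟨_, rfl⟩
  have hnone : ∀ q : ℕ × ℕ × ℕ × ℕ, j + 1 ≤ q.1 → blockDigit B j q = none := by
    intro q hc
    simp only [blockDigit, if_pos hc]
  by_cases hk : j + 1 ≤ k
  · have hk' : j + 1 ≤ k' := by
      by_contra hc
      obtain ⟨d, hd'⟩ := hsome (k', u', v', z') hc
      rw [hnone (k, u, v, z) hk, hd'] at hd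
      simp at hd
    simp [blockLabel, hk, hk']
  · have hk' : ¬ j + 1 ≤ k' := by
      intro hc
      obtain ⟨d, hd'⟩ := hsome (k, u, v, z) hk
      rw [hnone (k', u', v', z') hc, hd'] at hd
      simp at hd
    have hpar : k = k' ∧ u / B ^ (blockScale k - j) = u' / B ^ (blockScale k - j) ∧
        v / B ^ (blockScale k - j) = v' / B ^ (blockScale k - j) ∧
        z / B ^ (blockScale k + fineLength k - j) = z' / B ^ (blockScale k + fineLength k - j) := by
      by_cases hj : j ≤ k
      · have hj' : j ≤ k' := by
          by_contra hc
          simp [blockLabel, hj, hc] at hl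
        -- The `k`-th block detaches at generation `k + 1`, so here `k = k' = j`. The numbers `u`
        -- and `v` have only `blockScale k - k` digits, so all truncations at generation `k` vanish
        -- and the parents agree.
        obtain rfl : k = j := by omega
        obtain rfl : k' = k := by omega
        have e : blockScale k' - k' = blockLength k' := by have := blockLength_add k'; omega
        have hk2 : k' ≤ blockScale k' := by have := blockLength_add k'; omega
        rw [e, Nat.div_eq_of_lt hub, Nat.div_eq_of_lt hub', Nat.div_eq_of_lt hvb,
          Nat.div_eq_of_lt hvb', hz1 hk2, hz1' hk2]
        simp
      · have hj' : ¬ j ≤ k' := by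
          intro hc
          simp [blockLabel, hj, hc] at hl
        simp only [blockLabel, if_neg hj, if_neg hj', Option.some.injEq, Prod.mk.injEq] at hl
        obtain ⟨rfl, h1, h2, h3⟩ := hl
        exact ⟨rfl, h1, h2, h3⟩
    obtain ⟨rfl, pu, pv, pz⟩ := hpar
    simp only [blockLabel, if_neg hk, Option.some.injEq, Prod.mk.injEq, true_and]
    simp only [blockDigit, if_neg hk] at hd
    by_cases hj : j < blockScale k
    · rw [if_pos hj, if_pos hj] at hd
      have hduv : u / B ^ (blockScale k - (j + 1)) % B = u' / B ^ (blockScale k - (j + 1)) % B ∧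
          v / B ^ (blockScale k - (j + 1)) % B = v' / B ^ (blockScale k - (j + 1)) % B := by
        split_ifs at hd <;> simp only [Option.some.injEq, Prod.mk.injEq] at hd
        exacts [⟨hd.2, hd.1⟩, hd]
      refine ⟨div_pow_sub_succ_eq pu fun _ => hduv.1, div_pow_sub_succ_eq pv fun _ => hduv.2, ?_⟩
      rw [hz0 hj, hz0' hj]
    · rw [if_neg hj, if_neg hj] at hd
      simp only [Option.some.injEq, Prod.mk.injEq, and_true] at hd
      exact ⟨div_pow_sub_succ_eq pu fun c => absurd c hj,
        div_pow_sub_succ_eq pv fun c => absurd c hj, div_pow_sub_succ_eq pz fun _ => hd⟩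

end Block

/-- The hypotheses on the vertical offsets `o` and the horizontal perturbation `g` under which
`blockPoint` parametrises a regular set. -/
structure BlockData (B D₁ D₂ : ℕ) (o : ℕ → ℝ) (g : ℕ → ℕ → ℕ → ℝ)
    (J : Set (ℕ × ℕ × ℕ × ℕ)) : Prop where
  subset : J ⊆ blockIndex B D₁ D₂
  offset_ge : ∀ k, 2 * (B : ℝ)⁻¹ ^ k ≤ o k
  offset_le : ∀ k, o k ≤ 4 * (B : ℝ)⁻¹ ^ k
  abs_le : ∀ q ∈ J, |g q.1 q.2.2.1 q.2.2.2| ≤ 9 * (B : ℝ)⁻¹ ^ blockScale q.1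
  upper : ∀ k u v z z', (k, u, v, z) ∈ J → (k, u, v, z') ∈ J →
    |g k v z - g k v z'| ≤ 6 * (|(z : ℝ) - z'| * (B : ℝ)⁻¹ ^ (blockScale k + fineLength k))
  lower : ∀ k u v z z', (k, u, v, z) ∈ J → (k, u, v, z') ∈ J →
    |(z : ℝ) - z'| * (B : ℝ)⁻¹ ^ (blockScale k + fineLength k) ≤ |g k v z - g k v z'|

namespace BlockData

variable {B D₁ D₂ : ℕ} {e : ℝ} {o : ℕ → ℝ} {g : ℕ → ℕ → ℕ → ℝ} {J : Set (ℕ × ℕ × ℕ × ℕ)}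

theorem natCast_mul_le (hB : 0 < B) {k u : ℕ} (hu : u < B ^ blockLength k) :
    (u : ℝ) * (B : ℝ)⁻¹ ^ blockScale k ≤ (B : ℝ)⁻¹ ^ k := by
  have hB0 : (0 : ℝ) < B := by exact_mod_cast hB
  have h1 : (u : ℝ) ≤ (B : ℝ) ^ blockLength k := by exact_mod_cast hu.le
  calc _ ≤ (B : ℝ) ^ blockLength k * (B : ℝ)⁻¹ ^ blockScale k := by gcongr
    _ = _ := by
      rw [← blockLength_add, pow_add, inv_pow, inv_pow]
      field_simp

theorem dist_le (hB : 2 ≤ B) (hd : BlockData B D₁ D₂ o g J) {q q' : ℕ × ℕ × ℕ × ℕ} (hq : q ∈ J)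
    (hq' : q' ∈ J) {j : ℕ} (h : blockLabel B j q = blockLabel B j q') :
    dist (blockPoint B e o g q) (blockPoint B e o g q') ≤ 24 * (B : ℝ)⁻¹ ^ j := by
  have hB0 : 0 < B := by omega
  have hl0 : (0 : ℝ) < (B : ℝ)⁻¹ := by positivity
  have hl1 : (B : ℝ)⁻¹ ≤ 1 := inv_le_one_of_one_le₀ (by exact_mod_cast hB0)
  have hanti : ∀ {a b : ℕ}, a ≤ b → (B : ℝ)⁻¹ ^ b ≤ (B : ℝ)⁻¹ ^ a :=
    fun hab => pow_le_pow_of_le_one hl0.le hl1 hab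
  have hub := natCast_mul_le hB0 (mem_digitSet.1 (hd.subset hq).1).1
  have hub' := natCast_mul_le hB0 (mem_digitSet.1 (hd.subset hq').1).1
  have hvb := natCast_mul_le hB0 (mem_digitSet.1 (hd.subset hq).2.1).1
  have hvb' := natCast_mul_le hB0 (mem_digitSet.1 (hd.subset hq').2.1).1
  have hg := hd.abs_le q hq
  have hg' := hd.abs_le q' hq'
  refine (Plane.dist_le _ _).trans ?_
  obtain ⟨k, u, v, z⟩ := q
  obtain ⟨k', u', v', z'⟩ := q'
  simp only [blockPoint, PiLp.toLp_apply, Matrix.cons_val_zero, Matrix.cons_val_one]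
  dsimp only at hub hub' hvb hvb' hg hg'
  have hu0 : (0 : ℝ) ≤ u * (B : ℝ)⁻¹ ^ blockScale k := by positivity
  have hu0' : (0 : ℝ) ≤ u' * (B : ℝ)⁻¹ ^ blockScale k' := by positivity
  have hv0 : (0 : ℝ) ≤ v * (B : ℝ)⁻¹ ^ blockScale k := by positivity
  have hv0' : (0 : ℝ) ≤ v' * (B : ℝ)⁻¹ ^ blockScale k' := by positivity
  by_cases hj : j ≤ k
  · have hj' : j ≤ k' := by
      by_contra hc
      simp [blockLabel, hj, hc] at h
    have a1 := hanti hj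
    have a2 := hanti hj'
    have a3 : (B : ℝ)⁻¹ ^ blockScale k ≤ (B : ℝ)⁻¹ ^ j :=
      hanti (by have := blockLength_add k; omega)
    have a4 : (B : ℝ)⁻¹ ^ blockScale k' ≤ (B : ℝ)⁻¹ ^ j :=
      hanti (by have := blockLength_add k'; omega)
    have o1 := hd.offset_ge k
    have o2 := hd.offset_le k
    have o3 := hd.offset_ge k'
    have o4 := hd.offset_le k'
    have p1 : 0 < (B : ℝ)⁻¹ ^ k := by positivity
    have p2 : 0 < (B : ℝ)⁻¹ ^ k' := by positivity
    rw [_root_.abs_le] at hg hg'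
    have hx : |(e + u * (B : ℝ)⁻¹ ^ blockScale k + g k v z) -
        (e + u' * (B : ℝ)⁻¹ ^ blockScale k' + g k' v' z')| ≤ 19 * (B : ℝ)⁻¹ ^ j :=
      _root_.abs_le.2 ⟨by linarith, by linarith⟩
    have hy : |(o k + v * (B : ℝ)⁻¹ ^ blockScale k) -
        (o k' + v' * (B : ℝ)⁻¹ ^ blockScale k')| ≤ 5 * (B : ℝ)⁻¹ ^ j :=
      _root_.abs_le.2 ⟨by linarith, by linarith⟩
    linarith
  · have hj' : ¬ j ≤ k' := by
      intro hc
      simp [blockLabel, hj, hc] at h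
    simp only [blockLabel, if_neg hj, if_neg hj', Option.some.injEq, Prod.mk.injEq] at h
    obtain ⟨rfl, h1, h2, h3⟩ := h
    have eu := abs_sub_mul_inv_pow_le hB0 h1
    have ev := abs_sub_mul_inv_pow_le hB0 h2
    have ez := abs_sub_mul_inv_pow_le hB0 h3
    have hp : (0 : ℝ) < (B : ℝ)⁻¹ ^ blockScale k := by positivity
    have hpj : (0 : ℝ) < (B : ℝ)⁻¹ ^ j := by positivity
    -- Up to generation `blockScale` the perturbations are below the resolution, and `9 + 9`
    -- suffices. Beyond it `u` and `v` are completely determined, and the perturbation is Lipschitz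
    -- in `z` at the matching scale.
    have hgd : |g k v z - g k v' z'| ≤ 18 * (B : ℝ)⁻¹ ^ j := by
      rcases le_or_gt j (blockScale k) with hL | hL
      · have := hanti hL
        refine (abs_sub _ _).trans ?_
        linarith
      · have z0 : blockScale k - j = 0 := by omega
        rw [z0, pow_zero, Nat.div_one, Nat.div_one] at h1 h2
        subst h1 h2
        have := hd.upper k u v z z' hq hq'
        linarith
    have hx : |(e + u * (B : ℝ)⁻¹ ^ blockScale k + g k v z) -
        (e + u' * (B : ℝ)⁻¹ ^ blockScale k + g k v' z')| ≤ 19 * (B : ℝ)⁻¹ ^ j := by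
      have : (e + u * (B : ℝ)⁻¹ ^ blockScale k + g k v z) -
        (e + u' * (B : ℝ)⁻¹ ^ blockScale k + g k v' z') =
        ((u : ℝ) - u') * (B : ℝ)⁻¹ ^ blockScale k + (g k v z - g k v' z') := by ring
      rw [this]
      refine (abs_add_le _ _).trans ?_
      rw [abs_mul, abs_of_pos hp]
      linarith
    have hy : |(o k + v * (B : ℝ)⁻¹ ^ blockScale k) -
        (o k + v' * (B : ℝ)⁻¹ ^ blockScale k)| ≤ (B : ℝ)⁻¹ ^ j := by
      rw [add_sub_add_left_eq_sub, ← sub_mul, abs_mul, abs_of_pos hp]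
      exact ev
    linarith

/-- Ordinates in block `k` are at least `2 * B ^ (-k)`, those in a later block `k'` at most `5 * B ^
(-k') ≤ (5/8) * B ^ (-k)`. The gap exceeds `2 * B ^ (-j)` for every `j > k`, since `B ≥ 8`. -/
theorem fst_eq_of_dist_lt (hB : 8 ≤ B) (hd : BlockData B D₁ D₂ o g J) {q q' : ℕ × ℕ × ℕ × ℕ}
    (hq : q ∈ J) (hq' : q' ∈ J) {j : ℕ} (hj : q.1 < j) (hj' : q'.1 < j)
    (h : dist (blockPoint B e o g q) (blockPoint B e o g q') < 2 * (B : ℝ)⁻¹ ^ j) :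
    q.1 = q'.1 := by
  wlog hlt : q.1 < q'.1 generalizing q q'
  · rcases eq_or_lt_of_le (not_lt.1 hlt) with h' | h'
    · exact h'.symm
    · exact (this hq' hq hj' hj (by rwa [dist_comm]) h').symm
  exfalso
  have hB0 : 0 < B := by omega
  have hl0 : (0 : ℝ) < (B : ℝ)⁻¹ := by positivity
  have hl8 : (B : ℝ)⁻¹ ≤ 1 / 8 := by
    rw [one_div]
    exact inv_anti₀ (by norm_num) (by exact_mod_cast hB)
  have hstep : ∀ {a b : ℕ}, a < b → (B : ℝ)⁻¹ ^ b ≤ (1 / 8) * (B : ℝ)⁻¹ ^ a := by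
    intro a b hab
    calc (B : ℝ)⁻¹ ^ b ≤ (B : ℝ)⁻¹ ^ (a + 1) := pow_le_pow_of_le_one hl0.le (by linarith) hab
      _ = (B : ℝ)⁻¹ * (B : ℝ)⁻¹ ^ a := by ring
      _ ≤ _ := by gcongr
  have hv' := natCast_mul_le hB0 (mem_digitSet.1 (hd.subset hq').2.1).1
  have hv0 : (0 : ℝ) ≤ q.2.2.1 * (B : ℝ)⁻¹ ^ blockScale q.1 := by positivity
  have h1 := (Plane.abs_sub_le (blockPoint B e o g q) (blockPoint B e o g q') 1).trans_lt h
  simp only [blockPoint, PiLp.toLp_apply, Matrix.cons_val_one, Matrix.cons_val_zero] at h1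
  have h2 := (abs_lt.1 h1).2
  have := hd.offset_ge q.1
  have := hd.offset_le q'.1
  have := hstep hlt
  have := hstep hj
  have : 0 < (B : ℝ)⁻¹ ^ q.1 := by positivity
  linarith

/-- A small ball meets only one detached block. There the ordinate locates `v`, the abscissa locates
`u` up to the perturbation, and once `u` and `v` are known exactly the lower bound on the
perturbation locates `z`. -/
theorem regularCover {α : ℝ} (hα : 0 ≤ α) (hB : 8 ≤ B) (h₁ : 0 < D₁) (h₂ : 0 < D₂)
    (hD : (D₁ * D₂ + 1 : ℝ) ≤ (B : ℝ) ^ α) (hd : BlockData B D₁ D₂ o g J) :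
    RegularCover α (blockPoint B e o g '' J) := by
  have hB0 : 0 < B := by omega
  have hB1 : (1 : ℝ) < B := by exact_mod_cast (by omega : 1 < B)
  have hl0 : (0 : ℝ) < (B : ℝ)⁻¹ := by positivity
  have hl1 : (B : ℝ)⁻¹ < 1 := inv_lt_one_of_one_lt₀ hB1
  rw [Set.image_eq_range]
  refine regularCover_range_of_tree hα hl0 hl1 (c := 24) (by norm_num) _
    (fun j (i : J) => blockLabel B j i.1)
    (Finset.insertNone (Finset.range 21 ×ˢ Finset.range 3 ×ˢ Finset.range 3))
    (Finset.insertNone (Finset.range D₁ ×ˢ Finset.range D₂)) ?_ ?_ ?_ ?_ ?_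
  · rw [Finset.card_insertNone, Finset.card_product, Finset.card_range, Finset.card_range, inv_inv]
    push_cast
    exact hD
  · intro j i i' h
    exact hd.dist_le (by omega) i.2 i'.2 h
  · refine ⟨fun _ => none, fun _ => by simp, fun i i' _ => ?_⟩
    simp [blockLabel]
  · intro j x
    refine ⟨fun i => if j ≤ i.1.1 then none else some
      (i.1.2.1 / B ^ (blockScale i.1.1 - j) % 21, i.1.2.2.1 / B ^ (blockScale i.1.1 - j) % 3,
        i.1.2.2.2 / B ^ (blockScale i.1.1 + fineLength i.1.1 - j) % 3), fun i => ?_, ?_⟩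
    · rw [Finset.mem_insertNone]
      intro d hdm
      dsimp only at hdm
      split_ifs at hdm
      · simp at hdm
      · simp only [Option.mem_def, Option.some.injEq] at hdm
        subst hdm
        simp [Nat.mod_lt]
    · rintro ⟨q, hq⟩ ⟨q', hq'⟩ hi hi' hcode
      dsimp only at hi hi' hcode ⊢
      have hdist : dist (blockPoint B e o g q) (blockPoint B e o g q') < 2 * (B : ℝ)⁻¹ ^ j := by
        rw [Metric.mem_ball] at hi hi'
        linarith [dist_triangle_right (blockPoint B e o g q) (blockPoint B e o g q') x]
      by_cases hj : j ≤ q.1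
      · have hj' : j ≤ q'.1 := by
          by_contra hc
          simp [hj, hc] at hcode
        simp [blockLabel, hj, hj']
      · have hj' : ¬ j ≤ q'.1 := by
          intro hc
          simp [hj, hc] at hcode
        have hk := hd.fst_eq_of_dist_lt hB hq hq' (not_le.1 hj) (not_le.1 hj') hdist
        have hx := (Plane.abs_sub_le _ _ 0).trans_lt hdist
        have hy := (Plane.abs_sub_le _ _ 1).trans_lt hdist
        have hg := hd.abs_le q hq
        have hg' := hd.abs_le q' hq'
        have hz0 := fun c => fine_div_eq_zero hB0 (hd.subset hq) (j := j) c
        have hz0' := fun c => fine_div_eq_zero hB0 (hd.subset hq') (j := j) c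
        obtain ⟨k, u, v, z⟩ := q
        obtain ⟨k', u', v', z'⟩ := q'
        dsimp only at hk hj hj' hg hg' hz0 hz0'
        subst hk
        simp only [if_neg hj, Option.some.injEq, Prod.mk.injEq] at hcode
        simp only [blockPoint, PiLp.toLp_apply, Matrix.cons_val_one, Matrix.cons_val_zero] at hx hy
        have hp : (0 : ℝ) < (B : ℝ)⁻¹ ^ blockScale k := by positivity
        have hpj : (0 : ℝ) < (B : ℝ)⁻¹ ^ j := by positivity
        have ev : v / B ^ (blockScale k - j) = v' / B ^ (blockScale k - j) := by
          refine div_pow_sub_eq_of_mod_eq (C := 2) hB0 ?_ hcode.2.1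
          rw [add_sub_add_left_eq_sub, ← sub_mul, abs_mul, abs_of_pos hp] at hy
          exact_mod_cast hy.le
        have hmin : blockScale k - min j (blockScale k) = blockScale k - j := by omega
        -- The tolerance `20` is `2` for the diameter of the ball plus `9 + 9` for the
        -- perturbations. The latter have size `B ^ (-blockScale k)`, so the comparison is made at
        -- generation `min j (blockScale k)`, beyond which `u` has no further digits.
        have eu : u / B ^ (blockScale k - j) = u' / B ^ (blockScale k - j) := by
          have m1 : (B : ℝ)⁻¹ ^ j ≤ (B : ℝ)⁻¹ ^ min j (blockScale k) :=
            pow_le_pow_of_le_one hl0.le hl1.le (min_le_left _ _)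
          have m2 : (B : ℝ)⁻¹ ^ blockScale k ≤ (B : ℝ)⁻¹ ^ min j (blockScale k) :=
            pow_le_pow_of_le_one hl0.le hl1.le (min_le_right _ _)
          rw [← hmin]
          refine div_pow_sub_eq_of_mod_eq (C := 20) hB0 ?_ (by rw [hmin]; exact hcode.1)
          have e1 : |(u : ℝ) - u'| * (B : ℝ)⁻¹ ^ blockScale k =
              |((u : ℝ) - u') * (B : ℝ)⁻¹ ^ blockScale k| := by
            rw [abs_mul, abs_of_pos hp]
          rw [e1]
          push_cast
          rw [_root_.abs_le] at hg hg' ⊢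
          rw [abs_lt] at hx
          constructor <;> nlinarith
        have ez : z / B ^ (blockScale k + fineLength k - j) =
            z' / B ^ (blockScale k + fineLength k - j) := by
          rcases le_or_gt j (blockScale k) with hL | hL
          · rw [hz0 hL, hz0' hL]
          · have z0 : blockScale k - j = 0 := by omega
            rw [z0, pow_zero, Nat.div_one, Nat.div_one] at eu ev
            subst eu ev
            refine div_pow_sub_eq_of_mod_eq (C := 2) hB0 ?_ hcode.2.2
            refine (hd.lower k u v z z' hq hq').trans ?_
            rw [add_sub_add_left_eq_sub] at hx
            exact_mod_cast hx.le
        simp only [blockLabel, if_neg hj, eu, ev, ez]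
  · intro j
    exact ⟨fun i => blockDigit B j i.1, fun i => blockDigit_mem hB0 h₁ h₂ (hd.subset i.2) j,
      fun i i' => blockLabel_succ_eq hB0 (hd.subset i.2) (hd.subset i'.2)⟩

theorem isBounded (hB : 2 ≤ B) (hd : BlockData B D₁ D₂ o g J) :
    Bornology.IsBounded (blockPoint B e o g '' J) := by
  refine Metric.isBounded_iff.2 ⟨24 * (B : ℝ)⁻¹ ^ 0, ?_⟩
  rintro _ ⟨q, hq, rfl⟩ _ ⟨q', hq', rfl⟩
  exact hd.dist_le hB hq hq' (j := 0) (by simp [blockLabel])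

end BlockData

/-! ### The block construction: exact unit distances and their number -/

/-- The height difference of the unit distance pairs in the `k`-th block. -/
noncomputable def blockHeight (B k v z : ℕ) : ℝ :=
  ((v % B ^ fineLength k : ℕ) - (z : ℝ) + 2 * (B : ℝ) ^ fineLength k) * (B : ℝ)⁻¹ ^ blockScale k

/-- The horizontal perturbation that makes the distances of the pairs exactly one. -/
noncomputable def blockShift (B k v z : ℕ) : ℝ := √(1 - blockHeight B k v z ^ 2) - 1

section BlockPairs

variable {B D₁ D₂ : ℕ}

theorem pow_mul_inv_pow_blockScale (hB : 0 < B) (k : ℕ) :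
    (B : ℝ) ^ fineLength k * (B : ℝ)⁻¹ ^ blockScale k = (B : ℝ)⁻¹ ^ fineLength k := by
  have hB0 : (0 : ℝ) < B := by exact_mod_cast hB
  rw [blockScale, two_mul, pow_add, inv_pow]
  field_simp

/-- The term `2 * B ^ fineLength k` keeps the height comparable to `B ^ (-fineLength k)`. Being
bounded away from `0`, it makes the slope of `√(1 - w ^ 2)` comparable to `B ^ (-fineLength k)` too,
so different `z` yield well-spaced perturbations. -/
theorem blockHeight_mem (hB : 0 < B) {k v z : ℕ} (hz : z < B ^ fineLength k) :
    (B : ℝ)⁻¹ ^ fineLength k ≤ blockHeight B k v z ∧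
      blockHeight B k v z ≤ 3 * (B : ℝ)⁻¹ ^ fineLength k := by
  have hB0 : (0 : ℝ) < B := by exact_mod_cast hB
  have h1 : ((v % B ^ fineLength k : ℕ) : ℝ) ≤ (B : ℝ) ^ fineLength k := by
    exact_mod_cast (Nat.mod_lt v (pow_pos hB _)).le
  have h2 : (z : ℝ) ≤ (B : ℝ) ^ fineLength k := by exact_mod_cast hz.le
  have h3 : (0 : ℝ) ≤ ((v % B ^ fineLength k : ℕ) : ℝ) := by positivity
  have h4 : (0 : ℝ) ≤ z := by positivity
  have hp : (0 : ℝ) < (B : ℝ)⁻¹ ^ blockScale k := by positivity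
  rw [← pow_mul_inv_pow_blockScale hB, blockHeight, ← mul_assoc]
  constructor <;> gcongr <;> linarith

theorem inv_pow_fineLength_le (hB : 8 ≤ B) {k : ℕ} (hk : 1 ≤ k) :
    (B : ℝ)⁻¹ ^ fineLength k ≤ 1 / 8 := by
  have hB0 : 0 < B := by omega
  have h8 : (B : ℝ)⁻¹ ≤ 1 / 8 := by
    rw [one_div]
    exact inv_anti₀ (by norm_num) (by exact_mod_cast hB)
  have h0 : (0 : ℝ) ≤ (B : ℝ)⁻¹ := by positivity
  refine le_trans ?_ h8
  simpa using pow_le_pow_of_le_one h0 (by linarith) (n := fineLength k) (m := 1)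
    (by rw [fineLength]; omega)

/-- With `A` and `C` the two roots, `|A - C| * (A + C) = |w - w'| * (w + w')`, where `1 ≤ A + C ≤ 2`
and `2 * m ≤ w + w' ≤ 6 * m`. -/
theorem abs_sqrt_sub_sqrt_bounds {m w w' : ℝ} (hm : m ≤ 1 / 8) (hw : m ≤ w)
    (hw3 : w ≤ 3 * m) (hw' : m ≤ w') (hw3' : w' ≤ 3 * m) :
    |w - w'| * m ≤ |√(1 - w ^ 2) - √(1 - w' ^ 2)| ∧
      |√(1 - w ^ 2) - √(1 - w' ^ 2)| ≤ 6 * (|w - w'| * m) := by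
  have hm0 : 0 ≤ m := by linarith
  have b : ∀ {x}, m ≤ x → x ≤ 3 * m → 1 / 2 ≤ √(1 - x ^ 2) ∧ √(1 - x ^ 2) ≤ 1 ∧
      √(1 - x ^ 2) ^ 2 = 1 - x ^ 2 := by
    intro x h1 h2
    have hx : x ^ 2 ≤ 1 / 4 := by nlinarith
    refine ⟨Real.le_sqrt_of_sq_le (by nlinarith), ?_, Real.sq_sqrt (by linarith)⟩
    rw [Real.sqrt_le_one]
    nlinarith
  obtain ⟨a1, a2, a3⟩ := b hw hw3
  obtain ⟨c1, c2, c3⟩ := b hw' hw3'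
  set A := √(1 - w ^ 2)
  set C := √(1 - w' ^ 2)
  have key : |A - C| * (A + C) = |w - w'| * (w + w') := by
    rw [← abs_of_nonneg (by linarith : 0 ≤ A + C), ← abs_of_nonneg (by linarith : 0 ≤ w + w'),
      ← abs_mul, ← abs_mul, ← abs_neg]
    congr 1
    linear_combination c3 - a3
  have d1 := abs_nonneg (A - C)
  have d2 := abs_nonneg (w - w')
  constructor
  · have e1 : |A - C| * (A + C) ≤ |A - C| * 2 := by gcongr; linarith
    have e2 : |w - w'| * (2 * m) ≤ |w - w'| * (w + w') := by gcongr; linarith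
    linarith
  · have e1 : |A - C| * 1 ≤ |A - C| * (A + C) := by gcongr; linarith
    have e2 : |w - w'| * (w + w') ≤ |w - w'| * (6 * m) := by gcongr; linarith
    linarith

theorem blockHeight_sub (k v z z' : ℕ) :
    |blockHeight B k v z - blockHeight B k v z'| =
      |(z : ℝ) - z'| * (B : ℝ)⁻¹ ^ blockScale k := by
  rw [blockHeight, blockHeight, ← sub_mul, abs_mul,
    abs_of_nonneg (by positivity : (0 : ℝ) ≤ (B : ℝ)⁻¹ ^ blockScale k), abs_sub_comm (z : ℝ)]
  congr 2
  ring

theorem blockData_left (hB : 0 < B) : BlockData B D₁ D₂ (fun k => 2 * (B : ℝ)⁻¹ ^ k) (fun _ _ _ => 0)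
    {q | q ∈ blockIndex B D₁ D₂ ∧ q.2.2.2 = 0} where
  subset := fun q hq => hq.1
  offset_ge := fun k => le_rfl
  offset_le := fun k => by
    have : (0 : ℝ) ≤ (B : ℝ)⁻¹ ^ k := by positivity
    linarith
  abs_le := fun q _ => by
    rw [abs_zero]
    positivity
  upper := fun k u v z z' _ _ => by
    rw [sub_self, abs_zero]
    positivity
  lower := fun k u v z z' h h' => by
    obtain rfl : z = 0 := h.2
    obtain rfl : z' = 0 := h'.2
    simp

/-- The scale is the square of the height, `blockScale = 2 * fineLength`, so that `1 - √(1 - w ^ 2)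
≤ w ^ 2 ≤ 9 * B ^ (-blockScale k)`: the correction that makes distances exact is invisible at scale
`B ^ (-blockScale k)`. The offset is raised to match the term added to the height. The block `k = 0`
is left out because there `fineLength k = 0` and `w` need not be below `1`. -/
theorem blockData_right (hB : 8 ≤ B) : BlockData B D₁ D₂
    (fun k => 2 * (B : ℝ)⁻¹ ^ k + 2 * (B : ℝ)⁻¹ ^ fineLength k) (blockShift B)
    {q | q ∈ blockIndex B D₁ D₂ ∧ 1 ≤ q.1} := by
  have hB0 : 0 < B := by omega
  have hl0 : (0 : ℝ) < (B : ℝ)⁻¹ := by positivity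
  have hl1 : (B : ℝ)⁻¹ ≤ 1 := inv_le_one_of_one_le₀ (by exact_mod_cast hB0)
  have hz : ∀ {k u v z}, (k, u, v, z) ∈ blockIndex B D₁ D₂ → z < B ^ fineLength k :=
    fun h => (mem_digitSet.1 h.2.2).1
  have hbounds : ∀ k u v z z', (k, u, v, z) ∈ blockIndex B D₁ D₂ ∧ 1 ≤ k →
      (k, u, v, z') ∈ blockIndex B D₁ D₂ ∧ 1 ≤ k →
      |(z : ℝ) - z'| * (B : ℝ)⁻¹ ^ (blockScale k + fineLength k) ≤
        |blockShift B k v z - blockShift B k v z'| ∧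
      |blockShift B k v z - blockShift B k v z'| ≤
        6 * (|(z : ℝ) - z'| * (B : ℝ)⁻¹ ^ (blockScale k + fineLength k)) := by
    intro k u v z z' h h'
    obtain ⟨w1, w2⟩ := blockHeight_mem hB0 (v := v) (hz h.1)
    obtain ⟨w1', w2'⟩ := blockHeight_mem hB0 (v := v) (hz h'.1)
    have := abs_sqrt_sub_sqrt_bounds (inv_pow_fineLength_le hB h.2) w1 w2 w1' w2'
    rw [blockHeight_sub, mul_assoc, ← pow_add] at this
    simpa only [blockShift, sub_sub_sub_cancel_right] using this
  refine ⟨fun q hq => hq.1, fun k => ?_, fun k => ?_, ?_, fun k u v z z' h h' =>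
    (hbounds k u v z z' h h').2, fun k u v z z' h h' => (hbounds k u v z z' h h').1⟩
  · have : (0 : ℝ) ≤ (B : ℝ)⁻¹ ^ fineLength k := by positivity
    linarith
  · have : (B : ℝ)⁻¹ ^ fineLength k ≤ (B : ℝ)⁻¹ ^ k :=
      pow_le_pow_of_le_one hl0.le hl1 (by rw [fineLength]; omega)
    linarith
  · rintro ⟨k, u, v, z⟩ ⟨h, hk⟩
    obtain ⟨w1, w2⟩ := blockHeight_mem hB0 (v := v) (hz h)
    have hm := inv_pow_fineLength_le hB hk
    have hp : (0 : ℝ) < (B : ℝ)⁻¹ ^ fineLength k := by positivity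
    simp only [blockShift]
    have e : (B : ℝ)⁻¹ ^ blockScale k = ((B : ℝ)⁻¹ ^ fineLength k) ^ 2 := by
      rw [blockScale, mul_comm, pow_mul]
    rw [e]
    set m := (B : ℝ)⁻¹ ^ fineLength k
    set w := blockHeight B k v z
    have hw : w ^ 2 ≤ 9 * m ^ 2 := by nlinarith
    have hw1 : w ^ 2 ≤ 1 := by nlinarith
    have s1 : √(1 - w ^ 2) ≤ 1 := by
      rw [Real.sqrt_le_one]
      nlinarith
    have s2 : 1 - w ^ 2 ≤ √(1 - w ^ 2) := by
      refine Real.le_sqrt_of_sq_le ?_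
      nlinarith [sq_nonneg w]
    rw [abs_le]
    constructor <;> linarith

/-- The left partner of the right-hand point with data `(u, v, z)` has the coarse digits of `v` and
the fine digits `z`. The digit constraints are imposed place by place, so this recombination stays
admissible. -/
theorem replace_fine_mem (hB : 0 < B) {k v z : ℕ}
    (hv : v ∈ digitSet B (fun i => if i < fineLength k then D₁ else D₂) (blockLength k))
    (hz : z ∈ digitSet B (fun _ => D₁) (fineLength k)) :
    v / B ^ fineLength k * B ^ fineLength k + z ∈
      digitSet B (fun i => if i < fineLength k then D₁ else D₂) (blockLength k) := by
  rw [mem_digitSet] at hv hz ⊢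
  have hpos : 0 < B ^ fineLength k := pow_pos hB _
  have hdiv : (v / B ^ fineLength k * B ^ fineLength k + z) / B ^ fineLength k =
      v / B ^ fineLength k := by
    rw [mul_comm, Nat.mul_add_div hpos, Nat.div_eq_of_lt hz.1, add_zero]
  refine ⟨?_, fun i hi => ?_⟩
  · have h1 : v / B ^ fineLength k < B ^ k ^ 2 := by
      rw [Nat.div_lt_iff_lt_mul hpos, ← pow_add, add_comm]
      exact hv.1
    have h2 : (v / B ^ fineLength k + 1) * B ^ fineLength k ≤ B ^ k ^ 2 * B ^ fineLength k :=
      Nat.mul_le_mul_right _ h1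
    rw [blockLength, pow_add]
    linarith [hz.1]
  · by_cases hc : i < fineLength k
    · rw [if_pos hc, digit_mul_pow_add hB hc]
      exact hz.2 i hc
    · have := hv.2 i hi
      obtain ⟨m, rfl⟩ := Nat.exists_eq_add_of_le (not_lt.1 hc)
      rw [pow_add, ← Nat.div_div_eq_div_mul] at this ⊢
      rwa [hdiv]

theorem pow_le_card_block (hB : 0 < B) (h₁ : D₁ ≤ B) (h₂ : D₂ ≤ B) (k : ℕ) :
    D₁ ^ fineLength k * D₂ ^ k ^ 2 ≤
      (digitSet B (fun i => if i < fineLength k then D₁ else D₂) (blockLength k)).card := by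
  refine le_trans (le_of_eq ?_)
    (prod_le_card_digitSet hB (fun i => by split_ifs <;> assumption) (blockLength k))
  rw [blockLength, Finset.prod_range_add]
  congr 1
  · rw [Finset.prod_congr rfl (fun i hi => if_pos (Finset.mem_range.1 hi))]
    simp
  · simp

/-- With `n` the square of the block number, each of `u` and `v` takes at least `(D₁ * D₂) ^ n`
values and `z` takes at least `D₁ ^ n`, at a scale `B ^ (-2n)` up to a negligible power. The
exponent is `(3 * s₁ + 2 * s₂) / 2`. The gain `s₁ / 2` over `s₁ + s₂` comes from `z`, the free fine
ordinate of the partner, so vertical fine digits get the larger alphabet in the applications. -/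
theorem block_le_unitDistanceDim {α s₁ s₂ : ℝ} (hα : 0 < α) (hα2 : α ≤ 2) (hB : 8 ≤ B)
    (h₁ : 1 ≤ D₁) (h₂ : 1 ≤ D₂) (h₁B : D₁ ≤ B) (h₂B : D₂ ≤ B)
    (hD : (D₁ * D₂ + 1 : ℝ) ≤ (B : ℝ) ^ α) (hs₁ : (B : ℝ) ^ s₁ ≤ D₁) (hs₂ : (B : ℝ) ^ s₂ ≤ D₂) :
    ((3 * s₁ / 2 + s₂ : ℝ) : EReal) ≤ unitDistanceDim 2 α := by
  have hB0 : 0 < B := by omega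
  have hB1 : (1 : ℝ) < B := by exact_mod_cast (by omega : 1 < B)
  have hB0' : (0 : ℝ) < B := by linarith
  have hX := blockData_left (D₁ := D₁) (D₂ := D₂) hB0
  have hY := blockData_right (D₁ := D₁) (D₂ := D₂) hB
  have hm : ∀ k : ℕ, (B : ℝ) ^ (-((blockScale (k + 1) : ℕ) : ℝ)) =
      ((B : ℝ) ^ blockScale (k + 1))⁻¹ := fun k => by
    rw [Real.rpow_neg hB0'.le, Real.rpow_natCast]
  have hk1 : Tendsto (fun k : ℕ => (k : ℝ) + 1) atTop atTop :=
    tendsto_atTop_add_const_right _ _ tendsto_natCast_atTop_atTop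
  have hscale : ∀ k : ℕ, ((blockScale (k + 1) : ℕ) : ℝ) = 2 * (((k : ℝ) + 1) ^ 2 + (k + 1)) := by
    intro k
    simp [blockScale, fineLength]
  refine le_unitDistanceDim hα (exists_regularCover_of_le_two hα hα2)
    ((hX.isBounded (e := 0) (by omega)).union (hY.isBounded (e := 1) (by omega)))
    ((hX.regularCover (e := 0) hα.le hB h₁ h₂ hD).union
      (hY.regularCover (e := 1) hα.le hB h₁ h₂ hD))
    (fun k : ℕ => (B : ℝ) ^ (-((blockScale (k + 1) : ℕ) : ℝ)) / 3)
    (tendsto_rpow_neg_div_three hB1 ?_) (fun k => by positivity)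
    (fun k => digitSet B (fun i => if i < fineLength (k + 1) then D₂ else D₁) (blockLength (k + 1)) ×ˢ
      digitSet B (fun i => if i < fineLength (k + 1) then D₁ else D₂) (blockLength (k + 1)) ×ˢ
      digitSet B (fun _ => D₁) (fineLength (k + 1)))
    (fun k q => unitPair (q.1 * (B : ℝ)⁻¹ ^ blockScale (k + 1))
      (2 * (B : ℝ)⁻¹ ^ (k + 1) + ((q.2.1 / B ^ fineLength (k + 1) * B ^ fineLength (k + 1) + q.2.2 :
        ℕ) : ℝ) * (B : ℝ)⁻¹ ^ blockScale (k + 1)) (blockHeight B (k + 1) q.2.1 q.2.2)) ?_ ?_ ?_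
  · refine tendsto_natCast_atTop_atTop.comp (tendsto_atTop_mono (fun k => ?_) tendsto_id)
    rw [← blockLength_add]
    simp only [id]
    omega
  · rintro k ⟨u, v, z⟩ hq
    simp only [Finset.mem_product] at hq ⊢
    obtain ⟨hu, hv, hz⟩ := hq
    have hz' := (mem_digitSet.1 hz).1
    refine ⟨Or.inl ⟨(k + 1, u, v / B ^ fineLength (k + 1) * B ^ fineLength (k + 1) + z, 0),
      ⟨⟨hu, replace_fine_mem hB0 hv hz, ?_⟩, rfl⟩, ?_⟩, Or.inr ⟨(k + 1, u, v, z),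
      ⟨⟨hu, hv, hz⟩, by simp⟩, ?_⟩, norm_unitPair_sub ?_⟩
    · rw [mem_digitSet]
      exact ⟨pow_pos hB0 _, fun i _ => by simpa using Nat.lt_of_lt_of_le one_pos h₁⟩
    · ext i
      fin_cases i <;> simp [blockPoint, unitPair]
    · ext i
      fin_cases i
      · simp only [blockPoint, unitPair, blockShift, Fin.zero_eta, PiLp.toLp_apply,
          Matrix.cons_val_zero]
        ring
      · simp only [blockPoint, unitPair, Fin.mk_one, PiLp.toLp_apply, Matrix.cons_val_one,
          Matrix.cons_val_zero]
        rw [← pow_mul_inv_pow_blockScale hB0, blockHeight]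
        have hdm : ((v / B ^ fineLength (k + 1) * B ^ fineLength (k + 1) : ℕ) : ℝ) +
            ((v % B ^ fineLength (k + 1) : ℕ) : ℝ) = v := by
          exact_mod_cast Nat.div_add_mod' v (B ^ fineLength (k + 1))
        rw [Nat.cast_add]
        linear_combination -(B : ℝ)⁻¹ ^ blockScale (k + 1) * hdm
    · obtain ⟨w1, w2⟩ := blockHeight_mem hB0 (v := v) hz'
      have := inv_pow_fineLength_le hB (k := k + 1) (by omega)
      have hp : (0 : ℝ) < (B : ℝ)⁻¹ ^ fineLength (k + 1) := by positivity
      rw [abs_le]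
      constructor <;> linarith
  · rintro k ⟨u, v, z⟩ hq ⟨u', v', z'⟩ hq' hne
    have hL : (0 : ℝ) < (B : ℝ) ^ blockScale (k + 1) := by positivity
    have hL' : 0 < ((B : ℝ) ^ blockScale (k + 1))⁻¹ := by positivity
    rw [hm]
    refine lt_of_lt_of_le (by linarith : 2 * (((B : ℝ) ^ blockScale (k + 1))⁻¹ / 3) <
      ((B : ℝ) ^ blockScale (k + 1))⁻¹) ?_
    -- The parameters are read off from coordinates: `u` from the first abscissa, `v` from the
    -- second ordinate, and for equal `v` the number `z` from the first ordinate. No use is made of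
    -- the perturbed abscissa.
    by_cases hu : u = u'
    · by_cases hv : v = v'
      · have hz : z ≠ z' := fun h => hne (by rw [hu, hv, h])
        refine le_trans ?_ (abs_snd_sub_le_dist_unitPair _ _ _ _ _ _)
        subst hv
        convert! inv_le_abs_div_sub_div hz
          (c := 2 * (B : ℝ)⁻¹ ^ (k + 1) + ((v / B ^ fineLength (k + 1) * B ^ fineLength (k + 1) : ℕ) : ℝ)
            * (B : ℝ)⁻¹ ^ blockScale (k + 1)) hL using 3 <;>
        · rw [Nat.cast_add, inv_pow]
          ring
      · refine le_trans ?_ (abs_height_sub_le_dist_unitPair _ _ _ _ _ _)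
        have hdm : ∀ v : ℕ, ((v / B ^ fineLength (k + 1) * B ^ fineLength (k + 1) : ℕ) : ℝ) +
            ((v % B ^ fineLength (k + 1) : ℕ) : ℝ) = v := fun v => by
          exact_mod_cast Nat.div_add_mod' v (B ^ fineLength (k + 1))
        convert! inv_le_abs_div_sub_div hv
          (c := 2 * (B : ℝ)⁻¹ ^ (k + 1) + 2 * (B : ℝ) ^ fineLength (k + 1) *
            (B : ℝ)⁻¹ ^ blockScale (k + 1)) hL using 3
        · rw [Nat.cast_add, blockHeight, div_eq_mul_inv, ← inv_pow]
          linear_combination (B : ℝ)⁻¹ ^ blockScale (k + 1) * hdm v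
        · rw [Nat.cast_add, blockHeight, div_eq_mul_inv, ← inv_pow]
          linear_combination (B : ℝ)⁻¹ ^ blockScale (k + 1) * hdm v'
    · refine le_trans ?_ (abs_fst_sub_le_dist_unitPair _ _ _ _ _ _)
      simpa [div_eq_mul_inv, inv_pow] using inv_le_abs_div_sub_div hu (c := 0) hL
  · intro τ hτ
    have hlim : Tendsto (fun k : ℕ => (3 * s₁ + 2 * s₂) * ((k : ℝ) + 1) ^ 2 -
        τ * ((blockScale (k + 1) : ℕ) : ℝ)) atTop atTop := by
      have h1 : Tendsto (fun k : ℕ => ((k : ℝ) + 1) *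
          ((3 * s₁ + 2 * s₂ - 2 * τ) * ((k : ℝ) + 1) + -(2 * τ))) atTop atTop :=
        hk1.atTop_mul_atTop₀
          (tendsto_atTop_add_const_right _ _ (hk1.const_mul_atTop (by linarith)))
      refine h1.congr fun k => ?_
      rw [hscale]
      ring
    filter_upwards [eventually_rpow_neg_le hB1 _ _ hlim] with k hk
    refine hk.trans ?_
    set n := (k + 1) ^ 2 with hn
    have c1 := pow_le_card_block hB0 h₂B h₁B (k + 1)
    have c2 := pow_le_card_block hB0 h₁B h₂B (k + 1)
    have c3 : D₁ ^ fineLength (k + 1) ≤ (digitSet B (fun _ => D₁) (fineLength (k + 1))).card := by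
      simpa using prod_le_card_digitSet (B := B) (E := fun _ => D₁) hB0 (fun _ => h₁B)
        (fineLength (k + 1))
    have hfine : n ≤ fineLength (k + 1) := by rw [fineLength]; omega
    have c4 : (D₂ ^ n * D₁ ^ n) * ((D₁ ^ n * D₂ ^ n) * D₁ ^ n) ≤
        (digitSet B (fun i => if i < fineLength (k + 1) then D₂ else D₁) (blockLength (k + 1)) ×ˢ
        digitSet B (fun i => if i < fineLength (k + 1) then D₁ else D₂) (blockLength (k + 1)) ×ˢ
        digitSet B (fun _ => D₁) (fineLength (k + 1))).card := by
      rw [Finset.card_product, Finset.card_product]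
      have d1 := Nat.pow_le_pow_right h₁ hfine
      have d2 := Nat.pow_le_pow_right h₂ hfine
      exact Nat.mul_le_mul ((Nat.mul_le_mul_right _ d2).trans c1)
        (Nat.mul_le_mul ((Nat.mul_le_mul_right _ d1).trans c2) (d1.trans c3))
    have r1 : ((B : ℝ) ^ s₁) ^ n ≤ (D₁ : ℝ) ^ n := pow_le_pow_left₀ (by positivity) hs₁ n
    have r2 : ((B : ℝ) ^ s₂) ^ n ≤ (D₂ : ℝ) ^ n := pow_le_pow_left₀ (by positivity) hs₂ n
    have hncast : ((k : ℝ) + 1) ^ 2 = (n : ℝ) := by rw [hn]; push_cast; ring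
    calc (B : ℝ) ^ ((3 * s₁ + 2 * s₂) * ((k : ℝ) + 1) ^ 2)
        = (((B : ℝ) ^ s₂) ^ n * ((B : ℝ) ^ s₁) ^ n) * ((((B : ℝ) ^ s₁) ^ n * ((B : ℝ) ^ s₂) ^ n) *
          ((B : ℝ) ^ s₁) ^ n) := by
          rw [hncast]
          simp only [← Real.rpow_natCast, ← Real.rpow_mul hB0'.le, ← Real.rpow_add hB0']
          congr 1
          ring
      _ ≤ ((D₂ : ℝ) ^ n * (D₁ : ℝ) ^ n) * (((D₁ : ℝ) ^ n * (D₂ : ℝ) ^ n) * (D₁ : ℝ) ^ n) := by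
          gcongr
      _ ≤ _ := by exact_mod_cast c4

end BlockPairs

/-! ### The lower bounds `3α/2` and `α + 1/2` -/

theorem three_mul_div_two_le_unitDistanceDim {α : ℝ} (hα : 0 < α) (hα1 : α ≤ 1) :
    ((3 * α / 2 : ℝ) : EReal) ≤ unitDistanceDim 2 α := by
  refine EReal.ge_of_forall_gt_iff_ge.1 fun τ hτ => ?_
  replace hτ : τ < 3 * α / 2 := by exact_mod_cast hτ
  obtain ⟨B, D, hB, hD, hDB, hle, hs⟩ := exists_base_digit (a := α) (s := max 0 (2 * τ / 3))
    (le_max_left _ _) (max_lt hα (by linarith)) hα1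
  -- With `D₂ = 1` the whole dimension `α ≤ 1` goes to one direction at each scale: horizontal at
  -- coarse scales, vertical at fine ones.
  refine le_trans ?_ (block_le_unitDistanceDim (D₁ := D) (D₂ := 1) (s₂ := 0) hα (by linarith) hB hD
    le_rfl hDB (by omega) (by simpa using hle) hs (by simp))
  have := le_max_right 0 (2 * τ / 3)
  exact_mod_cast (by linarith : τ ≤ 3 * max 0 (2 * τ / 3) / 2 + 0)

theorem add_half_le_unitDistanceDim {α : ℝ} (hα : 1 ≤ α) (hα2 : α ≤ 2) :
    ((α + 1 / 2 : ℝ) : EReal) ≤ unitDistanceDim 2 α := by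
  -- Here `D₁ = B` is full and the remaining `α - 1` goes to `D₂`. At `α = 1` there is no exponent
  -- `s` with `0 ≤ s < α - 1`, and the bound is the previous one.
  rcases hα.eq_or_lt with rfl | hα1
  · convert! three_mul_div_two_le_unitDistanceDim one_pos le_rfl using 2
    norm_num
  refine EReal.ge_of_forall_gt_iff_ge.1 fun τ hτ => ?_
  replace hτ : τ < α + 1 / 2 := by exact_mod_cast hτ
  obtain ⟨B, D, hB, hD, hDB, hle, hs⟩ := exists_base_digit (a := α - 1) (s := max 0 (τ - 3 / 2))
    (le_max_left _ _) (max_lt (by linarith) (by linarith)) (by linarith)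
  have hB0 : (0 : ℝ) < B := by exact_mod_cast (by omega : 0 < B)
  have hB1 : (1 : ℝ) ≤ B := by exact_mod_cast (by omega : 1 ≤ B)
  refine le_trans ?_ (block_le_unitDistanceDim (D₁ := B) (D₂ := D) (s₁ := 1) (by linarith) hα2 hB
    (by omega) hD le_rfl hDB ?_ (by simp) hs)
  · have := le_max_right 0 (τ - 3 / 2)
    exact_mod_cast (by linarith : τ ≤ 3 * 1 / 2 + max 0 (τ - 3 / 2))
  · have : (B : ℝ) ^ α = B * (B : ℝ) ^ (α - 1) := by
      rw [← Real.rpow_one_add' hB0.le (by linarith)]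
      congr 1
      ring
    rw [this]
    nlinarith

/-! ### Counting nearly unit distances by intersecting annuli -/

/-- In the coordinates along and across `u`, being near both circles fixes the dot product with `u`
at `t ^ 2 / 2` up to `5 * η`, and makes the cross product at least `t / √2` in absolute value. When
the two cross products have the same sign, their sum is at least `t`, and factoring the difference
of their squares bounds their difference by `11 * η`. Finally `10 ^ 2 + 11 ^ 2 ≤ 15 ^ 2`. -/
theorem planar_circle_intersection {x₀ x₁ y₀ y₁ u₀ u₁ η t : ℝ} (ht : 0 < t) (ht2 : t ≤ 1 / 2)
    (hη : 0 < η) (hηt : 100 * η ≤ t) (hu : u₀ ^ 2 + u₁ ^ 2 = t ^ 2)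
    (hx : |x₀ ^ 2 + x₁ ^ 2 - 1| ≤ 5 * η) (hx' : |(x₀ - u₀) ^ 2 + (x₁ - u₁) ^ 2 - 1| ≤ 5 * η)
    (hy : |y₀ ^ 2 + y₁ ^ 2 - 1| ≤ 5 * η) (hy' : |(y₀ - u₀) ^ 2 + (y₁ - u₁) ^ 2 - 1| ≤ 5 * η)
    (hs : 0 ≤ (x₁ * u₀ - x₀ * u₁) * (y₁ * u₀ - y₀ * u₁)) :
    ((x₀ - y₀) ^ 2 + (x₁ - y₁) ^ 2) * t ^ 2 ≤ (15 * η) ^ 2 := by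
  have key : ∀ {x₀ x₁ : ℝ}, |x₀ ^ 2 + x₁ ^ 2 - 1| ≤ 5 * η →
      |(x₀ - u₀) ^ 2 + (x₁ - u₁) ^ 2 - 1| ≤ 5 * η →
      |x₀ * u₀ + x₁ * u₁ - t ^ 2 / 2| ≤ 5 * η ∧
        t ^ 2 / 2 ≤ (x₁ * u₀ - x₀ * u₁) ^ 2 ∧
        (x₁ * u₀ - x₀ * u₁) ^ 2 = (x₀ ^ 2 + x₁ ^ 2) * t ^ 2 - (x₀ * u₀ + x₁ * u₁) ^ 2 := by
    intro x₀ x₁ h h'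
    rw [abs_le] at h h'
    have e' : (x₀ - u₀) ^ 2 + (x₁ - u₁) ^ 2 =
        x₀ ^ 2 + x₁ ^ 2 - 2 * (x₀ * u₀ + x₁ * u₁) + t ^ 2 := by rw [← hu]; ring
    rw [e'] at h'
    have h1 : |x₀ * u₀ + x₁ * u₁ - t ^ 2 / 2| ≤ 5 * η := by
      rw [abs_le]
      constructor <;> linarith
    have h2 : (x₁ * u₀ - x₀ * u₁) ^ 2 = (x₀ ^ 2 + x₁ ^ 2) * t ^ 2 - (x₀ * u₀ + x₁ * u₁) ^ 2 := by
      rw [← hu]; ring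
    refine ⟨h1, ?_, h2⟩
    rw [h2]
    have h3 : |x₀ * u₀ + x₁ * u₁| ≤ 3 / 10 * t := by
      have : t * t ≤ t * (1 / 2) := by gcongr
      rw [abs_le] at h1 ⊢
      constructor <;> linarith [sq t, sq_nonneg t]
    have h4 : (x₀ * u₀ + x₁ * u₁) ^ 2 ≤ (3 / 10 * t) ^ 2 := sq_le_sq' (abs_le.1 h3).1 (abs_le.1 h3).2
    have h5 : (3 / 4) * t ^ 2 ≤ (x₀ ^ 2 + x₁ ^ 2) * t ^ 2 := by
      have : 3 / 4 ≤ x₀ ^ 2 + x₁ ^ 2 := by linarith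
      gcongr
    have e : (3 / 10 * t) ^ 2 = 9 / 100 * t ^ 2 := by ring
    linarith [sq_nonneg t]
  obtain ⟨a1, a2, a3⟩ := key hx hx'
  obtain ⟨b1, b2, b3⟩ := key hy hy'
  set s := x₁ * u₀ - x₀ * u₁ with hsdef
  set s' := y₁ * u₀ - y₀ * u₁ with hsdef'
  set d := x₀ * u₀ + x₁ * u₁ with hd
  set d' := y₀ * u₀ + y₁ * u₁ with hd'
  have hsum : ((x₀ - y₀) ^ 2 + (x₁ - y₁) ^ 2) * t ^ 2 = (d - d') ^ 2 + (s - s') ^ 2 := by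
    rw [← hu, hd, hd', hsdef, hsdef']; ring
  rw [abs_le] at a1 b1 hx hy
  have hdd : |d - d'| ≤ 10 * η := by rw [abs_le]; constructor <;> linarith
  have hdsq : (d - d') ^ 2 ≤ (10 * η) ^ 2 := sq_le_sq' (abs_le.1 hdd).1 (abs_le.1 hdd).2
  have hss : |s - s'| * |s + s'| ≤ 10 * η * t ^ 2 + 10 * η * (t ^ 2 + 10 * η) := by
    rw [← abs_mul]
    have e : (s - s') * (s + s') = ((x₀ ^ 2 + x₁ ^ 2) - (y₀ ^ 2 + y₁ ^ 2)) * t ^ 2 -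
        (d - d') * (d + d') := by linear_combination a3 - b3
    rw [e]
    refine (abs_sub _ _).trans ?_
    rw [abs_mul, abs_mul, abs_of_nonneg (sq_nonneg t)]
    have f1 : |x₀ ^ 2 + x₁ ^ 2 - (y₀ ^ 2 + y₁ ^ 2)| ≤ 10 * η := by
      rw [abs_le]; constructor <;> linarith
    have f2 : |d + d'| ≤ t ^ 2 + 10 * η := by
      rw [abs_le]; constructor <;> linarith [sq_nonneg t]
    gcongr
  have hst : t ≤ |s + s'| := by
    refine abs_le_of_sq_le_sq' ?_ (abs_nonneg _) |>.2
    rw [sq_abs]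
    have e : (s + s') ^ 2 = s ^ 2 + s' ^ 2 + 2 * (s * s') := by ring
    rw [e]
    linarith
  have hsd : |s - s'| ≤ 11 * η := by
    have h1 : |s - s'| * t ≤ 10 * η * t ^ 2 + 10 * η * (t ^ 2 + 10 * η) :=
      (mul_le_mul_of_nonneg_left hst (abs_nonneg _)).trans hss
    have h2 : 10 * η * t ^ 2 + 10 * η * (t ^ 2 + 10 * η) ≤ 11 * η * t := by
      have : η * (100 * η) ≤ η * t := by gcongr
      have : η * t * t ≤ η * t * (1 / 2) := by gcongr
      have e : 10 * η * t ^ 2 + 10 * η * (t ^ 2 + 10 * η) =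
          20 * (η * t * t) + η * (100 * η) := by ring
      rw [e]
      linarith
    exact le_of_mul_le_mul_right (h1.trans h2) ht
  have hssq : (s - s') ^ 2 ≤ (11 * η) ^ 2 := sq_le_sq' (abs_le.1 hsd).1 (abs_le.1 hsd).2
  rw [hsum]
  linarith [sq_nonneg η, mul_pow 10 η 2, mul_pow 11 η 2, mul_pow 15 η 2]

open scoped Classical in
/-- At most `C (r / η) ^ α` points of `P` lie in any ball of radius `r ≥ η`. -/
def HasGrowth (α C η : ℝ) (P : Finset Plane) : Prop :=
  ∀ (x : Plane) (r : ℝ), η ≤ r → ((P.filter fun p => dist p x < r).card : ℝ) ≤ C * (r / η) ^ α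

open scoped Classical in
/-- The pairs of points of `P` whose distance differs from `1` by at most `2 η`. -/
noncomputable def nearUnitPairs (η : ℝ) (P : Finset Plane) : Finset (Plane × Plane) :=
  (P ×ˢ P).filter fun z => |dist z.1 z.2 - 1| ≤ 2 * η

theorem exists_separated_net {K : Set Plane} (hK : IsCompact K) {η : ℝ} (hη : 0 < η) :
    ∃ P : Finset Plane, ↑P ⊆ K ∧ (P : Set Plane).Pairwise (fun p q => η < dist p q) ∧
      ∀ x ∈ K, ∃ p ∈ P, dist x p ≤ η := by
  set e : ℝ≥0 := η.toNNReal with he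
  have hec : (e : ℝ) = η := Real.coe_toNNReal _ hη.le
  have he0 : e ≠ 0 := (Real.toNNReal_pos.2 hη).ne'
  have hfin : Metric.packingNumber e K ≠ ⊤ := by
    obtain ⟨N, hNK, hN, hcov⟩ := Metric.exists_finite_isCover_of_isCompact
      (ε := e / 2) (div_ne_zero he0 two_ne_zero) hK
    have h1 := Metric.packingNumber_two_mul_le_externalCoveringNumber (e / 2) K
    rw [mul_div_cancel₀ e two_ne_zero] at h1
    exact ne_top_of_le_ne_top (Set.encard_ne_top_iff.2 hN)
      (h1.trans hcov.externalCoveringNumber_le_encard)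
  have hsf : (Metric.maximalSeparatedSet e K).Finite := by
    rw [← Set.encard_ne_top_iff, Metric.encard_maximalSeparatedSet hfin]
    exact hfin
  refine ⟨hsf.toFinset, by simpa using Metric.maximalSeparatedSet_subset, ?_, ?_⟩
  · rw [Set.Finite.coe_toFinset]
    intro p hp q hq hpq
    have h : (e : ℝ≥0∞) < edist p q := Metric.isSeparated_maximalSeparatedSet hp hq hpq
    rw [edist_dist, ← ENNReal.ofReal_coe_nnreal, hec] at h
    exact (ENNReal.ofReal_lt_ofReal_iff_of_nonneg hη.le).1 h
  · intro x hx
    obtain ⟨p, hp, hxp⟩ := Metric.isCover_maximalSeparatedSet hfin hx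
    refine ⟨p, by simpa using hp, ?_⟩
    have h : edist x p ≤ e := hxp
    rw [edist_dist, ← ENNReal.ofReal_coe_nnreal, hec] at h
    exact (ENNReal.ofReal_le_ofReal_iff hη.le).1 h

/-- Balls of radius `η / 2` about the separated points are disjoint and lie in the `η /
2`-neighbourhood of `K`; comparing areas at `δ = η / 2` and radius `2 * r` counts them. -/
theorem IsDiscreteAlphaSet.hasGrowth {α C : ℝ} {K : Set Plane} {P : Finset Plane} {η : ℝ}
    (hC : ∀ δ : ℝ, 0 < δ → ∀ (x : Plane) (r : ℝ), δ ≤ r →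
      volume (Metric.thickening δ K ∩ Metric.ball x r) ≤ ENNReal.ofReal (C * (r / δ) ^ α * δ ^ 2))
    (hη : 0 < η) (hPK : ↑P ⊆ K) (hsep : (P : Set Plane).Pairwise fun p q => η < dist p q) :
    HasGrowth α (|C| * 4 ^ α) η P := by
  classical
  intro x r hr
  have hr0 : 0 < r := hη.trans_le hr
  set F := P.filter fun p => dist p x < r
  have hvol := hC (η / 2) (by linarith) x (2 * r) (by linarith)
  have hsub : (⋃ p ∈ F, Metric.ball p (η / 2)) ⊆
      Metric.thickening (η / 2) K ∩ Metric.ball x (2 * r) := by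
    intro y hy
    simp only [Set.mem_iUnion] at hy
    obtain ⟨p, hp, hyp⟩ := hy
    obtain ⟨hpP, hpx⟩ := Finset.mem_filter.1 hp
    rw [Metric.mem_ball] at hyp
    refine ⟨Metric.mem_thickening_iff.2 ⟨p, hPK hpP, hyp⟩, ?_⟩
    rw [Metric.mem_ball]
    linarith [dist_triangle y p x]
  have hdisj : (F : Set Plane).PairwiseDisjoint fun p => Metric.ball p (η / 2) := by
    intro p hp q hq hpq
    refine Metric.ball_disjoint_ball ?_
    have : η < dist p q := hsep (Finset.mem_filter.1 hp).1 (Finset.mem_filter.1 hq).1 hpq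
    linarith
  have hcalc : ENNReal.ofReal (F.card * ((η / 2) ^ 2 * Real.pi)) ≤
      ENNReal.ofReal (|C| * (2 * r / (η / 2)) ^ α * (η / 2) ^ 2) := by
    calc ENNReal.ofReal (F.card * ((η / 2) ^ 2 * Real.pi))
        = ∑ p ∈ F, volume (Metric.ball p (η / 2)) := by
          simp only [EuclideanSpace.volume_ball_fin_two, Finset.sum_const, nsmul_eq_mul]
          rw [← ENNReal.ofReal_pow (by positivity), ← ENNReal.ofReal_mul (by positivity),
            ENNReal.ofReal_mul (Nat.cast_nonneg _), ENNReal.ofReal_natCast]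
      _ = volume (⋃ p ∈ F, Metric.ball p (η / 2)) :=
          (measure_biUnion_finset hdisj fun p _ => measurableSet_ball).symm
      _ ≤ _ := measure_mono hsub
      _ ≤ _ := hvol
      _ ≤ _ := by
          apply ENNReal.ofReal_le_ofReal
          gcongr
          exact le_abs_self C
  rw [ENNReal.ofReal_le_ofReal_iff (by positivity)] at hcalc
  have h1 : (F.card : ℝ) * Real.pi ≤ |C| * (2 * r / (η / 2)) ^ α := by
    have h2 : (0 : ℝ) < (η / 2) ^ 2 := by positivity
    refine le_of_mul_le_mul_right ?_ h2
    linarith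
  have h3 : (F.card : ℝ) ≤ F.card * Real.pi :=
    le_mul_of_one_le_right (Nat.cast_nonneg _) (by linarith [Real.two_le_pi])
  refine (h3.trans h1).trans (le_of_eq ?_)
  rw [mul_assoc, ← Real.mul_rpow (by norm_num) (by positivity)]
  congr 2
  field_simp
  norm_num

/-- Rounding both ends of a unit pair to the net changes the distance by at most `2 * η`. Centres
must lie in `unitDistancePairs K`, so each net pair that occurs is replaced by a genuine unit pair
rounding to it; two such are within `2 * η`. -/
theorem coveringNumber_unitDistancePairs_le {K : Set Plane} {P : Finset Plane} {η : ℝ}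
    (hη : 0 < η) (hP : ∀ x ∈ K, ∃ p ∈ P, dist x p ≤ η) {δ : ℝ≥0} (hδ : (δ : ℝ) = 4 * η) :
    Metric.coveringNumber δ (unitDistancePairs K) ≤ ((nearUnitPairs η P).card : ℕ∞) := by
  classical
  let rep : Plane × Plane → Set (Plane × Plane) := fun w =>
    {z | z ∈ unitDistancePairs K ∧ dist z.1 w.1 ≤ η ∧ dist z.2 w.2 ≤ η}
  let F : Finset (Plane × Plane) := (nearUnitPairs η P).filter fun w => (rep w).Nonempty
  let pick : Plane × Plane → Plane × Plane := fun w => if h : (rep w).Nonempty then h.some else 0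
  have hpick : ∀ w, (rep w).Nonempty → pick w ∈ rep w := fun w h => by
    simp only [pick, dif_pos h]
    exact h.some_mem
  have hcov : Metric.IsCover δ (unitDistancePairs K) ((F.image pick : Finset _) : Set _) := by
    rintro z hz
    obtain ⟨p, hp, hzp⟩ := hP z.1 hz.1
    obtain ⟨q, hq, hzq⟩ := hP z.2 hz.2.1
    have hne : (rep (p, q)).Nonempty := ⟨z, hz, hzp, hzq⟩
    have hmem : (p, q) ∈ F := by
      refine Finset.mem_filter.2 ⟨Finset.mem_filter.2 ⟨Finset.mem_product.2 ⟨hp, hq⟩, ?_⟩, hne⟩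
      have h1 : dist z.2 z.1 = 1 := by rw [dist_eq_norm]; exact hz.2.2
      rw [dist_comm] at h1
      rw [abs_le]
      constructor
      · linarith [dist_triangle4 z.1 p q z.2, dist_comm q z.2]
      · linarith [dist_triangle4 p z.1 z.2 q, dist_comm p z.1]
    refine ⟨pick (p, q), ?_, ?_⟩
    · rw [Finset.coe_image]
      exact ⟨_, hmem, rfl⟩
    · obtain ⟨-, h1, h2⟩ := hpick _ hne
      change edist z (pick (p, q)) ≤ δ
      rw [edist_dist, ← ENNReal.ofReal_coe_nnreal, hδ]
      refine ENNReal.ofReal_le_ofReal ?_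
      rw [Prod.dist_eq]
      refine max_le ?_ ?_
      · linarith [dist_triangle_right z.1 (pick (p, q)).1 p]
      · linarith [dist_triangle_right z.2 (pick (p, q)).2 q]
  refine (hcov.coveringNumber_le_encard ?_).trans ?_
  · rw [Finset.coe_image]
    rintro _ ⟨w, hw, rfl⟩
    exact (hpick w (Finset.mem_filter.1 hw).2).1
  · rw [Set.encard_coe_eq_coe_finsetCard]
    exact_mod_cast Finset.card_image_le.trans (Finset.card_filter_le _ _)

/-- A dyadic bound for the number of nearly unit distances in sets of `α`-growth bounds the upper
Minkowski dimension of the set of unit distance pairs. -/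
theorem upperMinkowskiDim_unitDistancePairs_le {α t : ℝ} (ht : 0 ≤ t) {K : Set Plane}
    (hK : IsCompact K) (hd : IsDiscreteAlphaSet α K)
    (h : ∀ C R : ℝ, 0 ≤ C → 1 ≤ R → ∃ C' : ℝ, ∀ (J : ℕ) (P : Finset Plane),
      HasGrowth α C ((2 : ℝ)⁻¹ ^ J / 4) P → (∀ p ∈ P, ‖p‖ < R) →
      ((nearUnitPairs ((2 : ℝ)⁻¹ ^ J / 4) P).card : ℝ) ≤ C' * (J + 1) * 2 ^ (t * J)) :
    upperMinkowskiDim (unitDistancePairs K) ≤ (t : EReal) := by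
  obtain ⟨C, hC⟩ := hd
  obtain ⟨R, hR⟩ := hK.isBounded.subset_ball 0
  obtain ⟨C', hC'⟩ := h (|C| * 4 ^ α) (max R 1) (by positivity) (le_max_right _ _)
  refine upperMinkowskiDim_le (C := C') ht fun J => ?_
  have hη : (0 : ℝ) < (2 : ℝ)⁻¹ ^ J / 4 := by positivity
  obtain ⟨P, hPK, hsep, hnet⟩ := exists_separated_net hK hη
  have h1 := coveringNumber_unitDistancePairs_le hη hnet (δ := (2 : ℝ≥0)⁻¹ ^ J)
    (by push_cast; ring)
  have h2 := hC' J P (IsDiscreteAlphaSet.hasGrowth hC hη hPK hsep) fun p hp => by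
    have := hR (hPK hp)
    rw [mem_ball_zero_iff] at this
    exact this.trans_le (le_max_left _ _)
  calc (Metric.coveringNumber ((2 : ℝ≥0)⁻¹ ^ J) (unitDistancePairs K) : ℝ≥0∞)
      ≤ (((nearUnitPairs ((2 : ℝ)⁻¹ ^ J / 4) P).card : ℕ∞) : ℝ≥0∞) := by exact_mod_cast h1
    _ = ENNReal.ofReal ((nearUnitPairs ((2 : ℝ)⁻¹ ^ J / 4) P).card : ℝ) := by simp
    _ ≤ _ := ENNReal.ofReal_le_ofReal h2

theorem Plane.dist_sq (x y : Plane) : dist x y ^ 2 = (x 0 - y 0) ^ 2 + (x 1 - y 1) ^ 2 := by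
  rw [EuclideanSpace.dist_sq_eq, Fin.sum_univ_two, Real.dist_eq, Real.dist_eq, sq_abs, sq_abs]

theorem Finset.sum_biUnion_le_of_nonneg {ι β : Type*} [DecidableEq β] (I : Finset ι)
    (t : ι → Finset β) {f : β → ℝ} (hf : ∀ b, 0 ≤ f b) :
    ∑ b ∈ I.biUnion t, f b ≤ ∑ i ∈ I, ∑ b ∈ t i, f b := by
  classical
  induction I using Finset.induction_on with
  | empty => simp
  | insert i I hi ih =>
    rw [Finset.biUnion_insert, Finset.sum_insert hi]
    have h1 := Finset.sum_union_inter (s₁ := t i) (s₂ := I.biUnion t) (f := f)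
    have h2 : 0 ≤ ∑ b ∈ t i ∩ I.biUnion t, f b := Finset.sum_nonneg fun b _ => hf b
    linarith

theorem HasGrowth.card_le_of_subset {α C η ρ : ℝ} {P G : Finset Plane} (hP : HasGrowth α C η P)
    (hη : 0 < η) (hC : 0 ≤ C) (hρ : η ≤ ρ) (hG : G ⊆ P) (hd : ∀ p ∈ G, ∀ q ∈ G, dist p q < ρ) :
    (G.card : ℝ) ≤ C * (ρ / η) ^ α := by
  classical
  have hρ0 : 0 < ρ := hη.trans_le hρ
  rcases G.eq_empty_or_nonempty with rfl | ⟨q, hq⟩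
  · simp only [Finset.card_empty, Nat.cast_zero]
    positivity
  · refine le_trans ?_ (hP q ρ hρ)
    exact_mod_cast Finset.card_le_card fun p hp => Finset.mem_filter.2 ⟨hG hp, hd p hp q hq⟩

open scoped Classical in
-- The line through `q` and `q'` splits the common points into two groups, each of diameter at most
-- `15 * η / t` when `t ≥ 100 * η`. For smaller `t` the trivial bound `3` on the diameter is already
-- below `600 * η / t`.
theorem HasGrowth.codegree_le {α C η : ℝ} {P : Finset Plane} (hP : HasGrowth α C η P)
    (hη : 0 < η) (hη4 : η ≤ 1 / 4) (hC : 0 ≤ C) {q q' : Plane} (ht : 0 < dist q q')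
    (ht2 : dist q q' ≤ 1 / 2) :
    ((P.filter fun p => |dist p q - 1| ≤ 2 * η ∧ |dist p q' - 1| ≤ 2 * η).card : ℝ) ≤
      2 * (C * (600 / dist q q') ^ α) := by
  set t := dist q q' with htdef
  set F := P.filter fun p => |dist p q - 1| ≤ 2 * η ∧ |dist p q' - 1| ≤ 2 * η with hF
  let side : Plane → ℝ := fun p => (p 1 - q 1) * (q' 0 - q 0) - (p 0 - q 0) * (q' 1 - q 1)
  have hρ : 600 * η / t / η = 600 / t := by field_simp
  have hclose : ∀ p ∈ F, ∀ p' ∈ F, 0 ≤ side p * side p' → dist p p' < 600 * η / t := by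
    intro p hp p' hp' hs
    obtain ⟨-, h1, h2⟩ := Finset.mem_filter.1 hp
    obtain ⟨-, h1', h2'⟩ := Finset.mem_filter.1 hp'
    rw [lt_div_iff₀ ht]
    rcases le_or_gt (100 * η) t with hc | hc
    · have hsq : ∀ {a b : Plane}, |dist a b - 1| ≤ 2 * η → |dist a b ^ 2 - 1| ≤ 5 * η := by
        intro a b hab
        have e : dist a b ^ 2 - 1 = (dist a b - 1) * (dist a b + 1) := by ring
        rw [e, abs_mul]
        have h3 : |dist a b + 1| ≤ 5 / 2 := by
          rw [abs_le] at hab ⊢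
          constructor <;> linarith
        calc |dist a b - 1| * |dist a b + 1| ≤ (2 * η) * (5 / 2) := by gcongr
          _ = 5 * η := by ring
      have a1 := hsq h1
      have a2 := hsq h2
      have b1 := hsq h1'
      have b2 := hsq h2'
      rw [Plane.dist_sq] at a1 a2 b1 b2
      have hu : (q' 0 - q 0) ^ 2 + (q' 1 - q 1) ^ 2 = t ^ 2 := by
        rw [htdef, dist_comm, Plane.dist_sq]
      have key := planar_circle_intersection (x₀ := p 0 - q 0) (x₁ := p 1 - q 1)
        (y₀ := p' 0 - q 0) (y₁ := p' 1 - q 1) ht ht2 hη hc hu a1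
        (by simpa only [sub_sub_sub_cancel_right] using a2) b1
        (by simpa only [sub_sub_sub_cancel_right] using b2) hs
      rw [sub_sub_sub_cancel_right, sub_sub_sub_cancel_right, ← Plane.dist_sq, ← mul_pow] at key
      have := abs_le_of_sq_le_sq' key (by positivity)
      linarith [this.2]
    · have : dist p p' ≤ 3 := by
        rw [abs_le] at h1 h1'
        linarith [dist_triangle_right p p' q]
      nlinarith
  have hρη : η ≤ 600 * η / t := by
    rw [le_div_iff₀ ht]
    nlinarith
  have hsplit : F.card = (F.filter fun p => 0 ≤ side p).card +
      (F.filter fun p => ¬ 0 ≤ side p).card := (Finset.card_filter_add_card_filter_not _).symm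
  have hFP : F ⊆ P := Finset.filter_subset _ _
  have c1 := hP.card_le_of_subset hη hC hρη (G := F.filter fun p => 0 ≤ side p)
    ((Finset.filter_subset _ _).trans hFP) fun p hp p' hp' =>
      hclose p (Finset.mem_filter.1 hp).1 p' (Finset.mem_filter.1 hp').1
        (mul_nonneg (Finset.mem_filter.1 hp).2 (Finset.mem_filter.1 hp').2)
  have c2 := hP.card_le_of_subset hη hC hρη (G := F.filter fun p => ¬ 0 ≤ side p)
    ((Finset.filter_subset _ _).trans hFP) fun p hp p' hp' =>
      hclose p (Finset.mem_filter.1 hp).1 p' (Finset.mem_filter.1 hp').1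
        (mul_nonneg_of_nonpos_of_nonpos (not_le.1 (Finset.mem_filter.1 hp).2).le
          (not_le.1 (Finset.mem_filter.1 hp').2).le)
  rw [hρ] at c1 c2
  rw [hsplit]
  push_cast
  linarith

open scoped Classical in
/-- The sum of the codegrees of a point with the points at distance less than `1 / 2`. -/
theorem HasGrowth.sum_codegree_le {α C R : ℝ} {J : ℕ} {P Q : Finset Plane} (hα : 0 ≤ α)
    (hP : HasGrowth α C ((2 : ℝ)⁻¹ ^ J / 4) P) (hC : 0 ≤ C) (hR : 1200 ≤ R)
    (hPR : ∀ p ∈ P, ‖p‖ < R) (hQP : Q ⊆ P) (q : Plane) (hQ : ∀ q' ∈ Q, dist q q' < 1 / 2) :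
    ∑ q' ∈ Q, ((P.filter fun p => |dist p q - 1| ≤ 2 * ((2 : ℝ)⁻¹ ^ J / 4) ∧
      |dist p q' - 1| ≤ 2 * ((2 : ℝ)⁻¹ ^ J / 4)).card : ℝ) ≤
      (J + 2) * (2 * C ^ 2 * (R / ((2 : ℝ)⁻¹ ^ J / 4)) ^ α) := by
  set η : ℝ := (2 : ℝ)⁻¹ ^ J / 4 with hηdef
  have hη : 0 < η := by positivity
  have hη4 : η ≤ 1 / 4 := by
    have : (2 : ℝ)⁻¹ ^ J ≤ 1 := pow_le_one₀ (by norm_num) (by norm_num)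
    linarith
  let cod : Plane → ℝ := fun q' =>
    ((P.filter fun p => |dist p q - 1| ≤ 2 * η ∧ |dist p q' - 1| ≤ 2 * η).card : ℝ)
  -- Shell `i` holds the points at distance about `2 ^ i * η` from `q`; shell `0` has no lower
  -- bound, as it contains `q` itself. Since `2 ^ (J + 2) * η = 1` and distances are below `1/2`,
  -- the indices up to `J + 1` suffice.
  let shell : ℕ → Finset Plane := fun i =>
    Q.filter fun q' => dist q' q < 2 ^ i * η ∧ (i ≠ 0 → 2 ^ i * η ≤ 2 * dist q' q)
  have hcover : Q ⊆ (Finset.range (J + 2)).biUnion shell := by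
    intro q' hq'
    have hex : ∃ i : ℕ, dist q' q < 2 ^ i * η := by
      obtain ⟨i, hi⟩ := pow_unbounded_of_one_lt (dist q' q / η) (one_lt_two : (1 : ℝ) < 2)
      exact ⟨i, by rwa [div_lt_iff₀ hη] at hi⟩
    rw [Finset.mem_biUnion]
    have hmin : Nat.find hex ≠ 0 → 2 ^ Nat.find hex * η ≤ 2 * dist q' q := by
      intro h0
      obtain ⟨i, hi⟩ := Nat.exists_eq_succ_of_ne_zero h0
      have := not_lt.1 (Nat.find_min hex (m := i) (by omega))
      rw [hi, pow_succ]
      linarith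
    refine ⟨Nat.find hex, ?_, Finset.mem_filter.2 ⟨hq', Nat.find_spec hex, hmin⟩⟩
    rw [Finset.mem_range]
    by_contra hlt
    have h1 := hmin (by omega)
    have h2 := hQ q' hq'
    have h3 : (2 : ℝ) ^ (J + 2) ≤ 2 ^ Nat.find hex := pow_le_pow_right₀ one_le_two (by omega)
    have h4 : (2 : ℝ) ^ (J + 2) * η = 1 := by
      rw [hηdef, pow_add, inv_pow]
      field_simp
      norm_num
    rw [dist_comm] at h2
    nlinarith
  -- In shell `0` the codegree is bounded by the size of `P`. In the others `dist q q' ≥ 2 ^ i * η /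
  -- 2`, so `600 / dist q q'` is absorbed by `R ≥ 1200`.
  have hcod : ∀ i, ∀ q' ∈ shell i, cod q' ≤ 2 * (C * (R / (2 ^ i * η)) ^ α) := by
    intro i q' hq'
    obtain ⟨hq'Q, h1, h2⟩ := Finset.mem_filter.1 hq'
    rcases Nat.eq_zero_or_pos i with rfl | hi
    · rw [pow_zero, one_mul]
      have h3 : cod q' ≤ C * (R / η) ^ α := by
        refine le_trans ?_ (hP 0 R (by linarith))
        simp only [cod]
        exact_mod_cast Finset.card_le_card fun p hp => Finset.mem_filter.2
          ⟨(Finset.mem_filter.1 hp).1, by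
            rw [dist_zero_right]; exact hPR p (Finset.mem_filter.1 hp).1⟩
      have : 0 ≤ C * (R / η) ^ α := by positivity
      linarith
    · have h3 := h2 hi.ne'
      have hpos : 0 < 2 ^ i * η := by positivity
      have ht : 0 < dist q q' := by rw [dist_comm]; linarith
      refine (hP.codegree_le hη hη4 hC ht (hQ q' hq'Q).le).trans ?_
      have h4 : 600 / dist q q' ≤ R / (2 ^ i * η) := by
        rw [div_le_div_iff₀ ht hpos]
        rw [dist_comm] at h3
        nlinarith
      gcongr
  have hshell : ∀ i, ((shell i).card : ℝ) ≤ C * (2 ^ i) ^ α := by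
    intro i
    have h1 := hP q (2 ^ i * η) (le_mul_of_one_le_left hη.le (one_le_pow₀ one_le_two))
    rw [mul_div_cancel_right₀ _ hη.ne'] at h1
    refine le_trans ?_ h1
    refine Nat.cast_le.2 (Finset.card_le_card fun p hp => ?_)
    obtain ⟨hpQ, hpd, -⟩ := Finset.mem_filter.1 hp
    exact Finset.mem_filter.2 ⟨hQP hpQ, hpd⟩
  calc ∑ q' ∈ Q, cod q' ≤ ∑ q' ∈ (Finset.range (J + 2)).biUnion shell, cod q' :=
        Finset.sum_le_sum_of_subset_of_nonneg hcover fun _ _ _ => Nat.cast_nonneg _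
    _ ≤ ∑ i ∈ Finset.range (J + 2), ∑ q' ∈ shell i, cod q' :=
        Finset.sum_biUnion_le_of_nonneg _ _ fun _ => Nat.cast_nonneg _
    _ ≤ ∑ i ∈ Finset.range (J + 2), (2 * C ^ 2 * (R / η) ^ α) := by
        refine Finset.sum_le_sum fun i _ => ?_
        calc ∑ q' ∈ shell i, cod q' ≤ ∑ q' ∈ shell i, 2 * (C * (R / (2 ^ i * η)) ^ α) :=
              Finset.sum_le_sum (hcod i)
          _ = (shell i).card * (2 * (C * (R / (2 ^ i * η)) ^ α)) := by
              rw [Finset.sum_const, nsmul_eq_mul]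
          _ ≤ (C * (2 ^ i) ^ α) * (2 * (C * (R / (2 ^ i * η)) ^ α)) := by
              gcongr
              exact hshell i
          -- The growth of the shell and the decay of the codegree cancel, so each shell contributes
          -- the same amount.
          _ = 2 * C ^ 2 * ((2 ^ i) ^ α * (R / (2 ^ i * η)) ^ α) := by ring
          _ = _ := by
              rw [← Real.mul_rpow (by positivity) (by positivity)]
              congr 2
              field_simp
    _ = _ := by
        rw [Finset.sum_const, Finset.card_range, nsmul_eq_mul]
        push_cast
        ring

open scoped Classical in
-- Cauchy–Schwarz over `p ∈ P` turns the number of pairs into the sum of the codegrees over `Q × Q`.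
-- The diameter of `Q` is kept below `1/2` because annuli with distant centres may be tangent.
theorem HasGrowth.sq_card_pairs_le {α C R : ℝ} {J : ℕ} {P Q : Finset Plane} (hα : 0 ≤ α)
    (hP : HasGrowth α C ((2 : ℝ)⁻¹ ^ J / 4) P) (hC : 0 ≤ C) (hR : 1200 ≤ R)
    (hPR : ∀ p ∈ P, ‖p‖ < R) (hQP : Q ⊆ P) (hQ : ∀ q ∈ Q, ∀ q' ∈ Q, dist q q' < 1 / 2) :
    (((P ×ˢ Q).filter fun z => |dist z.1 z.2 - 1| ≤ 2 * ((2 : ℝ)⁻¹ ^ J / 4)).card : ℝ) ^ 2 ≤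
      2 * C ^ 4 * (J + 2) * ((R / ((2 : ℝ)⁻¹ ^ J / 4)) ^ α) ^ 3 := by
  set η : ℝ := (2 : ℝ)⁻¹ ^ J / 4 with hηdef
  have hη : 0 < η := by positivity
  have hη4 : η ≤ 1 / 4 := by
    have : (2 : ℝ)⁻¹ ^ J ≤ 1 := pow_le_one₀ (by norm_num) (by norm_num)
    linarith
  set Λ : ℝ := (R / η) ^ α with hΛ
  have hΛ0 : 0 ≤ Λ := by positivity
  let ind : Plane → Plane → ℝ := fun p q => if |dist p q - 1| ≤ 2 * η then 1 else 0
  have hcard : (((P ×ˢ Q).filter fun z => |dist z.1 z.2 - 1| ≤ 2 * η).card : ℝ) =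
      ∑ p ∈ P, ∑ q ∈ Q, ind p q := by
    rw [Finset.card_filter, Finset.sum_product]
    push_cast
    rfl
  have hN : (P.card : ℝ) ≤ C * Λ := by
    refine le_trans ?_ (hP 0 R (by linarith))
    refine Nat.cast_le.2 (Finset.card_le_card fun p hp => Finset.mem_filter.2 ⟨hp, ?_⟩)
    rw [dist_zero_right]
    exact hPR p hp
  have hQN : (Q.card : ℝ) ≤ C * Λ := le_trans (by exact_mod_cast Finset.card_le_card hQP) hN
  have hsq : ∑ p ∈ P, (∑ q ∈ Q, ind p q) ^ 2 = ∑ q ∈ Q, ∑ q' ∈ Q,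
      ((P.filter fun p => |dist p q - 1| ≤ 2 * η ∧ |dist p q' - 1| ≤ 2 * η).card : ℝ) := by
    simp_rw [sq, Finset.sum_mul_sum]
    rw [Finset.sum_comm]
    refine Finset.sum_congr rfl fun q _ => ?_
    rw [Finset.sum_comm]
    refine Finset.sum_congr rfl fun q' _ => ?_
    rw [Finset.card_filter]
    push_cast
    refine Finset.sum_congr rfl fun p _ => ?_
    simp only [ind]
    by_cases h1 : |dist p q - 1| ≤ 2 * η <;> by_cases h2 : |dist p q' - 1| ≤ 2 * η <;>
      simp [h1, h2]
  rw [hcard]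
  calc (∑ p ∈ P, ∑ q ∈ Q, ind p q) ^ 2 ≤ P.card * ∑ p ∈ P, (∑ q ∈ Q, ind p q) ^ 2 :=
        sq_sum_le_card_mul_sum_sq
    _ ≤ P.card * ∑ q ∈ Q, ((J + 2) * (2 * C ^ 2 * Λ)) := by
        rw [hsq]
        gcongr with q hq
        exact hP.sum_codegree_le hα hC hR hPR hQP q (hQ q hq)
    _ = P.card * (Q.card * ((J + 2) * (2 * C ^ 2 * Λ))) := by rw [Finset.sum_const, nsmul_eq_mul]
    _ ≤ (C * Λ) * ((C * Λ) * ((J + 2) * (2 * C ^ 2 * Λ))) := by gcongr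
    _ = _ := by ring

/-- Sets of `α`-growth have `≲ 2 ^ (3 α J / 2)` nearly unit distances at scale `2 ^ (-J)`. -/
theorem exists_card_nearUnitPairs_le_three_halves {α C R : ℝ} (hα : 0 ≤ α) (hC : 0 ≤ C)
    (hR : 1 ≤ R) : ∃ C' : ℝ, ∀ (J : ℕ) (P : Finset Plane),
      HasGrowth α C ((2 : ℝ)⁻¹ ^ J / 4) P → (∀ p ∈ P, ‖p‖ < R) →
      ((nearUnitPairs ((2 : ℝ)⁻¹ ^ J / 4) P).card : ℝ) ≤ C' * (J + 1) * 2 ^ (3 * α / 2 * J) := by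
  classical
  set R' : ℝ := max R 1200 with hR'
  have hR0 : 1200 ≤ R' := le_max_right _ _
  set m : ℤ := ⌈4 * R'⌉ with hm
  set cells : Finset (ℤ × ℤ) := Finset.Icc (-m) m ×ˢ Finset.Icc (-m) m with hcells
  refine ⟨cells.card * (2 * C ^ 2 * (4 * R') ^ (3 * α / 2)), fun J P hP hPR => ?_⟩
  replace hPR : ∀ p ∈ P, ‖p‖ < R' := fun p hp => (hPR p hp).trans_le (le_max_left _ _)
  set η : ℝ := (2 : ℝ)⁻¹ ^ J / 4 with hηdef
  -- Cells of side `1/4` have diameter below `1/2`, and boundedly many of them cover the ball of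
  -- radius `R'`.
  let cell : Plane → ℤ × ℤ := fun p => (⌊4 * p 0⌋, ⌊4 * p 1⌋)
  have hcell : ∀ p ∈ P, cell p ∈ cells := by
    intro p hp
    have hk : ∀ k, ⌊4 * p k⌋ ∈ Finset.Icc (-m) m := by
      intro k
      have h1 : |p k| ≤ ‖p‖ := PiLp.norm_apply_le p k
      have h2 := hPR p hp
      have h3 := Int.le_ceil (4 * R')
      rw [abs_le] at h1
      rw [Finset.mem_Icc]
      refine ⟨Int.le_floor.2 ?_, Int.floor_le_iff.2 ?_⟩
      · push_cast; linarith
      · rw [hm]; linarith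
    exact Finset.mem_product.2 ⟨hk 0, hk 1⟩
  have hsum : (nearUnitPairs η P).card =
      ∑ c ∈ cells, ((nearUnitPairs η P).filter fun z => cell z.2 = c).card :=
    Finset.card_eq_sum_card_fiberwise fun z hz =>
      hcell _ (Finset.mem_product.1 (Finset.mem_filter.1 hz).1).2
  rw [hsum]
  push_cast
  have hbound : ∀ c ∈ cells, (((nearUnitPairs η P).filter fun z => cell z.2 = c).card : ℝ) ≤
      2 * C ^ 2 * (4 * R') ^ (3 * α / 2) * (J + 1) * 2 ^ (3 * α / 2 * J) := by
    intro c _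
    have hfib : ((nearUnitPairs η P).filter fun z => cell z.2 = c) =
        (P ×ˢ P.filter fun q => cell q = c).filter fun z => |dist z.1 z.2 - 1| ≤ 2 * η := by
      ext z
      simp only [nearUnitPairs, Finset.mem_filter, Finset.mem_product]
      tauto
    rw [hfib]
    have h1 := hP.sq_card_pairs_le hα hC hR0 hPR (Q := P.filter fun q => cell q = c)
      (Finset.filter_subset _ _) (by
        intro q hq q' hq'
        have hqq : cell q = cell q' :=
          (Finset.mem_filter.1 hq).2.trans (Finset.mem_filter.1 hq').2.symm
        have hk : ∀ k, ⌊4 * q k⌋ = ⌊4 * q' k⌋ → |q k - q' k| < 1 / 4 := by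
          intro k hk
          have := Int.abs_sub_lt_one_of_floor_eq_floor hk
          rw [← mul_sub, abs_mul, abs_of_pos (by norm_num : (0 : ℝ) < 4)] at this
          linarith
        have h0 := hk 0 (congrArg Prod.fst hqq)
        have h1 := hk 1 (congrArg Prod.snd hqq)
        linarith [Plane.dist_le q q'])
    refine (abs_le_of_sq_le_sq' (h1.trans ?_) (by positivity)).2
    have e1 : R' / η = 4 * R' * 2 ^ J := by
      rw [hηdef, inv_pow]
      field_simp
    have e2 : ((R' / η) ^ α) ^ 3 = ((4 * R') ^ (3 * α / 2) * 2 ^ (3 * α / 2 * J)) ^ 2 := by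
      rw [e1, Real.mul_rpow (by positivity) (by positivity), mul_pow, mul_pow]
      congr 1
      · rw [← Real.rpow_natCast, ← Real.rpow_natCast, ← Real.rpow_mul (by positivity),
          ← Real.rpow_mul (by positivity)]
        congr 1
        push_cast
        ring
      · simp only [← Real.rpow_natCast]
        rw [← Real.rpow_mul (by positivity), ← Real.rpow_mul (by positivity),
          ← Real.rpow_mul (by positivity)]
        congr 1
        push_cast
        ring
    rw [e2]
    have hJ : (0 : ℝ) ≤ J := Nat.cast_nonneg J
    -- The factor `2 * (J + 2)` is enlarged to the square of `2 * (J + 1)` so that the square root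
    -- can be taken.
    have h3 : 2 * ((J : ℝ) + 2) ≤ 4 * (J + 1) ^ 2 := by nlinarith
    calc 2 * C ^ 4 * ((J : ℝ) + 2) * ((4 * R') ^ (3 * α / 2) * 2 ^ (3 * α / 2 * (J : ℝ))) ^ 2
        = (2 * ((J : ℝ) + 2)) * (C ^ 4 * ((4 * R') ^ (3 * α / 2) * 2 ^ (3 * α / 2 * (J : ℝ))) ^ 2) := by
          ring
      _ ≤ (4 * (J + 1) ^ 2) * (C ^ 4 * ((4 * R') ^ (3 * α / 2) * 2 ^ (3 * α / 2 * (J : ℝ))) ^ 2) := by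
          gcongr
      _ = _ := by ring
  calc _ ≤ ∑ c ∈ cells, 2 * C ^ 2 * (4 * R') ^ (3 * α / 2) * (J + 1) * 2 ^ (3 * α / 2 * (J : ℝ)) :=
        Finset.sum_le_sum hbound
    _ = _ := by
        rw [Finset.sum_const, nsmul_eq_mul]
        ring

/-! ### Decay of the Fourier transform of arc length -/

theorem norm_exp_I_mul_cos (r θ : ℝ) : ‖Complex.exp (Complex.I * (r * Real.cos θ : ℝ))‖ = 1 := by
  rw [mul_comm]
  exact Complex.norm_exp_ofReal_mul_I _

theorem hasDerivAt_exp_I_mul_cos (r θ : ℝ) :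
    HasDerivAt (fun θ : ℝ => Complex.exp (Complex.I * (r * Real.cos θ : ℝ)))
      (Complex.exp (Complex.I * (r * Real.cos θ : ℝ)) * (Complex.I * (r * -Real.sin θ : ℝ))) θ := by
  have h1 : HasDerivAt (fun θ : ℝ => ((r * Real.cos θ : ℝ) : ℂ)) ((r * -Real.sin θ : ℝ) : ℂ) θ :=
    ((Real.hasDerivAt_cos θ).const_mul r).ofReal_comp
  exact (h1.const_mul Complex.I).cexp

/-- Away from the stationary point `0` the phase `r cos θ` has monotone derivative `-r sin θ`.
Integration by parts against `1 / (r sin θ)` leaves boundary terms and the variation of this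
function, all controlled by its value at `ε`. -/
theorem norm_integral_exp_cos_away_le {r ε : ℝ} (hr : r ≠ 0) (hε : 0 < ε) (hε2 : ε ≤ Real.pi / 2) :
    ‖∫ θ in ε..(Real.pi / 2), Complex.exp (Complex.I * (r * Real.cos θ : ℝ))‖ ≤
      2 / (|r| * Real.sin ε) := by
  have hpi := Real.pi_pos
  have hsin : ∀ θ ∈ Set.uIcc ε (Real.pi / 2), 0 < Real.sin θ := by
    intro θ hθ
    rw [Set.uIcc_of_le hε2] at hθ
    exact Real.sin_pos_of_pos_of_lt_pi (hε.trans_le hθ.1) (by linarith [hθ.2])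
  have hcos : ∀ θ ∈ Set.uIcc ε (Real.pi / 2), 0 ≤ Real.cos θ := by
    intro θ hθ
    rw [Set.uIcc_of_le hε2] at hθ
    exact Real.cos_nonneg_of_neg_pi_div_two_le_of_le (by linarith [hθ.1]) hθ.2
  have hinv : ∀ θ ∈ Set.uIcc ε (Real.pi / 2),
      HasDerivAt (fun θ => -(Real.sin θ)⁻¹) (Real.cos θ / Real.sin θ ^ 2) θ := by
    intro θ hθ
    convert! ((Real.hasDerivAt_sin θ).inv (hsin θ hθ).ne').neg using 1
    ring
  have hcont : ContinuousOn (fun θ => Real.cos θ / Real.sin θ ^ 2) (Set.uIcc ε (Real.pi / 2)) :=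
    Real.continuous_cos.continuousOn.div (Real.continuous_sin.continuousOn.pow 2)
      fun θ hθ => pow_ne_zero 2 (hsin θ hθ).ne'
  have hI : (∫ θ in ε..(Real.pi / 2), Real.cos θ / Real.sin θ ^ 2) = (Real.sin ε)⁻¹ - 1 := by
    rw [intervalIntegral.integral_eq_sub_of_hasDerivAt hinv hcont.intervalIntegrable]
    simp
    ring
  let u : ℝ → ℂ := fun θ => (Complex.I / r) * ((-(Real.sin θ)⁻¹ : ℝ) : ℂ)
  let u' : ℝ → ℂ := fun θ => (Complex.I / r) * ((Real.cos θ / Real.sin θ ^ 2 : ℝ) : ℂ)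
  let v : ℝ → ℂ := fun θ => Complex.exp (Complex.I * (r * Real.cos θ : ℝ))
  let v' : ℝ → ℂ := fun θ =>
    Complex.exp (Complex.I * (r * Real.cos θ : ℝ)) * (Complex.I * (r * -Real.sin θ : ℝ))
  have hu : ∀ θ ∈ Set.uIcc ε (Real.pi / 2), HasDerivAt u (u' θ) θ := fun θ hθ =>
    ((hinv θ hθ).ofReal_comp).const_mul _
  have hv : ∀ θ ∈ Set.uIcc ε (Real.pi / 2), HasDerivAt v (v' θ) θ := fun θ _ =>
    hasDerivAt_exp_I_mul_cos r θ
  have hu'c : ContinuousOn u' (Set.uIcc ε (Real.pi / 2)) :=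
    continuousOn_const.mul (Complex.continuous_ofReal.comp_continuousOn hcont)
  have hv'c : Continuous v' := by
    simp only [v']
    fun_prop
  have hparts := intervalIntegral.integral_mul_deriv_eq_deriv_mul hu hv hu'c.intervalIntegrable
    (hv'c.intervalIntegrable _ _)
  have hr' : (r : ℂ) ≠ 0 := by exact_mod_cast hr
  have heq : (∫ θ in ε..(Real.pi / 2), u θ * v' θ) =
      -∫ θ in ε..(Real.pi / 2), Complex.exp (Complex.I * (r * Real.cos θ : ℝ)) := by
    rw [← intervalIntegral.integral_neg]
    refine intervalIntegral.integral_congr fun θ hθ => ?_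
    have hs : ((Real.sin θ : ℝ) : ℂ) ≠ 0 := by exact_mod_cast (hsin θ hθ).ne'
    simp only [u, v']
    push_cast
    have hs' : Complex.sin (θ : ℂ) ≠ 0 := by rwa [← Complex.ofReal_sin]
    field_simp
    rw [Complex.I_sq]
  have hnu : ∀ θ ∈ Set.uIcc ε (Real.pi / 2), ‖u θ‖ = |r|⁻¹ * (Real.sin θ)⁻¹ := by
    intro θ hθ
    simp only [u, norm_mul, norm_div, Complex.norm_I, Complex.norm_real, Real.norm_eq_abs, abs_neg,
      abs_inv, abs_of_pos (hsin θ hθ), one_div]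
  have hbd : ‖∫ θ in ε..(Real.pi / 2), u' θ * v θ‖ ≤ |r|⁻¹ * ((Real.sin ε)⁻¹ - 1) := by
    rw [← hI, ← intervalIntegral.integral_const_mul]
    refine intervalIntegral.norm_integral_le_of_norm_le hε2 ?_ ?_
    · refine Eventually.of_forall fun θ hθ => ?_
      have hθ' : θ ∈ Set.uIcc ε (Real.pi / 2) := by
        rw [Set.uIcc_of_le hε2]
        exact ⟨hθ.1.le, hθ.2⟩
      simp only [u', v, norm_mul, norm_exp_I_mul_cos, norm_div, Complex.norm_I, Complex.norm_real,
        Real.norm_eq_abs, mul_one, one_div]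
      rw [abs_of_nonneg (hcos θ hθ'), abs_of_nonneg (sq_nonneg (Real.sin θ))]
    · exact (hcont.intervalIntegrable).const_mul _
  rw [← norm_neg, ← heq, hparts]
  have hle := Set.left_mem_uIcc (a := ε) (b := Real.pi / 2)
  have hri := Set.right_mem_uIcc (a := ε) (b := Real.pi / 2)
  have n1 : ‖u (Real.pi / 2) * v (Real.pi / 2)‖ = |r|⁻¹ := by
    rw [norm_mul, hnu _ hri, norm_exp_I_mul_cos]
    simp
  have n2 : ‖u ε * v ε‖ = |r|⁻¹ * (Real.sin ε)⁻¹ := by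
    rw [norm_mul, hnu _ hle, norm_exp_I_mul_cos, mul_one]
  calc _ ≤ ‖u (Real.pi / 2) * v (Real.pi / 2)‖ + ‖u ε * v ε‖ +
        ‖∫ θ in ε..(Real.pi / 2), u' θ * v θ‖ :=
        (norm_sub_le _ _).trans (by gcongr; exact norm_sub_le _ _)
    _ ≤ |r|⁻¹ + |r|⁻¹ * (Real.sin ε)⁻¹ + |r|⁻¹ * ((Real.sin ε)⁻¹ - 1) := by
        rw [n1, n2]; gcongr
    _ = 2 / (|r| * Real.sin ε) := by
        rw [div_eq_mul_inv, mul_inv]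
        ring

theorem continuous_exp_I_mul_cos (r : ℝ) :
    Continuous fun θ : ℝ => Complex.exp (Complex.I * (r * Real.cos θ : ℝ)) := by
  fun_prop

theorem norm_integral_exp_cos_le (r a b : ℝ) :
    ‖∫ θ in a..b, Complex.exp (Complex.I * (r * Real.cos θ : ℝ))‖ ≤ |b - a| := by
  rw [← one_mul |b - a|]
  exact intervalIntegral.norm_integral_le_of_norm_le_const fun θ _ => (norm_exp_I_mul_cos r θ).le

/-- The split at `ε = |r| ^ (-1/2)` balances the trivial bound `ε` near the stationary point with `2
/ (|r| sin ε) ≤ 4 / √|r|` beyond it. For `|r| < 1` the length of the interval suffices. -/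
theorem norm_integral_exp_cos_quarter_le {r : ℝ} (hr : r ≠ 0) :
    ‖∫ θ in (0 : ℝ)..(Real.pi / 2), Complex.exp (Complex.I * (r * Real.cos θ : ℝ))‖ ≤
      5 / √|r| := by
  have hpi := Real.pi_pos
  have hpi4 := Real.pi_lt_four
  have hpi3 := Real.pi_gt_three
  have hr0 : 0 < |r| := abs_pos.2 hr
  have hs0 : 0 < √|r| := Real.sqrt_pos.2 hr0
  rcases le_or_gt 1 |r| with h1 | h1
  · set ε : ℝ := 1 / √|r| with hε
    have hε0 : 0 < ε := by positivity
    have hε1 : ε ≤ 1 := by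
      rw [hε, div_le_one hs0]
      exact Real.one_le_sqrt.2 h1
    have hε2 : ε ≤ Real.pi / 2 := by linarith
    have hsin : ε / 2 ≤ Real.sin ε := by
      refine le_trans ?_ (Real.mul_le_sin hε0.le hε2)
      rw [div_mul_eq_mul_div, div_le_div_iff₀ two_pos hpi]
      nlinarith
    rw [← intervalIntegral.integral_add_adjacent_intervals
      ((continuous_exp_I_mul_cos r).intervalIntegrable 0 ε)
      ((continuous_exp_I_mul_cos r).intervalIntegrable ε (Real.pi / 2))]
    have a1 := norm_integral_exp_cos_le r 0 ε
    rw [sub_zero, abs_of_pos hε0] at a1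
    have a2 := norm_integral_exp_cos_away_le hr hε0 hε2
    have a3 : 2 / (|r| * Real.sin ε) ≤ 4 / √|r| := by
      have hrs : |r| = √|r| * √|r| := (Real.mul_self_sqrt hr0.le).symm
      have : √|r| / 2 ≤ |r| * Real.sin ε := by
        calc √|r| / 2 = |r| * (ε / 2) := by
              rw [hε]
              nth_rewrite 2 [hrs]
              field_simp
          _ ≤ _ := by gcongr
      calc 2 / (|r| * Real.sin ε) ≤ 2 / (√|r| / 2) := by gcongr
        _ = 4 / √|r| := by
          field_simp
          norm_num
    calc _ ≤ ε + 4 / √|r| := (norm_add_le _ _).trans (add_le_add a1 (a2.trans a3))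
      _ = 5 / √|r| := by rw [hε]; ring
  · have h2 : √|r| ≤ 1 := Real.sqrt_le_one.2 h1.le
    refine (norm_integral_exp_cos_le r 0 (Real.pi / 2)).trans ?_
    rw [sub_zero, abs_of_pos (by positivity), le_div_iff₀ hs0]
    nlinarith

/-- Reflections reduce the circle to quarter periods with a single stationary point at an endpoint;
the price is the sign of `r`. -/
theorem integral_exp_cos_eq (r : ℝ) :
    ∫ θ in (0 : ℝ)..(2 * Real.pi), Complex.exp (Complex.I * (r * Real.cos θ : ℝ)) =
      2 * ((∫ θ in (0 : ℝ)..(Real.pi / 2), Complex.exp (Complex.I * (r * Real.cos θ : ℝ))) +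
        ∫ θ in (0 : ℝ)..(Real.pi / 2), Complex.exp (Complex.I * (-r * Real.cos θ : ℝ))) := by
  have hcont := fun a b => (continuous_exp_I_mul_cos r).intervalIntegrable (μ := volume) a b
  have h1 : ∫ θ in Real.pi..(2 * Real.pi), Complex.exp (Complex.I * (r * Real.cos θ : ℝ)) =
      ∫ θ in (0 : ℝ)..Real.pi, Complex.exp (Complex.I * (r * Real.cos θ : ℝ)) := by
    have := intervalIntegral.integral_comp_sub_left (a := 0) (b := Real.pi)
      (fun θ : ℝ => Complex.exp (Complex.I * (r * Real.cos θ : ℝ))) (2 * Real.pi)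
    rw [sub_zero, show 2 * Real.pi - Real.pi = Real.pi by ring] at this
    rw [← this]
    simp only [Real.cos_two_pi_sub]
  have h2 : ∫ θ in (Real.pi / 2)..Real.pi, Complex.exp (Complex.I * (r * Real.cos θ : ℝ)) =
      ∫ θ in (0 : ℝ)..(Real.pi / 2), Complex.exp (Complex.I * (-r * Real.cos θ : ℝ)) := by
    have := intervalIntegral.integral_comp_sub_left (a := 0) (b := Real.pi / 2)
      (fun θ : ℝ => Complex.exp (Complex.I * (r * Real.cos θ : ℝ))) Real.pi
    rw [sub_zero, show Real.pi - Real.pi / 2 = Real.pi / 2 by ring] at this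
    rw [← this]
    simp only [Real.cos_pi_sub, mul_neg, neg_mul]
  rw [← intervalIntegral.integral_add_adjacent_intervals (hcont 0 Real.pi) (hcont _ _), h1,
    ← intervalIntegral.integral_add_adjacent_intervals (hcont 0 (Real.pi / 2)) (hcont _ _), h2]
  ring

theorem norm_integral_exp_cos_full_le {r : ℝ} (hr : r ≠ 0) :
    ‖∫ θ in (0 : ℝ)..(2 * Real.pi), Complex.exp (Complex.I * (r * Real.cos θ : ℝ))‖ ≤
      20 / √|r| := by
  rw [integral_exp_cos_eq, norm_mul]
  have h1 := norm_integral_exp_cos_quarter_le hr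
  have h2 := norm_integral_exp_cos_quarter_le (neg_ne_zero.2 hr)
  rw [abs_neg] at h2
  calc _ ≤ 2 * (5 / √|r| + 5 / √|r|) := by
        rw [Complex.norm_ofNat]
        gcongr
        exact (norm_add_le _ _).trans (add_le_add h1 h2)
    _ = _ := by ring

/-- The point of the unit circle with argument `θ`. -/
noncomputable def circlePoint (θ : ℝ) : Plane := !₂[Real.cos θ, Real.sin θ]

theorem continuous_circlePoint : Continuous circlePoint := by
  unfold circlePoint
  fun_prop

theorem Plane.exists_eq_norm_smul_circlePoint (x : Plane) : ∃ φ, x = ‖x‖ • circlePoint φ := by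
  have hn : ‖(⟨x 0, x 1⟩ : ℂ)‖ = ‖x‖ := by
    rw [Complex.norm_eq_sqrt_sq_add_sq, EuclideanSpace.norm_eq, Fin.sum_univ_two, Real.norm_eq_abs,
      Real.norm_eq_abs, sq_abs, sq_abs]
  refine ⟨Complex.arg ⟨x 0, x 1⟩, ?_⟩
  ext i
  fin_cases i
  · simpa [circlePoint, hn] using (Complex.norm_mul_cos_arg ⟨x 0, x 1⟩).symm
  · simpa [circlePoint, hn] using (Complex.norm_mul_sin_arg ⟨x 0, x 1⟩).symm

theorem inner_circlePoint (θ φ : ℝ) :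
    inner ℝ (circlePoint θ) (circlePoint φ) = Real.cos (θ - φ) := by
  simp [circlePoint, PiLp.inner_apply, Fin.sum_univ_two, Real.cos_sub]
  ring

theorem circlePoint_add_two_pi (θ : ℝ) : circlePoint (θ + 2 * Real.pi) = circlePoint θ := by
  simp [circlePoint]

/-- The Fourier transform of arc length on the unit circle. -/
noncomputable def circleTransform (ξ : Plane) : ℂ :=
  ∫ θ in (0 : ℝ)..(2 * Real.pi),
    Complex.exp (Complex.I * (-(2 * Real.pi) * inner ℝ (circlePoint θ) ξ : ℝ))

theorem circleTransform_eq (ξ : Plane) : circleTransform ξ =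
    ∫ θ in (0 : ℝ)..(2 * Real.pi),
      Complex.exp (Complex.I * (-(2 * Real.pi * ‖ξ‖) * Real.cos θ : ℝ)) := by
  obtain ⟨φ, hφ⟩ := ξ.exists_eq_norm_smul_circlePoint
  let f : ℝ → ℂ := fun θ => Complex.exp (Complex.I * (-(2 * Real.pi * ‖ξ‖) * Real.cos θ : ℝ))
  have hf : Function.Periodic f (2 * Real.pi) := fun θ => by simp only [f, Real.cos_add_two_pi]
  have h1 : circleTransform ξ = ∫ θ in (0 : ℝ)..(2 * Real.pi), f (θ - φ) := by
    unfold circleTransform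
    refine intervalIntegral.integral_congr fun θ _ => ?_
    have : inner ℝ (circlePoint θ) ξ = ‖ξ‖ * Real.cos (θ - φ) := by
      conv_lhs => rw [hφ]
      rw [inner_smul_right, inner_circlePoint]
    simp only [f, this]
    congr 3
    ring
  rw [h1, intervalIntegral.integral_comp_sub_right f φ,
    show 2 * Real.pi - φ = (0 - φ) + 2 * Real.pi by ring, hf.intervalIntegral_add_eq (0 - φ) 0,
    zero_add]

theorem norm_circleTransform_le (ξ : Plane) : ‖circleTransform ξ‖ ≤ 2 * Real.pi := by
  rw [circleTransform_eq]
  refine (norm_integral_exp_cos_le _ _ _).trans ?_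
  rw [sub_zero, abs_of_pos Real.two_pi_pos]

theorem norm_circleTransform_le_div_sqrt {ξ : Plane} (hξ : ξ ≠ 0) :
    ‖circleTransform ξ‖ ≤ 20 / √‖ξ‖ := by
  have h0 : 0 < ‖ξ‖ := norm_pos_iff.2 hξ
  rw [circleTransform_eq]
  refine (norm_integral_exp_cos_full_le (neg_ne_zero.2 (by positivity))).trans ?_
  rw [abs_neg, abs_of_pos (by positivity)]
  gcongr
  nlinarith [Real.pi_gt_three]

/-! ### Gaussian smoothing and exponential sums -/

theorem norm_exp_I_mul (t : ℝ) : ‖Complex.exp (Complex.I * (t : ℝ))‖ = 1 := by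
  rw [mul_comm]
  exact Complex.norm_exp_ofReal_mul_I t

theorem integrable_gaussian_mul_exp_inner {b : ℝ} (hb : 0 < b) (x : Plane) :
    Integrable fun ξ : Plane => ((Real.exp (-(Real.pi * b * ‖ξ‖ ^ 2)) : ℝ) : ℂ) *
      Complex.exp (Complex.I * (2 * Real.pi * inner ℝ x ξ : ℝ)) := by
  have := GaussianFourier.integrable_cexp_neg_mul_sq_norm_add (V := Plane)
    (b := ((Real.pi * b : ℝ) : ℂ)) (by rw [Complex.ofReal_re]; positivity)
    (2 * Real.pi * Complex.I) x
  refine this.congr (Eventually.of_forall fun ξ => ?_)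
  simp only
  rw [Complex.ofReal_exp, ← Complex.exp_add]
  congr 1
  push_cast
  ring

theorem integral_gaussian_mul_exp_inner {b : ℝ} (hb : 0 < b) (x : Plane) :
    ∫ ξ : Plane, ((Real.exp (-(Real.pi * b * ‖ξ‖ ^ 2)) : ℝ) : ℂ) *
      Complex.exp (Complex.I * (2 * Real.pi * inner ℝ x ξ : ℝ)) =
      ((b⁻¹ * Real.exp (-(Real.pi * b⁻¹ * ‖x‖ ^ 2)) : ℝ) : ℂ) := by
  have hpi := Real.pi_pos
  have := GaussianFourier.integral_cexp_neg_mul_sq_norm_add (V := Plane)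
    (b := ((Real.pi * b : ℝ) : ℂ)) (by rw [Complex.ofReal_re]; positivity)
    (2 * Real.pi * Complex.I) x
  have hpi' : (Real.pi : ℂ) ≠ 0 := by exact_mod_cast hpi.ne'
  have hb' : (b : ℂ) ≠ 0 := by exact_mod_cast hb.ne'
  -- In dimension two the power in the Gaussian integral is `1`, which gives the plain factor `b⁻¹`.
  have e : ((Module.finrank ℝ Plane : ℂ) / 2) = 1 := by
    rw [finrank_euclideanSpace_fin]
    norm_num
  rw [e, Complex.cpow_one] at this
  convert! this using 1
  · congr 1
    ext ξ
    rw [Complex.ofReal_exp, ← Complex.exp_add]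
    congr 1
    push_cast
    ring
  · push_cast
    congr 1
    · field_simp
    · congr 1
      field_simp
      rw [Complex.I_sq]
      ring

theorem integrable_gaussian {b : ℝ} (hb : 0 < b) :
    Integrable fun ξ : Plane => Real.exp (-(Real.pi * b * ‖ξ‖ ^ 2)) := by
  have := (integrable_gaussian_mul_exp_inner hb 0).norm
  refine this.congr (Eventually.of_forall fun ξ => ?_)
  simp only [norm_mul, norm_exp_I_mul, mul_one, Complex.norm_real, Real.norm_eq_abs, Real.abs_exp]

theorem continuous_circleTransform : Continuous circleTransform := by
  have := continuous_circlePoint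
  unfold circleTransform
  refine intervalIntegral.continuous_parametric_intervalIntegral_of_continuous' ?_ _ _
  simp only [Function.uncurry_def]
  fun_prop

/-- By Fubini, a Gaussian cutoff in frequency amounts to convolving arc length with a Gaussian of
width `√b`, here evaluated at `x`. -/
theorem integral_gaussian_mul_circleTransform {b : ℝ} (hb : 0 < b) (x : Plane) :
    ∫ ξ : Plane, ((Real.exp (-(Real.pi * b * ‖ξ‖ ^ 2)) : ℝ) : ℂ) *
      Complex.exp (Complex.I * (2 * Real.pi * inner ℝ x ξ : ℝ)) * circleTransform ξ =
      ((∫ θ in (0 : ℝ)..(2 * Real.pi),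
        b⁻¹ * Real.exp (-(Real.pi * b⁻¹ * ‖x - circlePoint θ‖ ^ 2)) : ℝ) : ℂ) := by
  have hc := continuous_circlePoint
  rw [← intervalIntegral.integral_ofReal]
  simp_rw [← integral_gaussian_mul_exp_inner hb]
  rw [MeasureTheory.intervalIntegral_integral_swap]
  · refine integral_congr_ae (Eventually.of_forall fun ξ => ?_)
    simp only
    rw [circleTransform, ← intervalIntegral.integral_const_mul]
    refine intervalIntegral.integral_congr fun θ _ => ?_
    rw [mul_assoc, ← Complex.exp_add, inner_sub_left]
    congr 2
    push_cast
    ring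
  · have : IsFiniteMeasure (volume.restrict (Set.uIoc 0 (2 * Real.pi))) := by
      rw [Set.uIoc_of_le Real.two_pi_pos.le]
      infer_instance
    have h1 : Integrable (fun z : ℝ × Plane => Real.exp (-(Real.pi * b * ‖z.2‖ ^ 2)))
        ((volume.restrict (Set.uIoc 0 (2 * Real.pi))).prod volume) :=
      (integrable_gaussian hb).comp_snd _
    refine h1.mono' (Continuous.aestronglyMeasurable ?_) (Eventually.of_forall fun z => ?_)
    · simp only [Function.uncurry_def]
      fun_prop
    · simp only [Function.uncurry_def, norm_mul, norm_exp_I_mul, mul_one, Complex.norm_real,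
        Real.norm_eq_abs, Real.abs_exp]
      exact le_rfl

/-- The exponential sum over a finite set of frequencies. -/
noncomputable def expSum (P : Finset Plane) (ξ : Plane) : ℂ :=
  ∑ p ∈ P, Complex.exp (Complex.I * (2 * Real.pi * inner ℝ p ξ : ℝ))

theorem sq_norm_expSum (P : Finset Plane) (ξ : Plane) :
    ((‖expSum P ξ‖ ^ 2 : ℝ) : ℂ) = ∑ p ∈ P, ∑ q ∈ P,
      Complex.exp (Complex.I * (2 * Real.pi * inner ℝ (p - q) ξ : ℝ)) := by
  push_cast
  rw [← Complex.mul_conj', expSum, map_sum, Finset.sum_mul_sum]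
  refine Finset.sum_congr rfl fun p _ => Finset.sum_congr rfl fun q _ => ?_
  rw [← Complex.exp_conj, ← Complex.exp_add, inner_sub_left]
  congr 1
  simp only [map_mul, Complex.conj_I, Complex.conj_ofReal]
  push_cast
  ring

theorem integrable_gaussian_mul_expSum {b : ℝ} (hb : 0 < b) (P : Finset Plane) :
    Integrable fun ξ : Plane => Real.exp (-(Real.pi * b * ‖ξ‖ ^ 2)) * ‖expSum P ξ‖ ^ 2 := by
  refine (integrable_gaussian hb).mul_bdd (c := (P.card : ℝ) ^ 2)
    (Continuous.aestronglyMeasurable ?_) (Eventually.of_forall fun ξ => ?_)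
  · unfold expSum
    fun_prop
  · rw [norm_pow, norm_norm]
    gcongr
    refine (norm_sum_le _ _).trans ?_
    simp only [norm_exp_I_mul, Finset.sum_const, nsmul_eq_mul, mul_one, le_refl]

theorem integral_gaussian_mul_expSum {b : ℝ} (hb : 0 < b) (P : Finset Plane) :
    ∫ ξ : Plane, Real.exp (-(Real.pi * b * ‖ξ‖ ^ 2)) * ‖expSum P ξ‖ ^ 2 =
      b⁻¹ * ∑ p ∈ P, ∑ q ∈ P, Real.exp (-(Real.pi * b⁻¹ * ‖p - q‖ ^ 2)) := by
  have h : ((∫ ξ : Plane, Real.exp (-(Real.pi * b * ‖ξ‖ ^ 2)) * ‖expSum P ξ‖ ^ 2 : ℝ) : ℂ) =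
      ((b⁻¹ * ∑ p ∈ P, ∑ q ∈ P, Real.exp (-(Real.pi * b⁻¹ * ‖p - q‖ ^ 2)) : ℝ) : ℂ) := by
    rw [← integral_complex_ofReal]
    simp_rw [Finset.mul_sum]
    rw [Complex.ofReal_sum]
    simp_rw [Complex.ofReal_sum, ← integral_gaussian_mul_exp_inner hb]
    simp_rw [← integral_finsetSum _ fun q _ => integrable_gaussian_mul_exp_inner hb _]
    rw [← integral_finsetSum _ fun p _ =>
      integrable_finsetSum _ fun q _ => integrable_gaussian_mul_exp_inner hb _]
    refine integral_congr_ae (Eventually.of_forall fun ξ => ?_)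
    simp only
    simp_rw [← Finset.mul_sum, ← sq_norm_expSum]
    push_cast
    rfl
  exact_mod_cast h

theorem integral_gaussian_mul_expSum_mul_circleTransform {b : ℝ} (hb : 0 < b) (P : Finset Plane) :
    ∫ ξ : Plane, ((Real.exp (-(Real.pi * b * ‖ξ‖ ^ 2)) * ‖expSum P ξ‖ ^ 2 : ℝ) : ℂ) *
      circleTransform ξ =
      ((∑ p ∈ P, ∑ q ∈ P, ∫ θ in (0 : ℝ)..(2 * Real.pi),
        b⁻¹ * Real.exp (-(Real.pi * b⁻¹ * ‖p - q - circlePoint θ‖ ^ 2)) : ℝ) : ℂ) := by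
  have hI : ∀ x : Plane, Integrable fun ξ : Plane =>
      ((Real.exp (-(Real.pi * b * ‖ξ‖ ^ 2)) : ℝ) : ℂ) *
      Complex.exp (Complex.I * (2 * Real.pi * inner ℝ x ξ : ℝ)) * circleTransform ξ := fun x =>
    (integrable_gaussian_mul_exp_inner hb x).mul_bdd (c := 2 * Real.pi)
      continuous_circleTransform.aestronglyMeasurable
      (Eventually.of_forall norm_circleTransform_le)
  rw [Complex.ofReal_sum]
  simp_rw [Complex.ofReal_sum, ← integral_gaussian_mul_circleTransform hb]
  simp_rw [← integral_finsetSum _ fun q _ => hI _]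
  rw [← integral_finsetSum _ fun p _ => integrable_finsetSum _ fun q _ => hI _]
  refine integral_congr_ae (Eventually.of_forall fun ξ => ?_)
  simp only
  simp_rw [← Finset.sum_mul, ← Finset.mul_sum, ← sq_norm_expSum]
  push_cast
  rfl

/-- The dominating function is a sum of Gaussians so that its integral against `|expSum P|²` is
again an explicit sum over pairs. If `2 ^ j` is the first power above `‖ξ‖` and `j ≤ J`, the `j`-th
Gaussian is at least `exp (-π)` and the decay is `20 * √2 * (√2)⁻¹ ^ j`; the constant `30` exceeds
both `20 * √2` and the trivial bound `2π`. -/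
theorem norm_circleTransform_mul_gaussian_le (J : ℕ) (ξ : Plane) :
    Real.exp (-(Real.pi * ((4 : ℝ) ^ J)⁻¹ * ‖ξ‖ ^ 2)) * ‖circleTransform ξ‖ ≤
      ∑ j ∈ Finset.range (J + 1), 30 * Real.exp Real.pi * (√2)⁻¹ ^ j *
        Real.exp (-(Real.pi * ((4 : ℝ) ^ j)⁻¹ * ‖ξ‖ ^ 2)) := by
  have hpi := Real.pi_pos
  have hpi4 := Real.pi_lt_four
  have hs2 : (0 : ℝ) < √2 := by positivity
  have hs3 : √2 ≤ 3 / 2 := by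
    rw [Real.sqrt_le_left (by norm_num)]
    norm_num
  have hE : 1 ≤ Real.exp Real.pi := Real.one_le_exp hpi.le
  have hG : ∀ j : ℕ, ‖ξ‖ < 2 ^ j →
      1 ≤ Real.exp Real.pi * Real.exp (-(Real.pi * ((4 : ℝ) ^ j)⁻¹ * ‖ξ‖ ^ 2)) := by
    intro j hj
    rw [← Real.exp_add, Real.one_le_exp_iff]
    have h1 : ((4 : ℝ) ^ j)⁻¹ * ‖ξ‖ ^ 2 ≤ 1 := by
      rw [inv_mul_le_iff₀ (by positivity), mul_one]
      calc ‖ξ‖ ^ 2 ≤ (2 ^ j) ^ 2 := by gcongr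
        _ = 4 ^ j := by rw [← pow_mul, mul_comm, pow_mul]; norm_num
    rw [mul_assoc]
    nlinarith
  have hdecay : ∀ n : ℕ, 2 ^ n ≤ ‖ξ‖ → ‖circleTransform ξ‖ ≤ 20 * (√2)⁻¹ ^ n := by
    intro n hn
    have h0 : 0 < ‖ξ‖ := lt_of_lt_of_le (by positivity) hn
    refine (norm_circleTransform_le_div_sqrt (norm_pos_iff.1 h0)).trans ?_
    rw [inv_pow, ← div_eq_mul_inv]
    gcongr
    apply Real.le_sqrt_of_sq_le
    rw [← pow_mul, mul_comm, pow_mul, Real.sq_sqrt zero_le_two]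
    exact hn
  have hle1 : Real.exp (-(Real.pi * ((4 : ℝ) ^ J)⁻¹ * ‖ξ‖ ^ 2)) ≤ 1 := by
    rw [Real.exp_le_one_iff, neg_nonpos]
    positivity
  have hterm : ∀ j ∈ Finset.range (J + 1), 30 * Real.exp Real.pi * (√2)⁻¹ ^ j *
      Real.exp (-(Real.pi * ((4 : ℝ) ^ j)⁻¹ * ‖ξ‖ ^ 2)) ≤ ∑ j ∈ Finset.range (J + 1),
        30 * Real.exp Real.pi * (√2)⁻¹ ^ j *
          Real.exp (-(Real.pi * ((4 : ℝ) ^ j)⁻¹ * ‖ξ‖ ^ 2)) := fun j hj =>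
    Finset.single_le_sum (f := fun j => 30 * Real.exp Real.pi * (√2)⁻¹ ^ j *
      Real.exp (-(Real.pi * ((4 : ℝ) ^ j)⁻¹ * ‖ξ‖ ^ 2))) (fun _ _ => by positivity) hj
  have hex : ∃ j : ℕ, ‖ξ‖ < 2 ^ j := pow_unbounded_of_one_lt _ one_lt_two
  rcases le_or_gt (Nat.find hex) J with hJ | hJ
  · refine le_trans ?_ (hterm (Nat.find hex) (Finset.mem_range.2 (by omega)))
    have hg := hG _ (Nat.find_spec hex)
    have hc : ‖circleTransform ξ‖ ≤ 30 * (√2)⁻¹ ^ Nat.find hex := by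
      rcases hn : Nat.find hex with _ | n
      · rw [pow_zero]
        linarith [norm_circleTransform_le ξ]
      · refine (hdecay n (not_lt.1 (Nat.find_min hex (by omega)))).trans ?_
        have h1 : (√2)⁻¹ ^ n = √2 * (√2)⁻¹ ^ (n + 1) := by
          rw [pow_succ]
          field_simp
        rw [h1]
        have : 0 ≤ (√2)⁻¹ ^ (n + 1) := by positivity
        nlinarith
    calc _ ≤ 1 * (30 * (√2)⁻¹ ^ Nat.find hex) := by gcongr
      _ ≤ (Real.exp Real.pi * Real.exp (-(Real.pi * ((4 : ℝ) ^ Nat.find hex)⁻¹ * ‖ξ‖ ^ 2))) *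
          (30 * (√2)⁻¹ ^ Nat.find hex) := by gcongr
      _ = _ := by ring
  -- Frequencies of size at least `2 ^ J` are handled by the Gaussian cutoff itself, which is the
  -- one in the last term.
  · refine le_trans ?_ (hterm J (Finset.mem_range.2 (by omega)))
    have h1 := hdecay J (not_lt.1 (Nat.find_min hex hJ))
    calc _ ≤ Real.exp (-(Real.pi * ((4 : ℝ) ^ J)⁻¹ * ‖ξ‖ ^ 2)) * (20 * (√2)⁻¹ ^ J) := by gcongr
      _ ≤ Real.exp (-(Real.pi * ((4 : ℝ) ^ J)⁻¹ * ‖ξ‖ ^ 2)) *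
          ((30 * Real.exp Real.pi) * (√2)⁻¹ ^ J) := by
          gcongr
          linarith
      _ = _ := by ring

/-- Smoothed count of unit distances, bounded by the smoothed energies at all coarser scales. -/
theorem sum_integral_circle_le (J : ℕ) (P : Finset Plane) :
    ∑ p ∈ P, ∑ q ∈ P, ∫ θ in (0 : ℝ)..(2 * Real.pi),
        4 ^ J * Real.exp (-(Real.pi * 4 ^ J * ‖p - q - circlePoint θ‖ ^ 2)) ≤
      ∑ j ∈ Finset.range (J + 1), 30 * Real.exp Real.pi * (√2)⁻¹ ^ j *
        (4 ^ j * ∑ p ∈ P, ∑ q ∈ P, Real.exp (-(Real.pi * 4 ^ j * ‖p - q‖ ^ 2))) := by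
  have hpos : ∀ j : ℕ, 0 < ((4 : ℝ) ^ j)⁻¹ := fun j => by positivity
  have h1 := integral_gaussian_mul_expSum_mul_circleTransform (hpos J) P
  have h2 : ∀ j, Integrable fun ξ : Plane => 30 * Real.exp Real.pi * (√2)⁻¹ ^ j *
      (Real.exp (-(Real.pi * ((4 : ℝ) ^ j)⁻¹ * ‖ξ‖ ^ 2)) * ‖expSum P ξ‖ ^ 2) := fun j =>
    (integrable_gaussian_mul_expSum (hpos j) P).const_mul _
  simp only [inv_inv] at h1
  calc _ ≤ ‖((∑ p ∈ P, ∑ q ∈ P, ∫ θ in (0 : ℝ)..(2 * Real.pi),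
        4 ^ J * Real.exp (-(Real.pi * 4 ^ J * ‖p - q - circlePoint θ‖ ^ 2)) : ℝ) : ℂ)‖ := by
        rw [Complex.norm_real]
        exact le_abs_self _
    _ ≤ ∫ ξ : Plane, ∑ j ∈ Finset.range (J + 1), 30 * Real.exp Real.pi * (√2)⁻¹ ^ j *
        (Real.exp (-(Real.pi * ((4 : ℝ) ^ j)⁻¹ * ‖ξ‖ ^ 2)) * ‖expSum P ξ‖ ^ 2) := by
        rw [← h1]
        refine norm_integral_le_of_norm_le (integrable_finsetSum _ fun j _ => h2 j)
          (Eventually.of_forall fun ξ => ?_)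
        rw [norm_mul, Complex.norm_real, Real.norm_of_nonneg (by positivity)]
        calc _ = (Real.exp (-(Real.pi * ((4 : ℝ) ^ J)⁻¹ * ‖ξ‖ ^ 2)) * ‖circleTransform ξ‖) *
              ‖expSum P ξ‖ ^ 2 := by ring
          _ ≤ _ := by
            refine (mul_le_mul_of_nonneg_right (norm_circleTransform_mul_gaussian_le J ξ)
              (sq_nonneg _)).trans (le_of_eq ?_)
            rw [Finset.sum_mul]
            simp only [mul_assoc]
    _ = _ := by
        rw [integral_finsetSum _ fun j _ => h2 j]
        refine Finset.sum_congr rfl fun j _ => ?_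
        rw [integral_const_mul, integral_gaussian_mul_expSum (hpos j)]
        simp only [inv_inv]

/-! ### From smoothed counts to pairs, and energy estimates -/

theorem norm_circlePoint (θ : ℝ) : ‖circlePoint θ‖ = 1 := by
  rw [EuclideanSpace.norm_eq, Fin.sum_univ_two]
  simp [circlePoint]

theorem dist_circlePoint_le (θ φ : ℝ) : dist (circlePoint θ) (circlePoint φ) ≤ 2 * |θ - φ| := by
  refine (Plane.dist_le _ _).trans ?_
  have h1 := Real.abs_cos_sub_cos_le θ φ
  have h2 := Real.abs_sin_sub_sin_le θ φ
  simp only [circlePoint, PiLp.toLp_apply, Matrix.cons_val_zero, Matrix.cons_val_one]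
  linarith

/-- With `s = 2 ^ (-J)`, the points of the circle at angle at most `s / 4` from the direction of `x`
are within `s / 2 + 2 * (s / 4) = s` of `x`. There the integrand is at least `4 ^ J * exp (-π)`, and
this arc has length `s / 2`. -/
theorem le_integral_circle {J : ℕ} {x : Plane} (hx : |‖x‖ - 1| ≤ (2 : ℝ)⁻¹ ^ J / 2) :
    2 ^ J * Real.exp (-Real.pi) / 2 ≤ ∫ θ in (0 : ℝ)..(2 * Real.pi),
      4 ^ J * Real.exp (-(Real.pi * 4 ^ J * ‖x - circlePoint θ‖ ^ 2)) := by
  have hpi := Real.pi_pos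
  have hpi3 := Real.pi_gt_three
  obtain ⟨φ, hφ⟩ := x.exists_eq_norm_smul_circlePoint
  set s : ℝ := (2 : ℝ)⁻¹ ^ J with hs
  have hs0 : 0 < s := by positivity
  have hs1 : s ≤ 1 := pow_le_one₀ (by norm_num) (by norm_num)
  have h4 : (4 : ℝ) ^ J * s ^ 2 = 1 := by
    rw [hs, ← pow_mul, mul_comm J 2, pow_mul, ← mul_pow]
    norm_num
  have h2 : (4 : ℝ) ^ J * s = 2 ^ J := by
    rw [hs, ← mul_pow]
    norm_num
  let f : ℝ → ℝ := fun θ => 4 ^ J * Real.exp (-(Real.pi * 4 ^ J * ‖x - circlePoint θ‖ ^ 2))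
  have hf : Function.Periodic f (2 * Real.pi) := fun θ => by
    simp only [f, circlePoint_add_two_pi]
  have hfc : Continuous f := by
    have := continuous_circlePoint
    fun_prop
  have hf0 : ∀ θ, 0 ≤ f θ := fun θ => by positivity
  have hlow : ∀ θ ∈ Set.Icc (φ - s / 4) (φ + s / 4), 4 ^ J * Real.exp (-Real.pi) ≤ f θ := by
    intro θ hθ
    have hd : ‖x - circlePoint θ‖ ≤ s := by
      have e1 : ‖x - circlePoint φ‖ = |‖x‖ - 1| := by
        conv_lhs => rw [hφ]
        rw [show ‖x‖ • circlePoint φ - circlePoint φ = (‖x‖ - 1) • circlePoint φ by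
          rw [sub_smul, one_smul], norm_smul, norm_circlePoint, mul_one, Real.norm_eq_abs]
      have e2 := dist_circlePoint_le φ θ
      have e3 : |φ - θ| ≤ s / 4 := by
        rw [abs_le]
        constructor <;> linarith [hθ.1, hθ.2]
      rw [dist_eq_norm] at e2
      calc ‖x - circlePoint θ‖ ≤ ‖x - circlePoint φ‖ + ‖circlePoint φ - circlePoint θ‖ :=
            norm_sub_le_norm_sub_add_norm_sub _ _ _
        _ ≤ s := by linarith
    simp only [f]
    gcongr
    calc Real.pi * 4 ^ J * ‖x - circlePoint θ‖ ^ 2 ≤ Real.pi * 4 ^ J * s ^ 2 := by gcongr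
      _ = Real.pi := by rw [mul_assoc, h4, mul_one]
  -- The period is recentred at the direction of `x` so that the arc lies inside the interval of
  -- integration.
  have hper : ∫ θ in (0 : ℝ)..(2 * Real.pi), f θ = ∫ θ in (φ - Real.pi)..(φ + Real.pi), f θ := by
    have := hf.intervalIntegral_add_eq 0 (φ - Real.pi)
    rw [zero_add, show φ - Real.pi + 2 * Real.pi = φ + Real.pi by ring] at this
    exact this
  calc 2 ^ J * Real.exp (-Real.pi) / 2
      = ∫ _ in (φ - s / 4)..(φ + s / 4), 4 ^ J * Real.exp (-Real.pi) := by
        rw [intervalIntegral.integral_const, smul_eq_mul, ← h2]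
        ring
    _ ≤ ∫ θ in (φ - s / 4)..(φ + s / 4), f θ :=
        intervalIntegral.integral_mono_on (by linarith) intervalIntegrable_const
          (hfc.intervalIntegrable _ _) hlow
    _ ≤ ∫ θ in (φ - Real.pi)..(φ + Real.pi), f θ :=
        intervalIntegral.integral_mono_interval (by linarith) (by linarith) (by linarith)
          (Eventually.of_forall hf0) (hfc.intervalIntegrable _ _)
    _ = _ := hper.symm

theorem card_nearUnitPairs_mul_le (J : ℕ) (P : Finset Plane) :
    ((nearUnitPairs ((2 : ℝ)⁻¹ ^ J / 4) P).card : ℝ) * (2 ^ J * Real.exp (-Real.pi) / 2) ≤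
      ∑ p ∈ P, ∑ q ∈ P, ∫ θ in (0 : ℝ)..(2 * Real.pi),
        4 ^ J * Real.exp (-(Real.pi * 4 ^ J * ‖p - q - circlePoint θ‖ ^ 2)) := by
  classical
  rw [← Finset.sum_product' P P fun p q => ∫ θ in (0 : ℝ)..(2 * Real.pi),
        (4 : ℝ) ^ J * Real.exp (-(Real.pi * 4 ^ J * ‖p - q - circlePoint θ‖ ^ 2)),
    ← nsmul_eq_mul, ← Finset.sum_const]
  calc _ ≤ ∑ z ∈ nearUnitPairs ((2 : ℝ)⁻¹ ^ J / 4) P, ∫ θ in (0 : ℝ)..(2 * Real.pi),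
        (4 : ℝ) ^ J * Real.exp (-(Real.pi * 4 ^ J * ‖z.1 - z.2 - circlePoint θ‖ ^ 2)) := by
        refine Finset.sum_le_sum fun z hz => le_integral_circle ?_
        have := (Finset.mem_filter.1 hz).2
        rw [dist_eq_norm] at this
        linarith
    _ ≤ _ := by
        refine Finset.sum_le_sum_of_subset_of_nonneg (Finset.filter_subset _ _) fun z _ _ => ?_
        exact intervalIntegral.integral_nonneg Real.two_pi_pos.le fun θ _ => by positivity

/-- The decay `16 ^ (-i)` is enough to beat the growth `(2 ^ i) ^ α ≤ 4 ^ i` of the dyadic rings,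
and it follows from the quadratic Taylor bound for the exponential. -/
theorem exp_neg_pi_mul_sq_le {i : ℕ} {t : ℝ} (ht : i ≠ 0 → 2 ^ i ≤ 2 * t) :
    Real.exp (-(Real.pi * t ^ 2)) ≤ 4 * (1 / 16) ^ i := by
  have hpi := Real.pi_pos
  have hpi3 := Real.pi_gt_three
  rcases Nat.eq_zero_or_pos i with rfl | hi
  · have : Real.exp (-(Real.pi * t ^ 2)) ≤ 1 := by
      rw [Real.exp_le_one_iff, neg_nonpos]
      positivity
    rw [pow_zero]
    linarith
  · have h1 := ht hi.ne'
    set y := Real.pi * t ^ 2 with hy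
    have h4 : (4 : ℝ) ^ i ≤ 4 * t ^ 2 := by
      calc (4 : ℝ) ^ i = (2 ^ i) ^ 2 := by rw [← pow_mul, mul_comm, pow_mul]; norm_num
        _ ≤ (2 * t) ^ 2 := by gcongr
        _ = 4 * t ^ 2 := by ring
    have hy1 : 3 / 4 * 4 ^ i ≤ y := by nlinarith [sq_nonneg t]
    have hy0 : 0 ≤ y := by positivity
    have h2 := Real.quadratic_le_exp_of_nonneg hy0
    have h16 : (16 : ℝ) ^ i = 4 ^ i * 4 ^ i := by rw [← mul_pow]; norm_num
    have h3 : (16 : ℝ) ^ i ≤ 4 * Real.exp y := by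
      have : (3 / 4 * 4 ^ i) * (3 / 4 * 4 ^ i) ≤ y * y :=
        mul_le_mul hy1 hy1 (by positivity) hy0
      rw [h16]
      nlinarith
    rw [Real.exp_neg, one_div, inv_pow, ← div_eq_mul_inv, inv_eq_one_div,
      div_le_div_iff₀ (Real.exp_pos _) (by positivity)]
    linarith

/-- Dyadic rings around `p` at distance `2 ^ i * ρ` contribute a geometric series of ratio `1/4`, so
the ball of radius `ρ` dominates. -/
theorem HasGrowth.sum_gaussian_le {α C η ρ : ℝ} {P : Finset Plane} (hP : HasGrowth α C η P)
    (hα2 : α ≤ 2) (hη : 0 < η) (hC : 0 ≤ C) (hρ : η ≤ ρ) (p : Plane) :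
    ∑ q ∈ P, Real.exp (-(Real.pi * (dist q p / ρ) ^ 2)) ≤ 8 * (C * (ρ / η) ^ α) := by
  classical
  have hρ0 : 0 < ρ := hη.trans_le hρ
  have hex : ∀ q : Plane, ∃ i : ℕ, dist q p < 2 ^ i * ρ := fun q => by
    obtain ⟨i, hi⟩ := pow_unbounded_of_one_lt (dist q p / ρ) (one_lt_two : (1 : ℝ) < 2)
    exact ⟨i, by rwa [div_lt_iff₀ hρ0] at hi⟩
  let idx : Plane → ℕ := fun q => Nat.find (hex q)
  have hmin : ∀ q, idx q ≠ 0 → 2 ^ idx q ≤ 2 * (dist q p / ρ) := by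
    intro q h0
    obtain ⟨i, hi⟩ := Nat.exists_eq_succ_of_ne_zero h0
    have := not_lt.1 (Nat.find_min (hex q) (m := i) (by simp only [idx] at hi; omega))
    rw [hi, pow_succ]
    have h2 := (le_div_iff₀ hρ0).2 this
    linarith
  have hfib : ∀ i, ∑ q ∈ P with idx q = i, Real.exp (-(Real.pi * (dist q p / ρ) ^ 2)) ≤
      4 * (C * (ρ / η) ^ α) * (1 / 4) ^ i := by
    intro i
    have h1 : ∀ q ∈ P.filter (fun q => idx q = i),
        Real.exp (-(Real.pi * (dist q p / ρ) ^ 2)) ≤ 4 * (1 / 16) ^ i := by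
      intro q hq
      obtain rfl := (Finset.mem_filter.1 hq).2
      exact exp_neg_pi_mul_sq_le (hmin q)
    have h2 : (((P.filter fun q => idx q = i).card : ℕ) : ℝ) ≤ C * (2 ^ i * ρ / η) ^ α := by
      refine le_trans ?_ (hP p (2 ^ i * ρ)
        (hρ.trans (le_mul_of_one_le_left hρ0.le (one_le_pow₀ one_le_two))))
      refine Nat.cast_le.2 (Finset.card_le_card fun q hq => ?_)
      obtain ⟨hqP, rfl⟩ := Finset.mem_filter.1 hq
      exact Finset.mem_filter.2 ⟨hqP, Nat.find_spec (hex q)⟩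
    have h3 : (2 ^ i * ρ / η) ^ α ≤ 4 ^ i * (ρ / η) ^ α := by
      rw [mul_div_assoc, Real.mul_rpow (by positivity) (by positivity)]
      gcongr
      calc ((2 : ℝ) ^ i) ^ α ≤ (2 ^ i) ^ (2 : ℝ) :=
            Real.rpow_le_rpow_of_exponent_le (one_le_pow₀ one_le_two) hα2
        _ = 4 ^ i := by
            rw [Real.rpow_two, ← pow_mul, mul_comm, pow_mul]
            norm_num
    calc _ ≤ ∑ q ∈ P with idx q = i, 4 * (1 / 16 : ℝ) ^ i := Finset.sum_le_sum h1
      _ = ((P.filter fun q => idx q = i).card : ℝ) * (4 * (1 / 16) ^ i) := by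
          rw [Finset.sum_const, nsmul_eq_mul]
      _ ≤ (C * (4 ^ i * (ρ / η) ^ α)) * (4 * (1 / 16) ^ i) := by
          gcongr
          exact h2.trans (by gcongr)
      _ = 4 * (C * (ρ / η) ^ α) * (4 ^ i * (1 / 16) ^ i) := by ring
      _ = _ := by
          rw [← mul_pow]
          norm_num
  have hgeom : ∑ i ∈ P.image idx, (1 / 4 : ℝ) ^ i ≤ 2 := by
    refine ((summable_geometric_of_lt_one (by norm_num) (by norm_num)).sum_le_tsum _
      fun _ _ => by positivity).trans ?_
    rw [tsum_geometric_of_lt_one (by norm_num) (by norm_num)]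
    norm_num
  rw [← Finset.sum_fiberwise_of_maps_to (g := idx) (t := P.image idx)
    fun q hq => Finset.mem_image_of_mem _ hq]
  calc _ ≤ ∑ i ∈ P.image idx, 4 * (C * (ρ / η) ^ α) * (1 / 4) ^ i :=
        Finset.sum_le_sum fun i _ => hfib i
    _ = 4 * (C * (ρ / η) ^ α) * ∑ i ∈ P.image idx, (1 / 4) ^ i := by rw [Finset.mul_sum]
    _ ≤ 4 * (C * (ρ / η) ^ α) * 2 := by gcongr
    _ = _ := by ring

/-- The energy at scale `2 ^ (-j)` of a set of `α`-growth. -/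
theorem HasGrowth.sum_sum_gaussian_le {α C R : ℝ} {J j : ℕ} {P : Finset Plane} (hα2 : α ≤ 2)
    (hP : HasGrowth α C ((2 : ℝ)⁻¹ ^ J / 4) P) (hC : 0 ≤ C) (hR : 1 ≤ R)
    (hPR : ∀ p ∈ P, ‖p‖ < R) (hj : j ≤ J) :
    ∑ p ∈ P, ∑ q ∈ P, Real.exp (-(Real.pi * 4 ^ j * ‖p - q‖ ^ 2)) ≤
      8 * C ^ 2 * (16 * R) ^ α * 2 ^ (2 * α * J) * 2 ^ (-α * j) := by
  set η : ℝ := (2 : ℝ)⁻¹ ^ J / 4 with hηdef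
  have hη : 0 < η := by positivity
  have hη4 : η ≤ 1 := by
    have : (2 : ℝ)⁻¹ ^ J ≤ 1 := pow_le_one₀ (by norm_num) (by norm_num)
    linarith
  have hρ : η ≤ (2 : ℝ)⁻¹ ^ j := by
    have h1 : (2 : ℝ)⁻¹ ^ J ≤ 2⁻¹ ^ j := pow_le_pow_of_le_one (by norm_num) (by norm_num) hj
    have h2 : (0 : ℝ) ≤ 2⁻¹ ^ j := by positivity
    linarith
  have hN : (P.card : ℝ) ≤ C * (R / η) ^ α := by
    refine le_trans ?_ (hP 0 R (by linarith))
    refine Nat.cast_le.2 (Finset.card_le_card fun p hp => Finset.mem_filter.2 ⟨hp, ?_⟩)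
    rw [dist_zero_right]
    exact hPR p hp
  have hrow : ∀ p ∈ P, ∑ q ∈ P, Real.exp (-(Real.pi * 4 ^ j * ‖p - q‖ ^ 2)) ≤
      8 * (C * ((2 : ℝ)⁻¹ ^ j / η) ^ α) := by
    intro p _
    refine le_trans (le_of_eq (Finset.sum_congr rfl fun q _ => ?_))
      (hP.sum_gaussian_le hα2 hη hC hρ p)
    congr 2
    rw [dist_comm, dist_eq_norm, div_pow, ← pow_mul, mul_comm j 2, pow_mul, mul_assoc]
    have : ((2 : ℝ)⁻¹ ^ 2) ^ j = (4 ^ j)⁻¹ := by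
      rw [← inv_pow]
      norm_num
    rw [this, div_inv_eq_mul]
    ring
  calc _ ≤ ∑ p ∈ P, 8 * (C * ((2 : ℝ)⁻¹ ^ j / η) ^ α) := Finset.sum_le_sum hrow
    _ = P.card * (8 * (C * ((2 : ℝ)⁻¹ ^ j / η) ^ α)) := by rw [Finset.sum_const, nsmul_eq_mul]
    _ ≤ (C * (R / η) ^ α) * (8 * (C * ((2 : ℝ)⁻¹ ^ j / η) ^ α)) := by gcongr
    _ = 8 * C ^ 2 * ((R / η) * ((2 : ℝ)⁻¹ ^ j / η)) ^ α := by
        rw [Real.mul_rpow (by positivity) (by positivity)]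
        ring
    _ = 8 * C ^ 2 * ((16 * R) * 2 ^ (2 * (J : ℝ)) * 2 ^ (-(j : ℝ))) ^ α := by
        congr 2
        rw [Real.rpow_neg zero_le_two, Real.rpow_natCast, mul_comm 2 (J : ℝ),
          Real.rpow_mul zero_le_two, Real.rpow_natCast, Real.rpow_two, hηdef, inv_pow, inv_pow]
        field_simp
        norm_num
    _ = _ := by
        rw [Real.mul_rpow (by positivity) (by positivity),
          Real.mul_rpow (by positivity) (by positivity), ← Real.rpow_mul zero_le_two,
          ← Real.rpow_mul zero_le_two, show 2 * (J : ℝ) * α = 2 * α * J by ring,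
          show -(j : ℝ) * α = -α * j by ring]
        ring

/-- The Fourier-analytic bound for nearly unit distances in sets of `α`-growth. -/
theorem exists_card_nearUnitPairs_le_of_three_halves_sub_le {α τ C R : ℝ} (hα2 : α ≤ 2)
    (hτ : 0 ≤ τ) (hτα : 3 / 2 - α ≤ τ) (hC : 0 ≤ C) (hR : 1 ≤ R) :
    ∃ C' : ℝ, ∀ (J : ℕ) (P : Finset Plane),
      HasGrowth α C ((2 : ℝ)⁻¹ ^ J / 4) P → (∀ p ∈ P, ‖p‖ < R) →
      ((nearUnitPairs ((2 : ℝ)⁻¹ ^ J / 4) P).card : ℝ) ≤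
        C' * (J + 1) * 2 ^ ((2 * α - 1 + τ) * J) := by
  set K : ℝ := 30 * Real.exp Real.pi * (8 * C ^ 2 * (16 * R) ^ α) with hK
  have hK0 : 0 ≤ K := by positivity
  refine ⟨2 * Real.exp Real.pi * K, fun J P hP hPR => ?_⟩
  have h1 := (card_nearUnitPairs_mul_le J P).trans (sum_integral_circle_le J P)
  have h2 : ∀ j ∈ Finset.range (J + 1), 30 * Real.exp Real.pi * (√2)⁻¹ ^ j *
      (4 ^ j * ∑ p ∈ P, ∑ q ∈ P, Real.exp (-(Real.pi * 4 ^ j * ‖p - q‖ ^ 2))) ≤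
      K * 2 ^ (2 * α * J) * 2 ^ (τ * J) := by
    intro j hj
    have hjJ : j ≤ J := Nat.lt_succ_iff.1 (Finset.mem_range.1 hj)
    have e1 : (√2)⁻¹ ^ j = (2 : ℝ) ^ (-(1 / 2) * (j : ℝ)) := by
      rw [Real.rpow_mul zero_le_two, Real.rpow_natCast, Real.rpow_neg zero_le_two,
        ← Real.sqrt_eq_rpow]
    have e2 : (4 : ℝ) ^ j = 2 ^ (2 * (j : ℝ)) := by
      rw [Real.rpow_mul zero_le_two, Real.rpow_natCast, Real.rpow_two]
      norm_num
    calc _ ≤ 30 * Real.exp Real.pi * (√2)⁻¹ ^ j *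
          (4 ^ j * (8 * C ^ 2 * (16 * R) ^ α * 2 ^ (2 * α * J) * 2 ^ (-α * j))) := by
          gcongr
          exact hP.sum_sum_gaussian_le hα2 hC hR hPR hjJ
      _ = K * 2 ^ (2 * α * J) *
          (2 ^ (-(1 / 2) * (j : ℝ)) * 2 ^ (2 * (j : ℝ)) * 2 ^ (-α * j)) := by
          rw [e1, e2, hK]
          ring
      _ = K * 2 ^ (2 * α * J) * 2 ^ ((3 / 2 - α) * j) := by
          rw [← Real.rpow_add two_pos, ← Real.rpow_add two_pos]
          congr 2
          ring
      -- As `0 ≤ j ≤ J`, the exponent `(3/2 - α) * j` is at most `τ * J` both when the finest scale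
      -- dominates, `τ = 3/2 - α`, and when the coarsest does, `τ = 0`.
      _ ≤ _ := by
          have hj0 : (0 : ℝ) ≤ j := Nat.cast_nonneg j
          have hjJ' : (j : ℝ) ≤ J := Nat.cast_le.2 hjJ
          gcongr
          · exact one_le_two
  have h3 := h1.trans (Finset.sum_le_sum h2)
  rw [Finset.sum_const, Finset.card_range, nsmul_eq_mul] at h3
  have hE : Real.exp (-Real.pi) * Real.exp Real.pi = 1 := by
    rw [← Real.exp_add, neg_add_cancel, Real.exp_zero]
  have hJ2 : (2 : ℝ) ^ (-(J : ℝ)) * 2 ^ J = 1 := by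
    rw [Real.rpow_neg zero_le_two, Real.rpow_natCast]
    exact inv_mul_cancel₀ (by positivity)
  -- Each pair has weight `2 ^ J * exp (-π) / 2` in the smoothed count; dividing by it produces the
  -- `-1` in the exponent.
  calc ((nearUnitPairs ((2 : ℝ)⁻¹ ^ J / 4) P).card : ℝ)
      = ((nearUnitPairs ((2 : ℝ)⁻¹ ^ J / 4) P).card : ℝ) * (2 ^ J * Real.exp (-Real.pi) / 2) *
          (2 * Real.exp Real.pi * 2 ^ (-(J : ℝ))) := by
        linear_combination (-((nearUnitPairs ((2 : ℝ)⁻¹ ^ J / 4) P).card : ℝ)) * hE -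
          ((nearUnitPairs ((2 : ℝ)⁻¹ ^ J / 4) P).card : ℝ) *
            (Real.exp (-Real.pi) * Real.exp Real.pi) * hJ2
    _ ≤ ((J + 1 : ℕ) * (K * 2 ^ (2 * α * J) * 2 ^ (τ * J))) *
          (2 * Real.exp Real.pi * 2 ^ (-(J : ℝ))) := by gcongr
    _ = 2 * Real.exp Real.pi * K * (J + 1) *
          (2 ^ (2 * α * J) * 2 ^ (τ * J) * 2 ^ (-(J : ℝ))) := by
        push_cast
        ring
    _ = _ := by
        rw [← Real.rpow_add two_pos, ← Real.rpow_add two_pos]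
        congr 2
        ring

/-! ### Conclusion -/

theorem unitDistanceDim_le {α t : ℝ} (ht : 0 ≤ t)
    (h : ∀ C R : ℝ, 0 ≤ C → 1 ≤ R → ∃ C' : ℝ, ∀ (J : ℕ) (P : Finset Plane),
      HasGrowth α C ((2 : ℝ)⁻¹ ^ J / 4) P → (∀ p ∈ P, ‖p‖ < R) →
      ((nearUnitPairs ((2 : ℝ)⁻¹ ^ J / 4) P).card : ℝ) ≤ C' * (J + 1) * 2 ^ (t * J)) :
    unitDistanceDim 2 α ≤ (t : EReal) := by
  refine sSup_le ?_
  rintro _ ⟨K, hK, -, hd, rfl⟩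
  exact upperMinkowskiDim_unitDistancePairs_le ht hK hd h

theorem theorem3 :
    (∀ α : ℝ, 0 < α → α ≤ 1 →
      ((3 * α / 2 : ℝ) : EReal) ≤ unitDistanceDim 2 α ∧
      unitDistanceDim 2 α ≤ ((min (5 * α / 3) (α * (2 + α) / (1 + α)) : ℝ) : EReal)) ∧
    (∀ α : ℝ, 1 ≤ α → α ≤ 3 / 2 →
      unitDistanceDim 2 α = ((α + 1 / 2 : ℝ) : EReal)) ∧
    (∀ α : ℝ, 3 / 2 ≤ α → α ≤ 2 →
      unitDistanceDim 2 α = ((2 * α - 1 : ℝ) : EReal)) := by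
  refine ⟨fun α h0 h1 => ⟨three_mul_div_two_le_unitDistanceDim h0 h1, ?_⟩,
    fun α h1 h2 => le_antisymm ?_ (add_half_le_unitDistanceDim h1 (by linarith)),
    fun α h1 h2 => le_antisymm ?_ (two_mul_sub_one_le_unitDistanceDim (by linarith) h2)⟩
  · refine (unitDistanceDim_le (t := 3 * α / 2) (by positivity) fun C R hC hR =>
      exists_card_nearUnitPairs_le_three_halves h0.le hC hR).trans (EReal.coe_le_coe_iff.2 ?_)
    -- The annulus bound `3α/2` is stronger than required: `3/2 ≤ (2 + α) / (1 + α)` is equivalent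
    -- to `α ≤ 1`.
    refine le_min (by linarith) ?_
    rw [div_le_div_iff₀ two_pos (by linarith)]
    nlinarith
  · refine unitDistanceDim_le (by linarith) fun C R hC hR => ?_
    have := exists_card_nearUnitPairs_le_of_three_halves_sub_le (α := α) (τ := 3 / 2 - α)
      (by linarith) (by linarith) le_rfl hC hR
    rwa [show 2 * α - 1 + (3 / 2 - α) = α + 1 / 2 by ring] at this
  · refine unitDistanceDim_le (by linarith) fun C R hC hR => ?_
    have := exists_card_nearUnitPairs_le_of_three_halves_sub_le (α := α) (τ := 0) h2 le_rfl
      (by linarith) hC hR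
    rwa [add_zero] at this
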